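/- Conventions. A binary NPTM $M$ is a nondeterministic polynomial-time Turing machine in which every nondeterministic step has exactly two choices. $\mathrm{TotP}$ is the class of functions $f:\{0,1\}^*\to\mathbb N$ for which there is a binary NPTM $M$ whose number of computation paths on every input $x$ is $f(x)+1$; equivalently, the computation tree of $M$ on $x$ has exactly $f(x)$ branchings (internal nodes). Theorem. Let $f\in\mathrm{TotP}$, let $M$ be any binary NPTM with $f(x)+1$ computation paths on every input $x$, and let $n':\{0,1\}^*\to\mathbb N$ be a polynomially bounded function such that on every $x$ the machine $M$ makes at most $n'(x)$ nondeterministic choices on each path (for instance, $n'(x)$ is the height of the computation tree of $M$ on $x$). Write $n=|x|$ and $n'=n'(x)$. Then there are polynomials $p$ and $q$, depending only on $f$, $M$ and the function $n'$, such that the following holds for each of the time bounds 1. $B=\dfrac{2^{n'}}{s(n')}+2^{n'/2}s(n')^{1/2}$, for every $s:\mathbb N\to\mathbb N$ with positive values; 2. $B=2^{(1-\beta)n'}+2^{(1+\beta)n'/2}$, for every real $\beta\in(0,1)$; 3. $B=2^{2n'/3}$. (a) (Randomized approximation scheme.) There is a randomized Turing machine which, for all $x\in\{0,1\}^*$ and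 all real $k>0$ and $\delta\in(0,1)$, given $x$ and the integers $n'(x)$, $\lceil k\rceil$, $\lceil\log_2\delta^{-1}\rceil$ in unary, halts on all coin tosses within $p(k,n,\log\delta^{-1})\cdot B$ steps and, with probability at least $1-\delta$, outputs a natural number $\hat f(x)$ with $(1-\frac1k)f(x)\le\hat f(x)\le(1+\frac1k)f(x)$. (b) (Uniform sampling.) There is a randomized Turing machine which, for all $x\in\{0,1\}^*$ and all real $\delta\in(0,1)$, given $x$ and the integers $n'(x)$, $\lceil\log_2\delta^{-1}\rceil$ in unary, halts on all coin tosses within $q(n,\log\delta^{-1})\cdot B$ steps and outputs either a failure symbol or a branching of the computation tree of $M$ on $x$ (described by the sequence of choices leading to it). If $f(x)>0$, it fails with probability at most $\delta$, and conditioned on not failing its output is exactly uniformly distributed over the $f(x)$ branchings. -/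

import Mathlib

open Turing

/-- Finite binary trees with leaves labelled by elements of `C`. They serve as computation trees:
a leaf carries the halting configuration, an internal node is a nondeterministic binary choice. -/
inductive CompTree (C : Type) : Type
  | leaf (c : C) : CompTree C
  | node (l r : CompTree C) : CompTree C

namespace CompTree

variable {C : Type}

/-- The number of leaves, that is, of computation paths. -/
def numLeaves : CompTree C → ℕ
  | leaf _ => 1
  | node l r => l.numLeaves + r.numLeaves

/-- The largest number of choices made on a path from the root to a leaf. -/
def height : CompTree C → ℕ
  | leaf _ => 0
  | node l r => max l.height r.height + 1

/-- `T.IsBranching w`: following the choices `w` (first choice first, `false` for the left subtree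
and `true` for the right one) from the root leads to an internal node of `T`. -/
def IsBranching : CompTree C → List Bool → Prop
  | leaf _, _ => False
  | node _ _, [] => True
  | node l _, false :: w => l.IsBranching w
  | node _ r, true :: w => r.IsBranching w

open Classical in
/-- The probability that the leaf reached by independent fair coin tosses satisfies `P`. -/
noncomputable def prob (P : C → Prop) : CompTree C → ℝ
  | leaf c => if P c then 1 else 0
  | node l r => (l.prob P + r.prob P) / 2

end CompTree

/-- A Turing machine with finitely many work tapes and binary choices, in Mathlib's `TM2`
presentation (tapes are given by stacks, a tape being a pair of stacks), with `a` input words and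
one output word. In each control state the machine makes either one deterministic step, or a
choice between exactly two steps. The choice is read as a nondeterministic one or as the toss of
a fair coin, so that the same machines serve as nondeterministic and as randomized machines. -/
structure ChoiceTM (a : ℕ) where
  /-- the stacks -/
  K : Type
  [decEqK : DecidableEq K]
  [finK : Fintype K]
  /-- the stack that initially holds the `i`-th input word -/
  inp : Fin a ↪ K
  /-- the stack that holds the output when the machine halts -/
  out : K
  /-- the tape alphabet -/
  Γ : Type
  [finΓ : Fintype Γ]
  /-- the letters `0` and `1` of the tape alphabet -/
  bit : Bool ↪ Γ
  /-- the control states, with the initial one -/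
  Λ : Type
  [finΛ : Fintype Λ]
  main : Λ
  /-- the contents of the finite internal memory, with the initial one -/
  σ : Type
  [finσ : Fintype σ]
  init₀ : σ
  /-- the program: a deterministic step, or a choice between two steps -/
  code : Λ → TM2.Stmt (fun _ : K => Γ) Λ σ ⊕
    (TM2.Stmt (fun _ : K => Γ) Λ σ × TM2.Stmt (fun _ : K => Γ) Λ σ)

namespace ChoiceTM

variable {a : ℕ}

attribute [instance] decEqK finK finΓ finΛ finσ

/-- The configurations of a machine. -/
abbrev Cfg (M : ChoiceTM a) : Type := TM2.Cfg (fun _ : M.K => M.Γ) M.Λ M.σ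

/-- The initial configuration on the input words `w 0, …, w (a - 1)`; all other stacks are empty. -/
noncomputable def init (M : ChoiceTM a) (w : Fin a → List Bool) : M.Cfg where
  l := some M.main
  var := M.init₀
  stk := Function.extend M.inp (fun i => (w i).map M.bit) (fun _ => [])

/-- `M.Runs c t T`: started in `c`, the machine halts on all computation paths, `t` is the number
of steps of the longest one, and `T` is the tree of all computations. -/
inductive Runs (M : ChoiceTM a) : M.Cfg → ℕ → CompTree M.Cfg → Prop
  | halt (v : M.σ) (S : M.K → List M.Γ) : Runs M ⟨none, v, S⟩ 0 (.leaf ⟨none, v, S⟩)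
  | step {l : M.Λ} {v : M.σ} {S : M.K → List M.Γ} {q : TM2.Stmt (fun _ : M.K => M.Γ) M.Λ M.σ}
      {t : ℕ} {T : CompTree M.Cfg} (hq : M.code l = .inl q)
      (h : Runs M (TM2.stepAux q v S) t T) : Runs M ⟨some l, v, S⟩ (t + 1) T
  | choose {l : M.Λ} {v : M.σ} {S : M.K → List M.Γ}
      {q₀ q₁ : TM2.Stmt (fun _ : M.K => M.Γ) M.Λ M.σ}
      {t₀ t₁ : ℕ} {T₀ T₁ : CompTree M.Cfg} (hq : M.code l = .inr (q₀, q₁))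
      (h₀ : Runs M (TM2.stepAux q₀ v S) t₀ T₀) (h₁ : Runs M (TM2.stepAux q₁ v S) t₁ T₁) :
      Runs M ⟨some l, v, S⟩ (max t₀ t₁ + 1) (.node T₀ T₁)

/-- The machine has halted in `c` with output word `w`. -/
def Outputs (M : ChoiceTM a) (w : List Bool) (c : M.Cfg) : Prop := c.stk M.out = w.map M.bit

/-- `M` is a nondeterministic polynomial time machine whose number of computation paths on every
input `x` is `f x + 1`. Since all choices are binary, `f x` is then also the number of branchings
(internal nodes) of the computation tree. -/
def CountsPaths (M : ChoiceTM 1) (f : List Bool → ℕ) : Prop :=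
  ∃ p : Polynomial ℕ, ∀ x : List Bool, ∃ (t : ℕ) (T : CompTree M.Cfg),
    M.Runs (M.init ![x]) t T ∧ t ≤ p.eval x.length ∧ T.numLeaves = f x + 1

/-- On each input `x` the machine makes at most `n' x` choices on every path, and `n'` is
polynomially bounded. For a polynomial time machine this includes the case that `n' x` is exactly
the height of the computation tree. -/
def ChoicesBoundedBy (M : ChoiceTM 1) (n' : List Bool → ℕ) : Prop :=
  (∀ (x : List Bool) (t : ℕ) (T : CompTree M.Cfg), M.Runs (M.init ![x]) t T → T.height ≤ n' x) ∧
    ∃ q : Polynomial ℕ, ∀ x : List Bool, n' x ≤ q.eval x.length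

end ChoiceTM

/-- The class `TotP`. -/
def TotP : Set (List Bool → ℕ) := {f | ∃ M : ChoiceTM 1, M.CountsPaths f}

/-- The natural number `m` written in unary. -/
def unary (m : ℕ) : List Bool := List.replicate m true

/-- `f` has a randomized approximation scheme that, given `x`, `n' x`, the accuracy `k` and the
confidence `δ`, runs in time `p(k, |x|, log δ⁻¹) * B (n' x)` on all coin tosses and outputs (in
binary, least significant bit first) a `(1 ± 1/k)`-approximation of `f x` with probability at least
`1 - δ`. The real parameters are presented to the machine as `⌈k⌉` and `⌈log₂ δ⁻¹⌉`. -/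
def HasRAS (f n' : List Bool → ℕ) (p : MvPolynomial (Fin 3) ℝ) (B : ℕ → ℝ) : Prop :=
  ∃ A : ChoiceTM 4, ∀ (x : List Bool) (k δ : ℝ), 0 < k → 0 < δ → δ < 1 →
    ∃ (t : ℕ) (T : CompTree A.Cfg),
      A.Runs (A.init ![x, unary (n' x), unary ⌈k⌉₊, unary ⌈Real.logb 2 δ⁻¹⌉₊]) t T ∧
      (t : ℝ) ≤ p.eval ![k, (x.length : ℝ), Real.log δ⁻¹] * B (n' x) ∧
      1 - δ ≤ T.prob (fun c => ∃ y : ℕ, A.Outputs y.bits c ∧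
        (1 - 1 / k) * (f x : ℝ) ≤ y ∧ (y : ℝ) ≤ (1 + 1 / k) * (f x : ℝ))

/-- The output format of a sampler: the empty word reports failure, and `1w` is the sample `w`. -/
def sampleCode : Option (List Bool) → List Bool
  | none => []
  | some w => true :: w

/-- The branchings of the computation tree of `M` can be sampled uniformly: there is a randomized
machine that, given `x`, `n' x` and `δ` (as `⌈log₂ δ⁻¹⌉`), runs in time
`p(|x|, log δ⁻¹) * B (n' x)` on all coin tosses, fails with probability at most `δ` if there is a
branching, and otherwise outputs a branching (given by the choices that lead to it), all branchings
being equally likely. -/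
def HasUniformSampler (M : ChoiceTM 1) (f n' : List Bool → ℕ) (p : MvPolynomial (Fin 2) ℝ)
    (B : ℕ → ℝ) : Prop :=
  ∃ A : ChoiceTM 3, ∀ (x : List Bool) (δ : ℝ), 0 < δ → δ < 1 →
    ∃ (t : ℕ) (T : CompTree A.Cfg),
      A.Runs (A.init ![x, unary (n' x), unary ⌈Real.logb 2 δ⁻¹⌉₊]) t T ∧
      (t : ℝ) ≤ p.eval ![(x.length : ℝ), Real.log δ⁻¹] * B (n' x) ∧
      T.prob (fun c => ∃ o, A.Outputs (sampleCode o) c) = 1 ∧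
      (0 < f x → T.prob (A.Outputs (sampleCode none)) ≤ δ) ∧
      ∀ (s : ℕ) (S : CompTree M.Cfg), M.Runs (M.init ![x]) s S → ∀ w : List Bool,
        (S.IsBranching w → T.prob (A.Outputs (sampleCode (some w))) =
          (1 - T.prob (A.Outputs (sampleCode none))) / (f x : ℝ)) ∧
        (¬ S.IsBranching w → T.prob (A.Outputs (sampleCode (some w))) = 0)

/-!
Each of the three time bounds is at least `2 ^ (n' / 2)`, so it suffices to construct one
approximation scheme and one sampler that run in time `2 ^ (n' / 2)`, up to a polynomial factor.

Both machines use two procedures. The first one simulates `M` along a given sequence of choices and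
decides whether it leads to a branching (`does_test`). With it, one can walk through the computation
tree in depth-first order while keeping only the address of the current node; a complete traversal
takes `2 f(x) + 1` steps and meets each branching once (`CompTree.walk_subtree`). The second one
generates a random node of the complete binary tree of height `n'`, each of the `2 ^ n' - 1`
addresses having probability `2 ^ (-n')`: toss `n'` coins and take what follows the first head
(`CompTree.prob_extendT_some`). Such a node is a branching of `M` with probability `f(x) / 2 ^ n'`.

The approximation scheme walks for about `2 ^ (n' / 2) k² log δ⁻¹` steps. If the walk has ended,
`f(x)` is known exactly. Otherwise `f(x)` is at least half the number of steps, so that among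
`2 ^ ⌈n' / 2⌉` random nodes the expected number of branchings is at least of the order of
`k² log δ⁻¹`, and by Chernoff's bound (`CompTree.prob_deviation_le`) the number found, multiplied by
`2 ^ ⌊n' / 2⌋`, is an accurate estimate (`CompTree.prob_estimate_ge`). The factor is a power of two,
so the multiplication prepends zeros to a binary number.

The sampler walks for `2 ^ ⌈n' / 2⌉` steps. If the walk has not ended, a random node is a branching
with probability at least of the order of `2 ^ (-n' / 2)`, and one rejects the nodes that are not
branchings. If the walk has ended, `f(x)` is known, and one takes the node at which the walk arrives
after a random number of less than `2 ^ h` steps, where `2 ^ h` is between `2 f(x) + 1` and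
`4 f(x)`; then a trial succeeds with probability at least `1 / 4`. In both cases all branchings are
equally likely in each trial, hence also in the repetition of trials until the first success
(`CompTree.prob_retry_eq`), and the number of trials is chosen such that they all fail with
probability at most `δ` (`CompTree.prob_fail_le`).

The machines are obtained from programs of a small language (`Prog`), which has assignments to the
finite memory, stack operations, coin tosses, and loops. The semantics `Prog.Exec` of a program
records its running time and the tree of its computations, and `ChoiceTM.runsIn_of_exec` shows that
the compiled machine has the same ones. The programs are analysed by rules in the style of Hoare
logic: `Does` specifies a program that tosses no coins, and `Yields` one whose outcomes form a given
tree, in which the probabilities are then computed.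
-/

/-! ### Trees as a monad, and expectations over them -/

namespace CompTree

variable {C D E ι : Type}

/-- Grafts the tree `F c` in place of every leaf labelled `c`. -/
def bind : CompTree C → (C → CompTree D) → CompTree D
  | leaf c, F => F c
  | node l r, F => node (l.bind F) (r.bind F)

/-- Relabels the leaves. -/
def map (g : C → D) (T : CompTree C) : CompTree D := T.bind fun c => leaf (g c)

/-- `T.Mem c`: some leaf of `T` is labelled `c`. -/
def Mem : CompTree C → C → Prop
  | leaf c, d => d = c
  | node l r, d => l.Mem d ∨ r.Mem d

@[simp] lemma bind_leaf (c : C) (F : C → CompTree D) : (leaf c).bind F = F c := rfl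

@[simp] lemma bind_node (l r : CompTree C) (F : C → CompTree D) :
    (node l r).bind F = node (l.bind F) (r.bind F) := rfl

@[simp] lemma map_leaf (c : C) (g : C → D) : (leaf c).map g = leaf (g c) := rfl

@[simp] lemma map_node (l r : CompTree C) (g : C → D) :
    (node l r).map g = node (l.map g) (r.map g) := rfl

@[simp] lemma mem_leaf (c d : C) : (leaf c).Mem d ↔ d = c := Iff.rfl

@[simp] lemma mem_node (l r : CompTree C) (d : C) : (node l r).Mem d ↔ l.Mem d ∨ r.Mem d := Iff.rfl

lemma bind_assoc (T : CompTree C) (F : C → CompTree D) (G : D → CompTree E) :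
    (T.bind F).bind G = T.bind fun c => (F c).bind G := by
  induction T with
  | leaf c => rfl
  | node l r hl hr => simp [hl, hr]

lemma bind_map (T : CompTree C) (g : C → D) (F : D → CompTree E) :
    (T.map g).bind F = T.bind fun c => F (g c) := by
  simp [map, bind_assoc]

lemma map_bind (T : CompTree C) (F : C → CompTree D) (g : D → E) :
    (T.bind F).map g = T.bind fun c => (F c).map g := by
  simp [map, bind_assoc]

lemma map_map (T : CompTree C) (g : C → D) (h : D → E) :
    (T.map g).map h = T.map fun c => h (g c) := by
  simp [map, bind_assoc]

lemma bind_congr (T : CompTree C) {F G : C → CompTree D} (h : ∀ c, T.Mem c → F c = G c) :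
    T.bind F = T.bind G := by
  induction T with
  | leaf c => exact h c rfl
  | node l r hl hr =>
    simp [hl fun c hc => h c (Or.inl hc), hr fun c hc => h c (Or.inr hc)]

lemma map_congr (T : CompTree C) {g h : C → D} (H : ∀ c, T.Mem c → g c = h c) :
    T.map g = T.map h :=
  bind_congr T fun c hc => by rw [H c hc]

@[simp] lemma bind_pure (T : CompTree C) : T.bind leaf = T := by
  induction T with
  | leaf c => rfl
  | node l r hl hr => simp [hl, hr]

lemma mem_bind {T : CompTree C} {F : C → CompTree D} {d : D} :
    (T.bind F).Mem d ↔ ∃ c, T.Mem c ∧ (F c).Mem d := by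
  induction T with
  | leaf c => simp
  | node l r hl hr =>
    simp only [bind_node, mem_node, hl, hr]
    constructor
    · rintro (⟨c, h, h'⟩ | ⟨c, h, h'⟩)
      exacts [⟨c, Or.inl h, h'⟩, ⟨c, Or.inr h, h'⟩]
    · rintro ⟨c, h | h, h'⟩
      exacts [Or.inl ⟨c, h, h'⟩, Or.inr ⟨c, h, h'⟩]

lemma mem_map {T : CompTree C} {g : C → D} {d : D} :
    (T.map g).Mem d ↔ ∃ c, T.Mem c ∧ d = g c := mem_bind

/-- The expectation of `g` at the leaf reached by independent fair coin tosses. -/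
noncomputable def expect (g : C → ℝ) : CompTree C → ℝ
  | leaf c => g c
  | node l r => (l.expect g + r.expect g) / 2

@[simp] lemma expect_leaf (g : C → ℝ) (c : C) : (leaf c).expect g = g c := rfl

@[simp] lemma expect_node (g : C → ℝ) (l r : CompTree C) :
    (node l r).expect g = (l.expect g + r.expect g) / 2 := rfl

lemma expect_bind (g : D → ℝ) (T : CompTree C) (F : C → CompTree D) :
    (T.bind F).expect g = T.expect fun c => (F c).expect g := by
  induction T with
  | leaf c => rfl
  | node l r hl hr => simp [hl, hr]

lemma expect_map (g : D → ℝ) (T : CompTree C) (h : C → D) :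
    (T.map h).expect g = T.expect fun c => g (h c) := expect_bind _ _ _

lemma expect_mono {g h : C → ℝ} {T : CompTree C} (H : ∀ c, T.Mem c → g c ≤ h c) :
    T.expect g ≤ T.expect h := by
  induction T with
  | leaf c => exact H c rfl
  | node l r hl hr =>
    have h1 := hl fun c hc => H c (Or.inl hc)
    have h2 := hr fun c hc => H c (Or.inr hc)
    simp only [expect_node]; linarith

lemma expect_congr {g h : C → ℝ} {T : CompTree C} (H : ∀ c, T.Mem c → g c = h c) :
    T.expect g = T.expect h :=
  le_antisymm (expect_mono fun c hc => (H c hc).le) (expect_mono fun c hc => (H c hc).ge)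

@[simp] lemma expect_const (a : ℝ) (T : CompTree C) : (T.expect fun _ => a) = a := by
  induction T with
  | leaf c => rfl
  | node l r hl hr => simp [hl, hr]

lemma expect_add (g h : C → ℝ) (T : CompTree C) :
    (T.expect fun c => g c + h c) = T.expect g + T.expect h := by
  induction T with
  | leaf c => rfl
  | node l r hl hr => simp only [expect_node, hl, hr]; ring

lemma expect_mul_left (a : ℝ) (g : C → ℝ) (T : CompTree C) :
    (T.expect fun c => a * g c) = a * T.expect g := by
  induction T with
  | leaf c => rfl
  | node l r hl hr => simp only [expect_node, hl, hr]; ring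

lemma expect_sum (s : Finset ι) (g : ι → C → ℝ) (T : CompTree C) :
    (T.expect fun c => ∑ i ∈ s, g i c) = ∑ i ∈ s, T.expect (g i) := by
  induction T with
  | leaf c => rfl
  | node l r hl hr => simp only [expect_node, hl, hr, ← Finset.sum_add_distrib, Finset.sum_div]

open Classical in
lemma prob_eq_expect (P : C → Prop) (T : CompTree C) :
    T.prob P = T.expect fun c => if P c then 1 else 0 := by
  induction T with
  | leaf c => simp [prob]
  | node l r hl hr => simp [prob, hl, hr]

lemma prob_map (P : D → Prop) (T : CompTree C) (g : C → D) :
    (T.map g).prob P = T.prob fun c => P (g c) := by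
  classical
  simp only [prob_eq_expect, expect_map]

lemma prob_mono {P Q : C → Prop} {T : CompTree C} (H : ∀ c, T.Mem c → P c → Q c) :
    T.prob P ≤ T.prob Q := by
  classical
  simp only [prob_eq_expect]
  refine expect_mono fun c hc => ?_
  have := H c hc
  by_cases h1 : P c
  · simp [h1, this h1]
  · by_cases h2 : Q c <;> simp [h1, h2]

lemma prob_congr {P Q : C → Prop} {T : CompTree C} (H : ∀ c, T.Mem c → (P c ↔ Q c)) :
    T.prob P = T.prob Q :=
  le_antisymm (prob_mono fun c hc => (H c hc).1) (prob_mono fun c hc => (H c hc).2)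

lemma prob_not (P : C → Prop) (T : CompTree C) : (T.prob fun c => ¬ P c) = 1 - T.prob P := by
  induction T with
  | leaf c => by_cases h : P c <;> simp [prob, h]
  | node l r hl hr => simp only [prob, hl, hr]; ring

/-- `F` applied `N` times in succession, starting from `a`. -/
def iter (F : C → CompTree C) : ℕ → C → CompTree C
  | 0, a => leaf a
  | N + 1, a => (F a).bind (iter F N)

lemma iter_add (F : C → CompTree C) (m n : ℕ) (a : C) :
    iter F (m + n) a = (iter F m a).bind (iter F n) := by
  induction m generalizing a with
  | zero => simp [iter]
  | succ m ih =>
    rw [Nat.add_right_comm, iter, iter, bind_assoc]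
    exact bind_congr _ fun c _ => ih c

lemma iter_leaf (G : C → C) (N : ℕ) (a : C) :
    iter (fun c => leaf (G c)) N a = leaf (G^[N] a) := by
  induction N generalizing a with
  | zero => rfl
  | succ N ih => simp [iter, ih]

end CompTree

/-! ### Structured randomized programs on stacks -/

/-- Structured programs over stacks indexed by `K`, with stack alphabet `Γ` and internal memory `σ`.
`dyn p` continues with the program selected by the memory, `loop b p` is a while loop, and
`toss f` tosses a fair coin and lets `f` store the outcome. -/
inductive Prog (K Γ σ : Type) : Type
  | push (k : K) (f : σ → Γ)
  | peek (k : K) (f : σ → Option Γ → σ)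
  | pop (k : K) (f : σ → Option Γ → σ)
  | load (f : σ → σ)
  | toss (f : σ → Bool → σ)
  | seq (p q : Prog K Γ σ)
  | dyn (p : σ → Prog K Γ σ)
  | loop (b : σ → Bool) (p : Prog K Γ σ)

namespace Prog

variable {K Γ σ Λ : Type}

infixr:60 " ;; " => Prog.seq

/-- The control states of the machine that executes a program. -/
def Lab : Prog K Γ σ → Type
  | push _ _ => Unit
  | peek _ _ => Unit
  | pop _ _ => Unit
  | load _ => Unit
  | toss _ => Unit
  | seq p q => p.Lab ⊕ q.Lab
  | dyn p => Unit ⊕ (Σ v, (p v).Lab)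
  | loop _ p => Unit ⊕ p.Lab

lemma finite_lab [Finite σ] (p : Prog K Γ σ) : Finite p.Lab := by
  induction p with
  | seq p q hp hq => exact @Finite.instSum _ _ hp hq
  | dyn p h =>
    have := h
    exact @Finite.instSum _ _ _ (@Finite.instSigma _ _ _ h)
  | loop b p h => exact @Finite.instSum _ _ _ h
  | _ => exact inferInstanceAs (Finite Unit)

/-- The control state in which the execution starts. -/
def entry : (p : Prog K Γ σ) → p.Lab
  | push _ _ => ()
  | peek _ _ => ()
  | pop _ _ => ()
  | load _ => ()
  | toss _ => ()
  | seq p _ => Sum.inl p.entry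
  | dyn _ => Sum.inl ()
  | loop _ _ => Sum.inl ()

/-- The machine code of a program, for a machine in which `e` embeds the control states of the
program and `x` is the control state in which to continue afterwards. -/
def code : (p : Prog K Γ σ) → (e : p.Lab → Λ) → (x : Λ) → p.Lab →
    TM2.Stmt (fun _ : K => Γ) Λ σ ⊕ (TM2.Stmt (fun _ : K => Γ) Λ σ × TM2.Stmt (fun _ : K => Γ) Λ σ)
  | push k f, _, x, _ => .inl (.push k f (.goto fun _ => x))
  | peek k f, _, x, _ => .inl (.peek k f (.goto fun _ => x))
  | pop k f, _, x, _ => .inl (.pop k f (.goto fun _ => x))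
  | load f, _, x, _ => .inl (.load f (.goto fun _ => x))
  | toss f, _, x, _ =>
    .inr (.load (fun v => f v false) (.goto fun _ => x),
      .load (fun v => f v true) (.goto fun _ => x))
  | seq p q, e, _, .inl a => p.code (fun b => e (.inl b)) (e (.inr q.entry)) a
  | seq _ q, e, x, .inr a => q.code (fun b => e (.inr b)) x a
  | dyn p, e, _, .inl _ => .inl (.goto fun v => e (.inr ⟨v, (p v).entry⟩))
  | dyn p, e, x, .inr ⟨v, a⟩ => (p v).code (fun b => e (.inr ⟨v, b⟩)) x a
  | loop b p, e, x, .inl _ =>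
    .inl (.branch b (.goto fun _ => e (.inr p.entry)) (.goto fun _ => x))
  | loop _ p, e, _, .inr a => p.code (fun b => e (.inr b)) (e (.inl ())) a

variable [DecidableEq K]

/-- `Exec p s t T`: started in the memory and stack contents `s`, the program `p` halts within `t`
steps on all coin tosses, and `T` is the tree of its possible final states. In a composition,
the final states `g i` of the first part carry an index `i`, from which the rest is computed. -/
inductive Exec : Prog K Γ σ → σ × (K → List Γ) → ℕ → CompTree (σ × (K → List Γ)) → Prop
  | push (k f v S) : Exec (push k f) (v, S) 1 (.leaf (v, Function.update S k (f v :: S k)))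
  | peek (k f v S) : Exec (peek k f) (v, S) 1 (.leaf (f v (S k).head?, S))
  | pop (k f v S) : Exec (pop k f) (v, S) 1
      (.leaf (f v (S k).head?, Function.update S k (S k).tail))
  | load (f v S) : Exec (load f) (v, S) 1 (.leaf (f v, S))
  | toss (f v S) : Exec (toss f) (v, S) 1 (.node (.leaf (f v false, S)) (.leaf (f v true, S)))
  | seq {p q s t t'} {ι : Type} {T : CompTree ι} {g : ι → σ × (K → List Γ)}
      {F : ι → CompTree (σ × (K → List Γ))} (h : Exec p s t (T.map g))
      (h' : ∀ i, T.Mem i → Exec q (g i) t' (F i)) : Exec (seq p q) s (t + t') (T.bind F)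
  | dyn {p v S t T} (h : Exec (p v) (v, S) t T) : Exec (dyn p) (v, S) (t + 1) T
  | loop_done {b p v S} (hb : b v = false) : Exec (loop b p) (v, S) 1 (.leaf (v, S))
  | loop_step {b p v S t t'} {ι : Type} {T : CompTree ι} {g : ι → σ × (K → List Γ)}
      {F : ι → CompTree (σ × (K → List Γ))} (hb : b v = true) (h : Exec p (v, S) t (T.map g))
      (h' : ∀ i, T.Mem i → Exec (loop b p) (g i) t' (F i)) :
      Exec (loop b p) (v, S) (t + t' + 1) (T.bind F)
  | mono {p s t t' T} (h : Exec p s t T) (ht : t ≤ t') : Exec p s t' T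

/-- A program adds at most one letter to each stack per step. -/
lemma Exec.length_le {p : Prog K Γ σ} {s : σ × (K → List Γ)} {t : ℕ}
    {T : CompTree (σ × (K → List Γ))} (h : Exec p s t T) :
    ∀ c, T.Mem c → ∀ k, (c.2 k).length ≤ (s.2 k).length + t := by
  induction h with
  | push k f v S =>
    rintro c rfl k'
    by_cases h : k' = k
    · subst h; simp
    · simp [Function.update_of_ne h]
  | peek k f v S => rintro c rfl k'; simp
  | pop k f v S =>
    rintro c rfl k'
    by_cases h : k' = k
    · subst h; simp; omega
    · simp [Function.update_of_ne h]
  | load f v S => rintro c rfl k'; simp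
  | toss f v S => rintro c (rfl | rfl) k' <;> simp
  | seq h h' ih ih' =>
    intro c hc k
    obtain ⟨i, hi, hc⟩ := CompTree.mem_bind.1 hc
    have h1 := ih _ (CompTree.mem_map.2 ⟨i, hi, rfl⟩) k
    have h2 := ih' i hi c hc k
    omega
  | dyn h ih => intro c hc k; have := ih c hc k; simp only at this ⊢; omega
  | loop_done hb => rintro c rfl k; simp
  | loop_step hb h h' ih ih' =>
    intro c hc k
    obtain ⟨i, hi, hc⟩ := CompTree.mem_bind.1 hc
    have h1 := ih _ (CompTree.mem_map.2 ⟨i, hi, rfl⟩) k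
    have h2 := ih' i hi c hc k
    simp only at h1 h2 ⊢
    omega
  | mono h ht ih => intro c hc k; have := ih c hc k; omega

end Prog

namespace ChoiceTM

variable {a : ℕ}

lemma Runs.unique {M : ChoiceTM a} {c : M.Cfg} {t t' : ℕ} {T T' : CompTree M.Cfg}
    (h : M.Runs c t T) (h' : M.Runs c t' T') : t = t' ∧ T = T' := by
  induction h generalizing t' T' with
  | halt v S => cases h'; exact ⟨rfl, rfl⟩
  | step hq h ih =>
    cases h' with
    | step hq' h' =>
      obtain rfl := Sum.inl.inj (hq.symm.trans hq')
      obtain ⟨rfl, rfl⟩ := ih h'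
      exact ⟨rfl, rfl⟩
    | choose hq' h₀' h₁' => cases hq.symm.trans hq'
  | choose hq h₀ h₁ ih₀ ih₁ =>
    cases h' with
    | step hq' h' => cases hq.symm.trans hq'
    | choose hq' h₀' h₁' =>
      obtain ⟨rfl, rfl⟩ := Prod.mk.inj (Sum.inr.inj (hq.symm.trans hq'))
      obtain ⟨rfl, rfl⟩ := ih₀ h₀'
      obtain ⟨rfl, rfl⟩ := ih₁ h₁'
      exact ⟨rfl, rfl⟩

/-- The machine halts within `t` steps on all paths, and `T` is its computation tree. -/
def RunsIn (M : ChoiceTM a) (c : M.Cfg) (t : ℕ) (T : CompTree M.Cfg) : Prop :=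
  ∃ t' ≤ t, M.Runs c t' T

lemma RunsIn.mono {M : ChoiceTM a} {c : M.Cfg} {t t' : ℕ} {T : CompTree M.Cfg}
    (h : M.RunsIn c t T) (ht : t ≤ t') : M.RunsIn c t' T :=
  let ⟨s, hs, h⟩ := h; ⟨s, hs.trans ht, h⟩

lemma RunsIn.unique {M : ChoiceTM a} {c : M.Cfg} {t t' : ℕ} {T T' : CompTree M.Cfg}
    (h : M.RunsIn c t T) (h' : M.RunsIn c t' T') : T = T' :=
  let ⟨_, _, h⟩ := h; let ⟨_, _, h'⟩ := h'; (h.unique h').2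

lemma RunsIn.step {M : ChoiceTM a} {l : M.Λ} {v : M.σ} {S : M.K → List M.Γ}
    {q : TM2.Stmt (fun _ : M.K => M.Γ) M.Λ M.σ} {t : ℕ} {T : CompTree M.Cfg}
    (hq : M.code l = .inl q) (h : M.RunsIn (TM2.stepAux q v S) t T) :
    M.RunsIn ⟨some l, v, S⟩ (t + 1) T :=
  let ⟨s, hs, h⟩ := h; ⟨s + 1, by omega, .step hq h⟩

/-- A machine that contains the code of a program executes it and then continues. -/
lemma runsIn_of_exec (A : ChoiceTM a) {p : Prog A.K A.Γ A.σ} {s : A.σ × (A.K → List A.Γ)} {t : ℕ}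
    {T : CompTree (A.σ × (A.K → List A.Γ))} (h : p.Exec s t T) :
    ∀ (e : p.Lab → A.Λ) (x : A.Λ), (∀ b, A.code (e b) = p.code e x b) →
    ∀ (t' : ℕ) (F : A.σ × (A.K → List A.Γ) → CompTree A.Cfg),
      (∀ c, T.Mem c → A.RunsIn ⟨some x, c.1, c.2⟩ t' (F c)) →
      A.RunsIn ⟨some (e p.entry), s.1, s.2⟩ (t + t') (T.bind F) := by
  -- by determinism, a continuation given for the indices of a tree factors through its labels
  have key : ∀ {ι : Type} (T : CompTree ι) (g : ι → A.σ × (A.K → List A.Γ)) (x : A.Λ) (t' : ℕ)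
      (F : ι → CompTree A.Cfg),
      (∀ i, T.Mem i → A.RunsIn ⟨some x, (g i).1, (g i).2⟩ t' (F i)) →
      ∃ G : A.σ × (A.K → List A.Γ) → CompTree A.Cfg,
        (∀ c, (T.map g).Mem c → A.RunsIn ⟨some x, c.1, c.2⟩ t' (G c)) ∧
        (T.map g).bind G = T.bind F := by
    intro ι T g x t' F hF
    classical
    have hex : ∀ c, (T.map g).Mem c → ∃ U, A.RunsIn ⟨some x, c.1, c.2⟩ t' U := by
      intro c hc
      obtain ⟨i, hi, rfl⟩ := CompTree.mem_map.1 hc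
      exact ⟨_, hF i hi⟩
    refine ⟨fun c => if h : (T.map g).Mem c then (hex c h).choose else .leaf ⟨none, c.1, c.2⟩,
      fun c hc => ?_, ?_⟩
    · simp only [hc, dite_true]
      exact (hex c hc).choose_spec
    · rw [CompTree.bind_map]
      refine CompTree.bind_congr _ fun i hi => ?_
      have hc : (T.map g).Mem (g i) := CompTree.mem_map.2 ⟨i, hi, rfl⟩
      simp only [hc, dite_true]
      exact (hex _ hc).choose_spec.unique (hF i hi)
  induction h with
  | push k f v S =>
    intro e x he t' F hF
    exact (RunsIn.step (he _) (hF _ rfl)).mono (by omega)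
  | peek k f v S =>
    intro e x he t' F hF
    exact (RunsIn.step (he _) (hF _ rfl)).mono (by omega)
  | pop k f v S =>
    intro e x he t' F hF
    exact (RunsIn.step (he _) (hF _ rfl)).mono (by omega)
  | load f v S =>
    intro e x he t' F hF
    exact (RunsIn.step (he _) (hF _ rfl)).mono (by omega)
  | toss f v S =>
    intro e x he t' F hF
    obtain ⟨t₀, h₀, H₀⟩ := hF _ (Or.inl rfl)
    obtain ⟨t₁, h₁, H₁⟩ := hF _ (Or.inr rfl)
    exact ⟨_, by omega, .choose (he _) H₀ H₁⟩
  | @seq p q s t t₁ ι T g G h h' ih ih' =>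
    intro e x he t' F hF
    obtain ⟨H, hH, hHb⟩ := key T g (e (.inr q.entry)) (t₁ + t') (fun i => (G i).bind F) fun i hi =>
      ih' i hi (fun b => e (.inr b)) x (fun b => he (.inr b)) t' F
        fun c hc => hF c (CompTree.mem_bind.2 ⟨i, hi, hc⟩)
    have := ih (fun b => e (.inl b)) _ (fun b => he (.inl b)) _ H hH
    rw [hHb, ← CompTree.bind_assoc] at this
    exact this.mono (by omega)
  | @dyn p v S t T h ih =>
    intro e x he t' F hF
    have := ih (fun b => e (.inr ⟨v, b⟩)) x (fun b => he (.inr ⟨v, b⟩)) t' F hF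
    exact (RunsIn.step (he (.inl ())) this).mono (by omega)
  | @loop_done b p v S hb =>
    intro e x he t' F hF
    refine (RunsIn.step (t := t') (he (.inl ())) ?_).mono (by omega)
    simp only [TM2.stepAux, hb, cond_false]
    exact hF _ rfl
  | @loop_step b p v S t t₁ ι T g G hb h h' ih ih' =>
    intro e x he t' F hF
    obtain ⟨H, hH, hHb⟩ := key T g (e (.inl ())) (t₁ + t') (fun i => (G i).bind F) fun i hi =>
      ih' i hi e x he t' F fun c hc => hF c (CompTree.mem_bind.2 ⟨i, hi, hc⟩)
    have := ih (fun b => e (.inr b)) _ (fun b => he (.inr b)) _ H hH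
    rw [hHb, ← CompTree.bind_assoc] at this
    refine (RunsIn.step (t := t + (t₁ + t')) (he (.inl ())) ?_).mono (by omega)
    simp only [TM2.stepAux, hb, cond_true]
    exact this
  | mono h ht ih =>
    intro e x he t' F hF
    exact (ih e x he t' F hF).mono (by omega)

end ChoiceTM

/-! ### The store of the algorithms and the elementary operations on it -/

/-- The stacks used next to the stacks of the simulated machine: the input words `x`, `n`, `k`, `d`;
the address `path` of a node, last choice on top; the choices `feed` still to be followed by the
simulation; the binary counter `cnt`; the fuel counters `c1`, `c2`, `c3`; the shift `sh`; the
auxiliary stack `t`; and the output `out`. -/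
inductive Aux
  | x | n | k | d | path | feed | cnt | c1 | c2 | c3 | sh | t | out
  deriving DecidableEq

instance : Fintype Aux :=
  ⟨{.x, .n, .k, .d, .path, .feed, .cnt, .c1, .c2, .c3, .sh, .t, .out},
    fun a => by cases a <;> decide⟩

/-- The registers: the letter `reg` read last (`none` for an empty stack), and four flags. The flag
`live` says that there is a current node, whose address is on the stack `path`; `res` is the result
of a test, `ovf` the overflow of a counter, and `succ` says that a sample has been found. -/
@[ext]
structure Flags where
  reg : Option Bool
  live : Bool
  res : Bool
  ovf : Bool
  succ : Bool
  deriving Fintype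

/-- The internal memory of the algorithms: memory and control state of the simulated machine, and
the registers. -/
abbrev Memo (M : ChoiceTM 1) : Type := M.σ × Option M.Λ × Flags

/-- The programs over the store of the algorithms. All stacks use the alphabet of `M`. -/
abbrev MProg (M : ChoiceTM 1) : Type := Prog (M.K ⊕ Aux) M.Γ (Memo M)

/-- The contents of the store: memory `mv`, control state `ml` and stacks `ms` of the simulated
machine, the registers `fl`, and the auxiliary stacks `aux`. -/
@[ext]
structure Store (M : ChoiceTM 1) where
  mv : M.σ
  ml : Option M.Λ
  fl : Flags
  ms : M.K → List M.Γ
  aux : Aux → List Bool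

namespace Store

variable {M : ChoiceTM 1}

/-- The memory and the stacks that represent a store. -/
def cfg (s : Store M) : Memo M × (M.K ⊕ Aux → List M.Γ) :=
  ((s.mv, s.ml, s.fl), Sum.elim s.ms fun a => (s.aux a).map M.bit)

/-- Replaces the contents of an auxiliary stack. -/
def set (s : Store M) (a : Aux) (l : List Bool) : Store M :=
  { s with aux := Function.update s.aux a l }

/-- Replaces the registers. -/
def withFl (s : Store M) (f : Flags) : Store M := { s with fl := f }

/-- Replaces the letter read last. -/
def setReg (s : Store M) (r : Option Bool) : Store M := { s with fl := { s.fl with reg := r } }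

/-- Replaces the flag that says whether there is a current node. -/
def setLive (s : Store M) (b : Bool) : Store M := { s with fl := { s.fl with live := b } }

/-- Replaces the result flag of a test. -/
def setRes (s : Store M) (b : Bool) : Store M := { s with fl := { s.fl with res := b } }

/-- Replaces the overflow flag. -/
def setOvf (s : Store M) (b : Bool) : Store M := { s with fl := { s.fl with ovf := b } }

/-- Replaces the flag that says whether a sample has been found. -/
def setSucc (s : Store M) (b : Bool) : Store M := { s with fl := { s.fl with succ := b } }

@[simp] lemma aux_set (s : Store M) (a b : Aux) (l : List Bool) :
    (s.set a l).aux b = if b = a then l else s.aux b := by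
  simp [set, Function.update_apply]

@[simp] lemma mv_set (s : Store M) (a l) : (s.set a l).mv = s.mv := rfl
@[simp] lemma ml_set (s : Store M) (a l) : (s.set a l).ml = s.ml := rfl
@[simp] lemma fl_set (s : Store M) (a l) : (s.set a l).fl = s.fl := rfl
@[simp] lemma ms_set (s : Store M) (a l) : (s.set a l).ms = s.ms := rfl
@[simp] lemma mv_withFl (s : Store M) (f) : (s.withFl f).mv = s.mv := rfl
@[simp] lemma ml_withFl (s : Store M) (f) : (s.withFl f).ml = s.ml := rfl
@[simp] lemma fl_withFl (s : Store M) (f) : (s.withFl f).fl = f := rfl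
@[simp] lemma ms_withFl (s : Store M) (f) : (s.withFl f).ms = s.ms := rfl
@[simp] lemma aux_withFl (s : Store M) (f) : (s.withFl f).aux = s.aux := rfl
@[simp] lemma mv_setReg (s : Store M) (r) : (s.setReg r).mv = s.mv := rfl
@[simp] lemma ml_setReg (s : Store M) (r) : (s.setReg r).ml = s.ml := rfl
@[simp] lemma fl_setReg (s : Store M) (r) : (s.setReg r).fl = { s.fl with reg := r } := rfl
@[simp] lemma ms_setReg (s : Store M) (r) : (s.setReg r).ms = s.ms := rfl
@[simp] lemma aux_setReg (s : Store M) (r) : (s.setReg r).aux = s.aux := rfl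
@[simp] lemma mv_setLive (s : Store M) (r) : (s.setLive r).mv = s.mv := rfl
@[simp] lemma ml_setLive (s : Store M) (r) : (s.setLive r).ml = s.ml := rfl
@[simp] lemma fl_setLive (s : Store M) (r) : (s.setLive r).fl = { s.fl with live := r } := rfl
@[simp] lemma ms_setLive (s : Store M) (r) : (s.setLive r).ms = s.ms := rfl
@[simp] lemma aux_setLive (s : Store M) (r) : (s.setLive r).aux = s.aux := rfl
@[simp] lemma mv_setRes (s : Store M) (r) : (s.setRes r).mv = s.mv := rfl
@[simp] lemma ml_setRes (s : Store M) (r) : (s.setRes r).ml = s.ml := rfl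
@[simp] lemma fl_setRes (s : Store M) (r) : (s.setRes r).fl = { s.fl with res := r } := rfl
@[simp] lemma ms_setRes (s : Store M) (r) : (s.setRes r).ms = s.ms := rfl
@[simp] lemma aux_setRes (s : Store M) (r) : (s.setRes r).aux = s.aux := rfl
@[simp] lemma mv_setOvf (s : Store M) (r) : (s.setOvf r).mv = s.mv := rfl
@[simp] lemma ml_setOvf (s : Store M) (r) : (s.setOvf r).ml = s.ml := rfl
@[simp] lemma fl_setOvf (s : Store M) (r) : (s.setOvf r).fl = { s.fl with ovf := r } := rfl
@[simp] lemma ms_setOvf (s : Store M) (r) : (s.setOvf r).ms = s.ms := rfl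
@[simp] lemma aux_setOvf (s : Store M) (r) : (s.setOvf r).aux = s.aux := rfl
@[simp] lemma mv_setSucc (s : Store M) (r) : (s.setSucc r).mv = s.mv := rfl
@[simp] lemma ml_setSucc (s : Store M) (r) : (s.setSucc r).ml = s.ml := rfl
@[simp] lemma fl_setSucc (s : Store M) (r) : (s.setSucc r).fl = { s.fl with succ := r } := rfl
@[simp] lemma ms_setSucc (s : Store M) (r) : (s.setSucc r).ms = s.ms := rfl
@[simp] lemma aux_setSucc (s : Store M) (r) : (s.setSucc r).aux = s.aux := rfl

lemma ext_aux {s s' : Store M} (hv : s.mv = s'.mv) (hl : s.ml = s'.ml) (hf : s.fl = s'.fl)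
    (hm : s.ms = s'.ms) (ha : ∀ a, s.aux a = s'.aux a) : s = s' :=
  Store.ext hv hl hf hm (funext ha)

lemma cfg_set (s : Store M) (a : Aux) (l : List Bool) :
    (s.set a l).cfg = (s.cfg.1, Function.update s.cfg.2 (Sum.inr a) (l.map M.bit)) := by
  refine Prod.ext rfl ?_
  simp only [cfg, set]
  rw [Sum.update_elim_inr]
  congr 1
  funext b
  by_cases h : b = a
  · subst h; simp
  · simp [Function.update_of_ne h]

end Store

variable {M : ChoiceTM 1}

/-- `Yields p s t T g`: started in the store `s`, the program `p` halts within `t` steps on all coin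
tosses, and its possible final stores form the tree `T`, a leaf `i` standing for the store `g i`. -/
def Yields {ι : Type} (p : MProg M) (s : Store M) (t : ℕ) (T : CompTree ι) (g : ι → Store M) :
    Prop :=
  Prog.Exec p s.cfg t (T.map fun i => (g i).cfg)

/-- `Does p s t s'`: started in the store `s`, the program `p` reaches the store `s'` within `t`
steps, without depending on coin tosses. -/
def Does (p : MProg M) (s : Store M) (t : ℕ) (s' : Store M) : Prop :=
  Prog.Exec p s.cfg t (.leaf s'.cfg)

section rules

variable {p q : MProg M} {s s' s₁ s₂ : Store M} {t t' t₁ t₂ : ℕ} {ι κ : Type}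

lemma Does.congr (h : Does p s t s₁) (hs : s₁ = s₂) (ht : t ≤ t') : Does p s t' s₂ :=
  hs ▸ Prog.Exec.mono h ht

lemma Does.start (h : Does p s t s₁) (hs : s' = s) : Does p s' t s₁ := hs ▸ h

lemma Does.mono (h : Does p s t s₁) (ht : t ≤ t') : Does p s t' s₁ := Prog.Exec.mono h ht

lemma Yields.mono {T : CompTree ι} {g : ι → Store M} (h : Yields p s t T g) (ht : t ≤ t') :
    Yields p s t' T g := Prog.Exec.mono h ht

lemma Yields.congr {T : CompTree ι} {g g' : ι → Store M} (h : Yields p s t T g)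
    (hg : ∀ i, T.Mem i → g i = g' i) (ht : t ≤ t') : Yields p s t' T g' := by
  refine Prog.Exec.mono ?_ ht
  rwa [← CompTree.map_congr T fun i hi => congrArg Store.cfg (hg i hi)]

lemma Does.yields {T : CompTree ι} {g : ι → Store M} {i : ι} (h : Does p s t s') (hs : s' = g i)
    (hT : T = .leaf i) : Yields p s t T g := by
  subst hs hT; exact h

lemma Yields.seq {T : CompTree ι} {g : ι → Store M} {F : ι → CompTree κ} {g' : κ → Store M}
    (h : Yields p s t T g) (h' : ∀ i, T.Mem i → Yields q (g i) t' (F i) g') :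
    Yields (p ;; q) s (t + t') (T.bind F) g' := by
  unfold Yields
  rw [CompTree.map_bind]
  exact Prog.Exec.seq h h'

lemma Does.seq (h : Does p s t s₁) (h' : Does q s₁ t' s₂) : Does (p ;; q) s (t + t') s₂ :=
  Prog.Exec.seq (T := .leaf ()) (g := fun _ => s₁.cfg) (F := fun _ => .leaf s₂.cfg) h
    fun _ _ => h'

lemma Does.seq_yields {T : CompTree ι} {g : ι → Store M} (h : Does p s t s₁)
    (h' : Yields q s₁ t' T g) : Yields (p ;; q) s (t + t') T g :=
  Prog.Exec.seq (T := .leaf ()) (g := fun _ => s₁.cfg) (F := fun _ => T.map fun i => (g i).cfg) h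
    fun _ _ => h'

lemma Yields.seq_does {T : CompTree ι} {g g' : ι → Store M}
    (h : Yields p s t T g) (h' : ∀ i, T.Mem i → Does q (g i) t' (g' i)) :
    Yields (p ;; q) s (t + t') T g' := by
  have := Yields.seq (F := fun i => CompTree.leaf i) (g' := g') h h'
  rwa [CompTree.bind_pure] at this

/-- Renames the leaves. -/
lemma Yields.of_map {T : CompTree ι} {h : ι → κ} {g : κ → Store M}
    (H : Yields p s t T fun i => g (h i)) : Yields p s t (T.map h) g := by
  unfold Yields
  rw [CompTree.map_map]
  exact H

end rules

/-- Decodes a letter, `1` being the only letter that stands for `true`. -/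
noncomputable def decodeBit (M : ChoiceTM 1) (c : M.Γ) : Bool :=
  open Classical in decide (c = M.bit true)

@[simp] lemma decodeBit_bit (b : Bool) : decodeBit M (M.bit b) = b := by
  cases b <;> simp [decodeBit]

/-- Pushes a bit. -/
def bpush (M : ChoiceTM 1) (a : Aux) (f : Flags → Bool) : MProg M :=
  .push (.inr a) fun v => M.bit (f v.2.2)

/-- Pops a bit into the register. -/
noncomputable def bpop (M : ChoiceTM 1) (a : Aux) : MProg M :=
  .pop (.inr a) fun v o => (v.1, v.2.1, { v.2.2 with reg := o.map (decodeBit M) })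

/-- Changes the registers. -/
def setF (M : ChoiceTM 1) (f : Flags → Flags) : MProg M := .load fun v => (v.1, v.2.1, f v.2.2)

/-- Tosses a fair coin into the register. -/
def tossF (M : ChoiceTM 1) : MProg M :=
  .toss fun v b => (v.1, v.2.1, { v.2.2 with reg := some b })

/-- Case distinction. -/
def ifF (b : Flags → Bool) (p q : MProg M) : MProg M := .dyn fun v => if b v.2.2 then p else q

/-- While loop. -/
def whileF (b : Flags → Bool) (p : MProg M) : MProg M := .loop (fun v => b v.2.2) p

section ops

variable {p q : MProg M} {s s' s₁ : Store M} {t t' : ℕ} {ι κ : Type}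

lemma does_bpush (s : Store M) (a : Aux) (f : Flags → Bool) :
    Does (bpush M a f) s 1 (s.set a (f s.fl :: s.aux a)) := by
  unfold Does
  rw [Store.cfg_set]
  exact Prog.Exec.push _ _ _ _

lemma does_bpop (s : Store M) (a : Aux) :
    Does (bpop M a) s 1 ((s.set a (s.aux a).tail).setReg (s.aux a).head?) := by
  have := Prog.Exec.pop (.inr a)
    (fun (v : Memo M) o => (v.1, v.2.1, { v.2.2 with reg := o.map (decodeBit M) })) s.cfg.1 s.cfg.2
  have h1 : ((s.set a (s.aux a).tail).setReg (s.aux a).head?).cfg =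
      ((s.mv, s.ml, { s.fl with reg := (s.aux a).head? }), (s.set a (s.aux a).tail).cfg.2) := rfl
  have h2 : (s.cfg.2 (.inr a)).head?.map (decodeBit M) = (s.aux a).head? := by
    simp only [Store.cfg, Sum.elim_inr]
    cases s.aux a <;> simp
  have h3 : (s.cfg.2 (.inr a)).tail = (s.aux a).tail.map M.bit := by simp [Store.cfg]
  unfold Does
  rw [h1, Store.cfg_set, ← h2, ← h3]
  exact this

lemma does_setF (s : Store M) (f : Flags → Flags) :
    Does (setF M f) s 1 (s.withFl (f s.fl)) := Prog.Exec.load _ _ _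

lemma yields_tossF (s : Store M) :
    Yields (tossF M) s 1 (.node (.leaf false) (.leaf true)) fun b => s.setReg (some b) :=
  Prog.Exec.toss _ _ _

lemma Does.ifF_true {b : Flags → Bool} (hb : b s.fl = true) (h : Does p s t s') :
    Does (ifF b p q) s (t + 1) s' :=
  Prog.Exec.dyn (by
    rw [show b (s.mv, s.ml, s.fl).2.2 = _ from hb]; exact h)

lemma Does.ifF_false {b : Flags → Bool} (hb : b s.fl = false) (h : Does q s t s') :
    Does (ifF b p q) s (t + 1) s' :=
  Prog.Exec.dyn (by
    rw [show b (s.mv, s.ml, s.fl).2.2 = _ from hb]; exact h)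

lemma Yields.ifF_true {T : CompTree ι} {g : ι → Store M} {b : Flags → Bool} (hb : b s.fl = true)
    (h : Yields p s t T g) : Yields (ifF b p q) s (t + 1) T g :=
  Prog.Exec.dyn (by
    rw [show b (s.mv, s.ml, s.fl).2.2 = _ from hb]; exact h)

lemma Yields.ifF_false {T : CompTree ι} {g : ι → Store M} {b : Flags → Bool} (hb : b s.fl = false)
    (h : Yields q s t T g) : Yields (ifF b p q) s (t + 1) T g :=
  Prog.Exec.dyn (by
    rw [show b (s.mv, s.ml, s.fl).2.2 = _ from hb]; exact h)

lemma does_whileF_done {b : Flags → Bool} (hb : b s.fl = false) : Does (whileF b p) s 1 s :=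
  Prog.Exec.loop_done hb

lemma Does.whileF_step {b : Flags → Bool} (hb : b s.fl = true) (h : Does p s t s₁)
    (h' : Does (whileF b p) s₁ t' s') : Does (whileF b p) s (t + t' + 1) s' :=
  Prog.Exec.loop_step (T := .leaf ()) (g := fun _ => s₁.cfg) (F := fun _ => .leaf s'.cfg) hb h
    fun _ _ => h'

lemma Yields.whileF_step {T : CompTree ι} {g : ι → Store M} {F : ι → CompTree κ}
    {g' : κ → Store M} {b : Flags → Bool} (hb : b s.fl = true) (h : Yields p s t T g)
    (h' : ∀ i, T.Mem i → Yields (whileF b p) (g i) t' (F i) g') :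
    Yields (whileF b p) s (t + t' + 1) (T.bind F) g' := by
  unfold Yields
  rw [CompTree.map_bind]
  exact Prog.Exec.loop_step hb h h'

end ops

/-! ### Loops that consume a stack -/

/-- Pops the letters of a stack one by one and executes `p` for each of them. -/
noncomputable def forPop (a : Aux) (p : MProg M) : MProg M :=
  bpop M a ;; whileF (fun f => f.reg.isSome) (p ;; bpop M a)

/-- Folds a randomized step over a list. -/
def foldT {ι : Type} (F : Bool → ι → CompTree ι) : List Bool → ι → CompTree ι
  | [], x => .leaf x
  | b :: l, x => (F b x).bind (foldT F l)

lemma foldT_leaf {ι : Type} (G : Bool → ι → ι) (l : List Bool) (x : ι) :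
    foldT (fun b y => .leaf (G b y)) l x = .leaf (l.foldl (fun y b => G b y) x) := by
  induction l generalizing x with
  | nil => rfl
  | cons b l ih => simp [foldT, ih]

/-- The body of the loop may leave the register in any state `ρ b`. The predicate `I l x` is an
invariant, `l` being the part of the stack that is still to be read; the store `g l x` may depend
on it. -/
lemma yields_forPop {ι : Type} {a : Aux} {p : MProg M} {g : List Bool → ι → Store M}
    {F : Bool → ι → CompTree ι} {τ : ℕ} (ρ : Bool → Option Bool) (I : List Bool → ι → Prop)
    (hI : ∀ b l x, I (b :: l) x → ∀ y, (F b x).Mem y → I l y)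
    (hp : ∀ b l x, I (b :: l) x → Yields p (((g (b :: l) x).set a l).setReg (some b)) τ (F b x)
      fun y => ((g l y).set a l).setReg (ρ b))
    (l : List Bool) (x : ι) (hx : I l x) (s : Store M) (hs : s = (g l x).set a l) :
    Yields (forPop a p) s (l.length * (τ + 2) + 2) (foldT F l x)
      fun y => ((g [] y).set a []).setReg none := by
  subst hs
  have loop : ∀ (l : List Bool) (x : ι), I l x →
      Yields (whileF (fun f => f.reg.isSome) (p ;; bpop M a))
        (((g l x).set a l.tail).setReg l.head?) (l.length * (τ + 2) + 1) (foldT F l x)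
        fun y => ((g [] y).set a []).setReg none := by
    intro l
    induction l with
    | nil =>
      intro x _
      exact Does.yields (i := x) (Does.mono (does_whileF_done rfl) (by omega)) rfl rfl
    | cons b l ih =>
      intro x hx
      have h1 := (hp b l x hx).seq_does
        (g' := fun y => ((g l y).set a l.tail).setReg l.head?) (q := bpop M a) (t' := 1) fun y _ =>
          (does_bpop _ a).congr (by
            refine Store.ext_aux rfl rfl ?_ rfl fun c => ?_
            · simp
            · by_cases h : c = a <;> simp [h]) le_rfl
      have h2 := h1.whileF_step (b := fun f => f.reg.isSome) (by rfl)
        fun y hy => ih y (hI _ _ _ hx y hy)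
      refine Yields.mono h2 ?_
      simp only [List.length_cons, Nat.add_mul]
      omega
  have h0 : Does (bpop M a) ((g l x).set a l) 1 (((g l x).set a l.tail).setReg l.head?) :=
    (does_bpop _ a).congr (by
      refine Store.ext_aux rfl rfl ?_ rfl fun c => ?_
      · simp
      · by_cases h : c = a <;> simp [h]) le_rfl
  exact (h0.seq_yields (loop l x hx)).mono (by omega)

lemma does_forPop {ι : Type} {a : Aux} {p : MProg M} {g : List Bool → ι → Store M}
    {G : Bool → ι → ι} {τ : ℕ} (ρ : Bool → Option Bool) (I : List Bool → ι → Prop)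
    (hI : ∀ b l x, I (b :: l) x → I l (G b x))
    (hp : ∀ b l x, I (b :: l) x → Does p (((g (b :: l) x).set a l).setReg (some b)) τ
      (((g l (G b x)).set a l).setReg (ρ b)))
    (l : List Bool) (x : ι) (hx : I l x) (s : Store M) (hs : s = (g l x).set a l) :
    Does (forPop a p) s (l.length * (τ + 2) + 2)
      (((g [] (l.foldl (fun y b => G b y) x)).set a []).setReg none) := by
  have := yields_forPop (p := p) (g := g) (F := fun b y => .leaf (G b y)) (τ := τ) ρ I
    (fun b l x h y hy => by obtain rfl := hy; exact hI b l x h) hp l x hx s hs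
  rw [foldT_leaf] at this
  exact this

/-- Moves the letters of the stack `a` to the stack `b`, which reverses their order. -/
noncomputable def move (M : ChoiceTM 1) (a b : Aux) : MProg M :=
  forPop a (bpush M b fun f => f.reg.getD false)

lemma does_move (s : Store M) {a b : Aux} (hab : a ≠ b) (hr : s.fl.reg = none) :
    Does (move M a b) s ((s.aux a).length * 3 + 2)
      ((s.set a []).set b ((s.aux a).reverse ++ s.aux b)) := by
  have := does_forPop (a := a) (p := bpush M b fun f => f.reg.getD false)
    (g := fun _ y => s.set b y) (G := fun c y => c :: y)
    (τ := 1) (fun c => some c) (fun _ _ => True) (fun _ _ _ _ => trivial)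
    (fun c l y _ => (does_bpush _ _ _).congr (by
      refine Store.ext_aux rfl rfl ?_ rfl fun e => ?_
      · simp
      · simp only [Store.aux_set, Store.aux_setReg, Store.fl_setReg]
        split_ifs <;> simp_all) le_rfl)
    (s.aux a) (s.aux b) trivial s (by
      refine Store.ext_aux rfl rfl rfl rfl fun e => ?_
      simp only [Store.aux_set]
      split_ifs <;> simp_all)
  refine Does.congr this ?_ le_rfl
  refine Store.ext_aux rfl rfl ?_ rfl fun e => ?_
  · simp [← hr]
  · simp only [Store.aux_set, Store.aux_setReg]
    split_ifs <;> simp_all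

/-- Empties a stack. -/
noncomputable def clear (M : ChoiceTM 1) (a : Aux) : MProg M := forPop a (setF M id)

lemma does_clear (s : Store M) (a : Aux) (hr : s.fl.reg = none) :
    Does (clear M a) s ((s.aux a).length * 3 + 2) (s.set a []) := by
  have := does_forPop (a := a) (p := setF M id) (g := fun _ (_ : Unit) => s)
    (G := fun _ y => y) (τ := 1) (fun c => some c) (fun _ _ => True) (fun _ _ _ _ => trivial)
    (fun c l y _ => (does_setF _ _).congr rfl le_rfl)
    (s.aux a) () trivial s (by
      refine Store.ext_aux rfl rfl rfl rfl fun e => ?_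
      simp only [Store.aux_set]
      split_ifs <;> simp_all)
  refine Does.congr this ?_ le_rfl
  refine Store.ext_aux rfl rfl ?_ rfl fun e => rfl
  simp [← hr]

/-! ### Binary counters -/

/-- Adds one to a binary number with a fixed number of digits, least significant digit first;
an overflow leaves zeros. -/
def incFixed : List Bool → List Bool
  | [] => []
  | false :: l => true :: l
  | true :: l => false :: incFixed l

/-- Adds one to a binary number, least significant digit first. -/
def incGrow : List Bool → List Bool
  | [] => [true]
  | false :: l => true :: l
  | true :: l => false :: incGrow l

/-- The value of a binary number, least significant digit first. -/
def bval : List Bool → ℕ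
  | [] => 0
  | b :: l => b.toNat + 2 * bval l

lemma bval_lt (l : List Bool) : bval l < 2 ^ l.length := by
  induction l with
  | nil => simp [bval]
  | cons b l ih => cases b <;> simp [bval, pow_succ] <;> omega

lemma length_incFixed (l : List Bool) : (incFixed l).length = l.length := by
  induction l with
  | nil => rfl
  | cons b l ih => cases b <;> simp [incFixed, ih]

lemma bval_incFixed {l : List Bool} (h : l.all id = false) : bval (incFixed l) = bval l + 1 := by
  induction l with
  | nil => simp at h
  | cons b l ih =>
    cases b
    · simp [incFixed, bval]; omega
    · simp only [List.all_cons, id, Bool.true_and] at h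
      simp [incFixed, bval, ih h]; omega

lemma incFixed_of_all {l : List Bool} (h : l.all id = true) :
    incFixed l = List.replicate l.length false := by
  induction l with
  | nil => rfl
  | cons b l ih =>
    simp only [List.all_cons, id, Bool.and_eq_true] at h
    obtain ⟨rfl, h⟩ := h
    simp [incFixed, ih h, List.replicate_succ]

lemma bval_of_all {l : List Bool} (h : l.all id = true) : bval l + 1 = 2 ^ l.length := by
  induction l with
  | nil => rfl
  | cons b l ih =>
    simp only [List.all_cons, id, Bool.and_eq_true] at h
    obtain ⟨rfl, h⟩ := h
    have := ih h
    simp [bval, pow_succ]; omega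

lemma bval_replicate_false (n : ℕ) : bval (List.replicate n false) = 0 := by
  induction n with
  | zero => rfl
  | succ n ih => simp [List.replicate_succ, bval, ih]

lemma incGrow_bits (n : ℕ) : incGrow n.bits = (n + 1).bits := by
  induction n using Nat.strong_induction_on with
  | _ n ih =>
    rcases Nat.eq_zero_or_pos n with rfl | hn
    · simp [incGrow]
    obtain ⟨m, rfl | rfl⟩ : ∃ m, n = 2 * m ∨ n = 2 * m + 1 := ⟨n / 2, by omega⟩
    · rw [Nat.bit0_bits m (by omega), Nat.bit1_bits]; rfl
    · rw [Nat.bit1_bits, show 2 * m + 1 + 1 = 2 * (m + 1) by ring, Nat.bit0_bits _ (by omega),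
        incGrow, ih m (by omega)]

/-- Adds one to the binary number on the stack `c`, keeping the number of digits; the flag `ovf`
reports an overflow. -/
noncomputable def incWrap (M : ChoiceTM 1) (c : Aux) : MProg M :=
  bpop M c ;; whileF (fun f => f.reg == some true) (bpush M .t (fun _ => false) ;; bpop M c) ;;
    ifF (fun f => f.reg == some false)
      (bpush M c (fun _ => true) ;; setF M (fun f => { f with reg := none }))
      (setF M fun f => { f with ovf := true }) ;;
    move M .t c

/-- Adds one to the binary number on the stack `c`. -/
noncomputable def inc (M : ChoiceTM 1) (c : Aux) : MProg M :=
  bpop M c ;; whileF (fun f => f.reg == some true) (bpush M .t (fun _ => false) ;; bpop M c) ;;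
    (bpush M c (fun _ => true) ;; setF M (fun f => { f with reg := none })) ;; move M .t c

lemma does_incLoop {c : Aux} (hc : c ≠ .t) (l : List Bool) : ∀ s : Store M,
    Does (whileF (fun f => f.reg == some true) (bpush M .t (fun _ => false) ;; bpop M c))
      ((s.set c l.tail).setReg l.head?) (l.length * 3 + 1)
      (((s.set c (l.dropWhile id).tail).set .t
        (List.replicate (l.takeWhile id).length false ++ s.aux .t)).setReg
          (l.dropWhile id).head?) := by
  induction l with
  | nil =>
    intro s
    refine (does_whileF_done (by rfl)).congr (Store.ext_aux rfl rfl rfl rfl fun e => ?_) (by simp)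
    by_cases h : e = .t
    · subst h; simp [hc.symm]
    · simp [h]
  | cons b l ih =>
    intro s
    cases b
    · refine (does_whileF_done (by rfl)).congr (Store.ext_aux rfl rfl rfl rfl fun e => ?_)
        (by simp)
      by_cases h : e = .t
      · subst h; simp [hc.symm]
      · simp [h]
    · have h1 : Does (bpush M .t (fun _ => false) ;; bpop M c)
          ((s.set c (true :: l).tail).setReg (true :: l).head?) 2
          (((s.set .t (false :: s.aux .t)).set c l.tail).setReg l.head?) := by
        refine ((does_bpush _ _ _).seq (does_bpop _ _)).congr
          (Store.ext_aux rfl rfl ?_ rfl fun e => ?_) le_rfl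
        · simp [hc, hc.symm]
        · simp only [Store.aux_set, Store.aux_setReg]
          split_ifs <;> simp_all
      refine (h1.whileF_step (by rfl) (ih _)).congr (Store.ext_aux rfl rfl ?_ rfl fun e => ?_) ?_
      · simp
      · simp only [Store.aux_set, Store.aux_setReg]
        split_ifs <;> simp_all [List.replicate_succ']
      · simp; omega

lemma incFixed_eq (l : List Bool) : incFixed l = List.replicate (l.takeWhile id).length false ++
    (if (l.dropWhile id).head? = some false then true :: (l.dropWhile id).tail
      else (l.dropWhile id).tail) := by
  induction l with
  | nil => rfl
  | cons b l ih => cases b <;> simp [incFixed, List.replicate_succ, ih]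

lemma incGrow_eq (l : List Bool) : incGrow l = List.replicate (l.takeWhile id).length false ++
    true :: (l.dropWhile id).tail := by
  induction l with
  | nil => rfl
  | cons b l ih => cases b <;> simp [incGrow, List.replicate_succ, ih]

lemma head?_dropWhile_id (l : List Bool) :
    (l.dropWhile id).head? = if l.all id then none else some false := by
  induction l with
  | nil => rfl
  | cons b l ih => cases b <;> simp [ih]

lemma dropWhile_id_of_all {l : List Bool} (h : l.all id = true) : l.dropWhile id = [] := by
  have := head?_dropWhile_id l
  rw [h] at this
  simpa using this

lemma does_incWrap (s : Store M) {c : Aux} (hc : c ≠ .t) (ht : s.aux .t = [])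
    (hr : s.fl.reg = none) (ho : s.fl.ovf = false) :
    Does (incWrap M c) s ((s.aux c).length * 6 + 8)
      ((s.set c (incFixed (s.aux c))).setOvf ((s.aux c).all id)) := by
  have hlen : ((s.aux c).takeWhile id).length ≤ (s.aux c).length :=
    (List.takeWhile_prefix _).length_le
  have h0 := does_incLoop hc (s.aux c) s
  rw [ht, List.append_nil] at h0
  by_cases hall : (s.aux c).all id = true
  · rw [dropWhile_id_of_all hall] at h0
    refine Does.congr (Does.seq (does_bpop s c) (Does.seq h0
      (Does.seq (Does.ifF_false (by simp) (does_setF _ _)) (does_move _ hc.symm (by simp)))))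
      (Store.ext_aux rfl rfl ?_ rfl fun e => ?_) ?_
    · simp [← hr, hall]
    · rw [incFixed_eq, dropWhile_id_of_all hall]
      by_cases h : e = c
      · subst h; simp [hc]
      · by_cases h' : e = .t
        · subst h'; simp [h, ht]
        · simp [h, h']
    · simp; omega
  · have hd := head?_dropWhile_id (s.aux c)
    rw [if_neg hall] at hd
    rw [hd] at h0
    refine Does.congr (Does.seq (does_bpop s c) (Does.seq h0
      (Does.seq (Does.ifF_true (by simp) (Does.seq (does_bpush _ _ _) (does_setF _ _)))
        (does_move _ hc.symm (by simp)))))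
      (Store.ext_aux rfl rfl ?_ rfl fun e => ?_) ?_
    · simp only [Bool.not_eq_true] at hall
      simp [← hr, hall, ← ho]
    · rw [incFixed_eq, hd]
      by_cases h : e = c
      · subst h; simp [hc, hc.symm]
      · by_cases h' : e = .t
        · subst h'; simp [h, ht]
        · simp [h, h']
    · simp [hc.symm]; omega

lemma does_inc (s : Store M) {c : Aux} (hc : c ≠ .t) (ht : s.aux .t = [])
    (hr : s.fl.reg = none) :
    Does (inc M c) s ((s.aux c).length * 6 + 8) (s.set c (incGrow (s.aux c))) := by
  have hlen : ((s.aux c).takeWhile id).length ≤ (s.aux c).length :=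
    (List.takeWhile_prefix _).length_le
  have h0 := does_incLoop hc (s.aux c) s
  rw [ht, List.append_nil] at h0
  refine Does.congr (Does.seq (does_bpop s c) (Does.seq h0
    (Does.seq (Does.seq (does_bpush _ _ _) (does_setF _ _)) (does_move _ hc.symm (by simp)))))
    (Store.ext_aux rfl rfl ?_ rfl fun e => ?_) ?_
  · simp [← hr]
  · rw [incGrow_eq]
    by_cases h : e = c
    · subst h; simp [hc, hc.symm]
    · by_cases h' : e = .t
      · subst h'; simp [h, ht]
      · simp [h, h']
  · simp [hc.symm]; omega

/-! ### Loops with exponentially many iterations -/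

/-- Executes `p` once for each number from the value of the counter `c` up to the largest one with
the same number of digits, the latter excluded. The counter is zero afterwards. -/
noncomputable def fuel (c : Aux) (p : MProg M) : MProg M :=
  incWrap M c ;; whileF (fun f => !f.ovf) (p ;; incWrap M c) ;;
    setF M fun f => { f with ovf := false }

/-- The predicate `I i x` is an invariant, `i` being the value of the counter. -/
lemma yields_fuel {ι : Type} {c : Aux} (hc : c ≠ .t) {p : MProg M} {g : ι → Store M}
    {F : ι → CompTree ι} {τ : ℕ} (I : ℕ → ι → Prop)
    (hI : ∀ i x, I i x → ∀ y, (F x).Mem y → I (i + 1) y) (h : ℕ)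
    (ht : ∀ x, (g x).aux .t = []) (hr : ∀ x, (g x).fl.reg = none) (ho : ∀ x, (g x).fl.ovf = false)
    (hp : ∀ i x l, I i x → i < 2 ^ h → l.length = h →
      Yields p ((g x).set c l) τ (F x) fun y => (g y).set c l)
    (l : List Bool) (hl : l.length = h) (x : ι) (hx : I (bval l) x) (s : Store M)
    (hs : s = (g x).set c l) :
    Yields (fuel c p) s (2 ^ h * (τ + (6 * h + 10)) + 1)
      (CompTree.iter F (2 ^ h - 1 - bval l) x)
      fun y => (g y).set c (List.replicate h false) := by
  have hinc : ∀ (x : ι) (l : List Bool), l.length = h →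
      Does (incWrap M c) ((g x).set c l) (6 * h + 8)
        (((g x).set c (incFixed l)).setOvf (l.all id)) := by
    intro x l hl
    refine Does.congr (does_incWrap _ hc (by simp [hc.symm, ht]) (hr x) (ho x))
      (Store.ext_aux rfl rfl ?_ rfl fun e => ?_) ?_
    · simp
    · simp only [Store.aux_set, Store.aux_setOvf, if_true]
      split_ifs <;> rfl
    · simp [hl]; omega
  have loop : ∀ (N : ℕ) (x : ι) (l : List Bool), l.length = h → 2 ^ h - 1 - bval l = N →
      I (bval l) x →
      Yields (whileF (fun f => !f.ovf) (p ;; incWrap M c))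
        (((g x).set c (incFixed l)).setOvf (l.all id)) (N * (τ + (6 * h + 9)) + 1)
        (CompTree.iter F N x)
        fun y => ((g y).set c (List.replicate h false)).setOvf true := by
    intro N
    induction N with
    | zero =>
      intro x l hl hN _
      have hall : l.all id = true := by
        by_contra hall
        rw [Bool.not_eq_true] at hall
        have h1 := bval_incFixed hall
        have h2 := bval_lt (incFixed l)
        rw [length_incFixed, hl] at h2
        omega
      rw [hall, incFixed_of_all hall, hl]
      exact ((does_whileF_done (by rfl)).mono (by omega)).yields rfl rfl
    | succ N ih =>
      intro x l hl hN hx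
      have hall : l.all id = false := by
        by_contra hall
        rw [Bool.not_eq_false] at hall
        have h1 := bval_of_all hall
        rw [hl] at h1
        omega
      have hl' : (incFixed l).length = h := (length_incFixed l).trans hl
      have hv := bval_incFixed hall
      have hlt := bval_lt l
      rw [hl] at hlt
      have hs : ((g x).set c (incFixed l)).setOvf (l.all id) = (g x).set c (incFixed l) := by
        refine Store.ext_aux rfl rfl ?_ rfl fun e => rfl
        simp [hall, ← ho x]
      rw [hs]
      have hb := (hp _ x (incFixed l) hx hlt hl').seq_does fun y _ => hinc y _ hl'
      refine (hb.whileF_step (by simp [ho]) fun y hy => ih y _ hl' (by omega) ?_).mono ?_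
      · rw [hv]; exact hI _ x hx y hy
      · rw [Nat.add_mul]; omega
  subst hs
  refine ((hinc x l hl).seq_yields ((loop _ x l hl rfl hx).seq_does fun y _ =>
    (does_setF _ _).congr ?_ le_rfl)).mono ?_
  · refine Store.ext_aux rfl rfl ?_ rfl fun e => ?_
    · simp [← ho y]
    · rfl
  · have h1 : (2 ^ h - 1 - bval l + 1) * (τ + (6 * h + 9)) ≤ 2 ^ h * (τ + (6 * h + 9)) :=
      Nat.mul_le_mul_right _ (by have := Nat.one_le_two_pow (n := h); omega)
    have h2 : 2 ^ h * (τ + (6 * h + 10)) = 2 ^ h * (τ + (6 * h + 9)) + 2 ^ h := by ring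
    have h3 := Nat.one_le_two_pow (n := h)
    rw [Nat.add_mul, Nat.one_mul] at h1
    omega

/-! ### Simulating the given machine along a sequence of choices -/

instance CompTree.decidableIsBranching {C : Type} :
    ∀ (T : CompTree C) (w : List Bool), Decidable (T.IsBranching w)
  | .leaf _, _ => .isFalse id
  | .node _ _, [] => .isTrue trivial
  | .node l _, false :: w => decidableIsBranching l w
  | .node _ r, true :: w => decidableIsBranching r w

namespace Store

/-- Replaces the configuration of the simulated machine. -/
def withCfg (s : Store M) (c : M.Cfg) : Store M := { s with mv := c.var, ml := c.l, ms := c.stk }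

/-- Replaces the contents of a stack of the simulated machine. -/
def setMs (s : Store M) (k : M.K) (l : List M.Γ) : Store M :=
  { s with ms := Function.update s.ms k l }

lemma cfg_setMs (s : Store M) (k : M.K) (l : List M.Γ) :
    (s.setMs k l).cfg = (s.cfg.1, Function.update s.cfg.2 (Sum.inl k) l) := by
  refine Prod.ext rfl ?_
  simp only [cfg, setMs]
  rw [Sum.update_elim_inl]

@[simp] lemma mv_setMs (s : Store M) (k l) : (s.setMs k l).mv = s.mv := rfl
@[simp] lemma ml_setMs (s : Store M) (k l) : (s.setMs k l).ml = s.ml := rfl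
@[simp] lemma fl_setMs (s : Store M) (k l) : (s.setMs k l).fl = s.fl := rfl
@[simp] lemma aux_setMs (s : Store M) (k l) : (s.setMs k l).aux = s.aux := rfl
@[simp] lemma fl_withCfg (s : Store M) (c) : (s.withCfg c).fl = s.fl := rfl
@[simp] lemma aux_withCfg (s : Store M) (c) : (s.withCfg c).aux = s.aux := rfl
@[simp] lemma mv_withCfg (s : Store M) (c) : (s.withCfg c).mv = c.var := rfl
@[simp] lemma ml_withCfg (s : Store M) (c) : (s.withCfg c).ml = c.l := rfl
@[simp] lemma ms_withCfg (s : Store M) (c) : (s.withCfg c).ms = c.stk := rfl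

end Store

/-- The program that executes one statement of the simulated machine. -/
def trStmt : TM2.Stmt (fun _ : M.K => M.Γ) M.Λ M.σ → MProg M
  | .push k f q => .push (.inl k) (fun v => f v.1) ;; trStmt q
  | .peek k f q => .peek (.inl k) (fun v o => (f v.1 o, v.2)) ;; trStmt q
  | .pop k f q => .pop (.inl k) (fun v o => (f v.1 o, v.2)) ;; trStmt q
  | .load f q => .load (fun v => (f v.1, v.2)) ;; trStmt q
  | .branch b p q => .dyn fun v => if b v.1 then trStmt p else trStmt q
  | .goto l => .load fun v => (v.1, some (l v.1), v.2.2)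
  | .halt => .load fun v => (v.1, none, v.2.2)

/-- A bound for the number of steps in which a statement is simulated. -/
def stmtCost : TM2.Stmt (fun _ : M.K => M.Γ) M.Λ M.σ → ℕ
  | .push _ _ q => 1 + stmtCost q
  | .peek _ _ q => 1 + stmtCost q
  | .pop _ _ q => 1 + stmtCost q
  | .load _ q => 1 + stmtCost q
  | .branch _ p q => stmtCost p + stmtCost q + 1
  | .goto _ => 1
  | .halt => 1

lemma does_trStmt (q : TM2.Stmt (fun _ : M.K => M.Γ) M.Λ M.σ) : ∀ s : Store M,
    Does (trStmt q) s (stmtCost q) (s.withCfg (TM2.stepAux q s.mv s.ms)) := by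
  induction q with
  | push k f q ih =>
    intro s
    refine Does.seq (s₁ := s.setMs k (f s.mv :: s.ms k)) ?_ (ih _)
    unfold Does
    rw [Store.cfg_setMs]
    exact Prog.Exec.push _ _ _ _
  | peek k f q ih =>
    intro s
    exact Does.seq (s₁ := { s with mv := f s.mv (s.ms k).head? }) (Prog.Exec.peek _ _ _ _) (ih _)
  | pop k f q ih =>
    intro s
    refine Does.seq (s₁ := { s.setMs k (s.ms k).tail with mv := f s.mv (s.ms k).head? }) ?_ (ih _)
    have h1 : ({ s.setMs k (s.ms k).tail with mv := f s.mv (s.ms k).head? } : Store M).cfg =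
      ((f s.mv (s.ms k).head?, s.ml, s.fl), (s.setMs k (s.ms k).tail).cfg.2) := rfl
    unfold Does
    rw [h1, Store.cfg_setMs]
    exact Prog.Exec.pop _ _ _ _
  | load f q ih =>
    intro s
    exact Does.seq (s₁ := { s with mv := f s.mv }) (Prog.Exec.load _ _ _) (ih _)
  | branch b p q hp hq =>
    intro s
    refine Prog.Exec.dyn ?_
    simp only [TM2.stepAux]
    cases h : b s.mv
    · exact Does.mono (hq s) (by omega)
    · exact Does.mono (hp s) (by omega)
  | goto l => intro s; exact Prog.Exec.load _ _ _
  | halt => intro s; exact Prog.Exec.load _ _ _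

/-- Follows a choice `b` by executing the statement `q`, and records the choice. -/
def follow (b : Bool) (q : TM2.Stmt (fun _ : M.K => M.Γ) M.Λ M.σ) : MProg M :=
  bpush M .path (fun _ => b) ;; setF M (fun f => { f with reg := none }) ;; trStmt q

/-- Simulates the step made in the control state `l`. If a choice has to be made and none is left on
the stack `feed`, then a branching has been reached, and the flag `res` is set. -/
noncomputable def simStep (l : M.Λ) : MProg M :=
  match M.code l with
  | .inl q => trStmt q
  | .inr (q₀, q₁) => bpop M .feed ;; ifF (fun f => f.reg == none)
      (setF M fun f => { f with res := true })
      (ifF (fun f => f.reg == some true) (follow true q₁) (follow false q₀))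

/-- Simulates the machine until it halts or reaches a branching not covered by the choices. -/
noncomputable def sim (M : ChoiceTM 1) : MProg M :=
  .loop (fun v => v.2.1.isSome && !v.2.2.res) (.dyn fun v => match v.2.1 with
    | none => setF M id
    | some l => simStep l)

/-- A bound for the number of steps in which a step of the machine is simulated. -/
noncomputable def stepCost (M : ChoiceTM 1) : ℕ :=
  ∑ l : M.Λ, match M.code l with
    | .inl q => stmtCost q
    | .inr (q₀, q₁) => stmtCost q₀ + stmtCost q₁

lemma stmtCost_le_inl {l : M.Λ} {q} (h : M.code l = .inl q) : stmtCost q ≤ stepCost M := by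
  refine le_trans ?_ (Finset.single_le_sum (fun _ _ => Nat.zero_le _) (Finset.mem_univ l))
  rw [h]

lemma stmtCost_le_inr {l : M.Λ} {q₀ q₁} (h : M.code l = .inr (q₀, q₁)) :
    stmtCost q₀ + stmtCost q₁ ≤ stepCost M := by
  refine le_trans ?_ (Finset.single_le_sum (fun _ _ => Nat.zero_le _) (Finset.mem_univ l))
  rw [h]

lemma does_sim_step {l : M.Λ} {s s₁ s' : Store M} {t t' : ℕ} (hl : s.ml = some l)
    (hres : s.fl.res = false) (h : Does (simStep l) s t s₁) (h' : Does (sim M) s₁ t' s') :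
    Does (sim M) s (t + 1 + t' + 1) s' := by
  refine Prog.Exec.loop_step (T := .leaf ()) (g := fun _ => s₁.cfg) (F := fun _ => .leaf s'.cfg)
    (v := s.cfg.1) ?_ (Prog.Exec.dyn ?_) fun _ _ => h'
  · simp [Store.cfg, hl, hres]
  · have : s.cfg.1.2.1 = some l := hl
    rw [this]
    exact h

/-- The simulation consumes an initial segment `u` of the choices `w` and keeps it, in reverse
order, on the stack `path`, from which the address can be restored afterwards. It ends with the flag
`res` set exactly if it is stopped by a missing choice, that is, if `w` leads to a branching. -/
lemma does_sim {c : M.Cfg} {t : ℕ} {T : CompTree M.Cfg} (h : M.Runs c t T) :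
    ∀ (s : Store M) (w : List Bool), s.fl.res = false → s.fl.reg = none → s.aux .feed = w →
      ∃ (c' : M.Cfg) (u w' : List Bool), w = u ++ w' ∧
        Does (sim M) (s.withCfg c) (t * (stepCost M + 7) + 1)
          ((((s.withCfg c').set .feed w').set .path (u.reverse ++ s.aux .path)).setRes
            (decide (T.IsBranching w))) := by
  induction h with
  | halt v S =>
    intro s w hres hreg hw
    refine ⟨⟨none, v, S⟩, [], w, rfl, Does.congr (Prog.Exec.loop_done (by rfl))
      (s₁ := s.withCfg ⟨none, v, S⟩) (Store.ext_aux rfl rfl ?_ rfl fun e => ?_) (by omega)⟩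
    · exact Flags.ext rfl rfl hres rfl rfl
    · by_cases h : e = .path
      · subst h; simp
      · by_cases h' : e = .feed
        · subst h'; simp [hw]
        · simp [h, h']
  | @step l v S q t T hq h ih =>
    intro s w hres hreg hw
    obtain ⟨c', u, w', hu, hd⟩ := ih s w hres hreg hw
    have hc := stmtCost_le_inl hq
    refine ⟨c', u, w', hu, Does.congr (does_sim_step (s := s.withCfg ⟨some l, v, S⟩) rfl hres
      (t := stmtCost q) (s₁ := s.withCfg (TM2.stepAux q v S)) ?_ hd) rfl ?_⟩
    · rw [simStep, hq]
      exact does_trStmt q (s.withCfg ⟨some l, v, S⟩)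
    · rw [Nat.add_mul]; omega
  | @choose l v S q₀ q₁ t₀ t₁ T₀ T₁ hq h₀ h₁ ih₀ ih₁ =>
    intro s w hres hreg hw
    have hc := stmtCost_le_inr hq
    -- the simulation of the subtree below the choice `b`
    have key : ∀ (b : Bool) (w₁ : List Bool) (q : TM2.Stmt (fun _ : M.K => M.Γ) M.Λ M.σ) (t : ℕ)
        (T : CompTree M.Cfg), w = b :: w₁ → stmtCost q ≤ stepCost M → t ≤ max t₀ t₁ →
        (∀ s₁ : Store M, s₁ = ((s.withCfg ⟨some l, v, S⟩).set .feed w₁).setReg (some b) →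
          Does (ifF (fun f => f.reg == none) (setF M fun f => { f with res := true })
            (ifF (fun f => f.reg == some true) (follow true q₁) (follow false q₀))) s₁
            (stmtCost q + 4)
            ((((s.set .feed w₁).set .path (b :: s.aux .path))).withCfg (TM2.stepAux q v S))) →
        (∀ (s : Store M) (w : List Bool), s.fl.res = false → s.fl.reg = none → s.aux .feed = w →
          ∃ (c' : M.Cfg) (u w' : List Bool), w = u ++ w' ∧
            Does (sim M) (s.withCfg (TM2.stepAux q v S)) (t * (stepCost M + 7) + 1)
              ((((s.withCfg c').set .feed w').set .path (u.reverse ++ s.aux .path)).setRes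
                (decide (T.IsBranching w)))) →
        ((CompTree.node T₀ T₁).IsBranching w ↔ T.IsBranching w₁) →
        ∃ (c' : M.Cfg) (u w' : List Bool), w = u ++ w' ∧
          Does (sim M) (s.withCfg ⟨some l, v, S⟩) ((max t₀ t₁ + 1) * (stepCost M + 7) + 1)
            ((((s.withCfg c').set .feed w').set .path (u.reverse ++ s.aux .path)).setRes
              (decide ((CompTree.node T₀ T₁).IsBranching w))) := by
      intro b w₁ q t T hb hcq ht hf ih hT
      obtain ⟨c', u, w', hu, hd⟩ := ih ((s.set .feed w₁).set .path (b :: s.aux .path)) w₁ hres hreg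
        (by simp)
      refine ⟨c', b :: u, w', by rw [hb, hu]; rfl, Does.congr
        (does_sim_step (s := s.withCfg ⟨some l, v, S⟩) rfl hres
          (t := 1 + (stmtCost q + 4)) ?_ hd)
        (Store.ext_aux rfl rfl ?_ rfl fun e => ?_) ?_⟩
      · rw [simStep, hq]
        refine Does.seq (does_bpop _ _) (hf _ ?_)
        simp [hw, hb]
      · simp [hT]
      · simp only [Store.aux_set, Store.aux_setRes, Store.aux_withCfg]
        split_ifs <;> simp_all
      · have := Nat.mul_le_mul_right (stepCost M + 7) ht
        rw [Nat.add_mul]; omega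
    have hfollow : ∀ (b : Bool) (w₁ : List Bool) (q) (s₁ : Store M),
        s₁ = ((s.withCfg ⟨some l, v, S⟩).set .feed w₁).setReg (some b) →
        Does (follow b q) s₁ (1 + (1 + stmtCost q))
          ((((s.set .feed w₁).set .path (b :: s.aux .path))).withCfg (TM2.stepAux q v S)) := by
      rintro b w₁ q s₁ rfl
      refine Does.congr (Does.seq (does_bpush _ _ _) (Does.seq (does_setF _ _) (does_trStmt q _)))
        (Store.ext_aux rfl rfl ?_ rfl fun e => ?_) le_rfl
      · simp [← hreg]
      · simp
    match w, hw with
    | [], hw =>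
      refine ⟨⟨some l, v, S⟩, [], [], rfl, Does.congr (does_sim_step
        (s := s.withCfg ⟨some l, v, S⟩) rfl hres (t := 3)
        (s₁ := ((s.withCfg ⟨some l, v, S⟩).set .feed []).setRes true) ?_
        (Prog.Exec.loop_done (by rfl))) (Store.ext_aux rfl rfl ?_ rfl fun e => ?_) ?_⟩
      · rw [simStep, hq]
        refine Does.congr (Does.seq (does_bpop _ _) (Does.ifF_true ?_ (does_setF _ _)))
          (Store.ext_aux rfl rfl ?_ rfl fun e => ?_) le_rfl
        · simp [hw]
        · simp [hw, ← hreg]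
        · simp [hw]
      · rfl
      · by_cases h : e = .path
        · subst h; simp
        · simp [h]
      · rw [Nat.add_mul]; omega
    | false :: w₁, hw =>
      refine key false w₁ q₀ t₀ T₀ rfl (by omega) (le_max_left _ _) ?_ ih₀ Iff.rfl
      intro s₁ hs₁
      refine Does.mono (Does.ifF_false (by simp [hs₁]) (Does.ifF_false (by simp [hs₁])
        (hfollow _ _ _ _ hs₁))) (by omega)
    | true :: w₁, hw =>
      refine key true w₁ q₁ t₁ T₁ rfl (by omega) (le_max_right _ _) ?_ ih₁ Iff.rfl
      intro s₁ hs₁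
      refine Does.mono (Does.ifF_false (by simp [hs₁]) (Does.ifF_true (by simp [hs₁])
        (hfollow _ _ _ _ hs₁))) (by omega)

/-- Pushes a bit on a stack of the simulated machine. -/
def mpush (k : M.K) (f : Flags → Bool) : MProg M := .push (.inl k) fun v => M.bit (f v.2.2)

lemma does_mpush (s : Store M) (k : M.K) (f : Flags → Bool) :
    Does (mpush k f) s 1 (s.setMs k (M.bit (f s.fl) :: s.ms k)) := by
  unfold Does
  rw [Store.cfg_setMs]
  exact Prog.Exec.push _ _ _ _

/-- Pops a letter from a stack of the simulated machine. -/
noncomputable def mpop (k : M.K) : MProg M :=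
  .pop (.inl k) fun v o => (v.1, v.2.1, { v.2.2 with reg := o.map (decodeBit M) })

lemma does_mpop (s : Store M) (k : M.K) :
    Does (mpop k) s 1 ((s.setMs k (s.ms k).tail).setReg ((s.ms k).head?.map (decodeBit M))) := by
  have h1 : ((s.setMs k (s.ms k).tail).setReg ((s.ms k).head?.map (decodeBit M))).cfg =
      ((s.mv, s.ml, { s.fl with reg := (s.ms k).head?.map (decodeBit M) }),
        (s.setMs k (s.ms k).tail).cfg.2) := rfl
  unfold Does
  rw [h1, Store.cfg_setMs]
  exact Prog.Exec.pop _ _ _ _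

/-- Empties a stack of the simulated machine. -/
noncomputable def mclear (k : M.K) : MProg M := mpop k ;; whileF (fun f => f.reg.isSome) (mpop k)

lemma does_mclear (k : M.K) (s : Store M) (hr : s.fl.reg = none) :
    Does (mclear k) s ((s.ms k).length * 2 + 2) (s.setMs k []) := by
  have loop : ∀ (l : List M.Γ),
      Does (whileF (fun f => f.reg.isSome) (mpop k))
        ((s.setMs k l.tail).setReg (l.head?.map (decodeBit M))) (l.length * 2 + 1)
        (s.setMs k []) := by
    intro l
    induction l with
    | nil =>
      refine Does.congr (does_whileF_done (by rfl)) ?_ (by simp)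
      refine Store.ext_aux rfl rfl ?_ rfl fun e => rfl
      simp [← hr]
    | cons b l ih =>
      refine Does.congr (Does.whileF_step (by rfl) (Does.congr (does_mpop _ _) ?_ le_rfl) ih) rfl ?_
      · refine Store.ext_aux rfl rfl ?_ ?_ fun e => rfl
        · simp [Store.setMs]
        · funext k'
          simp [Store.setMs, Store.setReg]
      · simp; omega
  exact Does.congr (Does.seq (does_mpop s k) (loop _)) rfl (by omega)

/-- Empties the listed stacks of the simulated machine. -/
noncomputable def mclearAll : List M.K → MProg M
  | [] => setF M id
  | k :: ks => mclear k ;; mclearAll ks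

lemma does_mclearAll (L : ℕ) (ks : List M.K) : ∀ s : Store M, s.fl.reg = none →
    (∀ k, (s.ms k).length ≤ L) →
    Does (mclearAll ks) s (ks.length * (L * 2 + 2) + 1)
      { s with ms := fun k => if k ∈ ks then [] else s.ms k } := by
  induction ks with
  | nil =>
    intro s _ _
    exact Does.congr (does_setF _ _) (Store.ext_aux rfl rfl rfl (by simp) fun _ => rfl) (by omega)
  | cons k ks ih =>
    intro s hr hL
    refine Does.congr (Does.seq (does_mclear k s hr) (ih _ hr fun k' => ?_))
      (Store.ext_aux rfl rfl rfl ?_ fun _ => rfl) ?_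
    · by_cases h : k' = k
      · subst h; simp [Store.setMs]
      · simp [Store.setMs, Function.update_of_ne h, hL]
    · funext k'
      by_cases h : k' = k
      · subst h; simp [Store.setMs]
      · simp [Store.setMs, h]
    · have := hL k
      simp only [List.length_cons, Nat.add_mul]
      omega

/-- Writes the input of the simulated machine. -/
noncomputable def loadInput (M : ChoiceTM 1) : MProg M :=
  move M .x .t ;; forPop .t (bpush M .x (fun f => f.reg.getD false) ;;
    mpush (M.inp 0) fun f => f.reg.getD false)

lemma does_loadInput (s : Store M) (hr : s.fl.reg = none) (ht : s.aux .t = [])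
    (hm : s.ms = fun _ => []) :
    Does (loadInput M) s ((s.aux .x).length * 7 + 4)
      (s.setMs (M.inp 0) ((s.aux .x).map M.bit)) := by
  have h1 := does_move s (a := .x) (b := .t) (by decide) hr
  have h2 := does_forPop (a := .t) (p := bpush M .x (fun f => f.reg.getD false) ;;
    mpush (M.inp 0) fun f => f.reg.getD false)
    (g := fun _ (y : List Bool) => (s.set .x y).setMs (M.inp 0) (y.map M.bit))
    (G := fun c y => c :: y) (τ := 2) (fun c => some c) (fun _ _ => True) (fun _ _ _ _ => trivial)
    (fun c l y _ => by
      refine Does.congr (Does.seq (does_bpush _ _ _) (does_mpush _ _ _))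
        (Store.ext_aux rfl rfl rfl ?_ fun e => ?_) le_rfl
      · simp [Store.setMs, Store.set, Store.setReg]
      · simp only [Store.aux_set, Store.aux_setMs, Store.aux_setReg]
        split_ifs <;> simp_all)
    (s.aux .x).reverse [] trivial ((s.set .x []).set .t (s.aux .x).reverse)
      (Store.ext_aux rfl rfl rfl (by
        funext k
        by_cases h : k = M.inp 0
        · subst h; simp [Store.setMs, Store.set, hm]
        · simp [Store.setMs, Store.set, h]) fun e => by simp)
  rw [ht, List.append_nil] at h1
  refine Does.congr (Does.seq h1 h2) (Store.ext_aux rfl rfl ?_ ?_ fun e => ?_) ?_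
  · simp [← hr]
  · simp [Store.setMs, Store.set, Store.setReg]
  · simp only [Store.aux_set, Store.aux_setMs, Store.aux_setReg]
    split_ifs <;> simp_all
  · simp; omega

lemma ChoiceTM.init_stk (M : ChoiceTM 1) (x : List Bool) :
    (M.init ![x]).stk = Function.update (fun _ => []) (M.inp 0) (x.map M.bit) := by
  funext k
  by_cases h : k = M.inp 0
  · subst h
    simp only [ChoiceTM.init, Function.update_self]
    rw [M.inp.injective.extend_apply]
    rfl
  · rw [Function.update_of_ne h]
    simp only [ChoiceTM.init]
    rw [Function.extend_apply']
    rintro ⟨i, rfl⟩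
    exact h (by rw [Subsingleton.elim i 0])

/-- Decides whether the address on the stack `path` is that of a branching. -/
noncomputable def test (M : ChoiceTM 1) : MProg M :=
  setF M (fun f => { f with res := false }) ;; move M .path .feed ;; loadInput M ;;
    .load (fun v => (v.1, some M.main, v.2.2)) ;; sim M ;; move M .feed .path ;;
    mclearAll Finset.univ.toList ;; .load (fun v => (M.init₀, none, v.2.2))

/-- A bound for the running time of `test`, where `n` is the length of the input, `t` the running
time of the simulated machine, and `p` the length of the address. -/
noncomputable def testTime (M : ChoiceTM 1) (n t p : ℕ) : ℕ :=
  6 * p + 7 * n + (t * (stepCost M + 7) + 1) +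
    Fintype.card M.K * ((n + (t * (stepCost M + 7) + 1)) * 2 + 2) + 12

/-- The simulated machine is idle, and the auxiliary stacks and registers used by the subroutines
are empty. -/
structure Store.Idle (s : Store M) : Prop where
  mv : s.mv = M.init₀
  ml : s.ml = none
  ms : s.ms = fun _ => []
  reg : s.fl.reg = none
  ovf : s.fl.ovf = false
  feed : s.aux .feed = []
  t : s.aux .t = []

lemma does_test {x : List Bool} {t : ℕ} {T : CompTree M.Cfg} (h : M.Runs (M.init ![x]) t T)
    (s : Store M) (hs : s.Idle) (hx : s.aux .x = x) :
    Does (test M) s (testTime M x.length t (s.aux .path).length)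
      (s.setRes (decide (T.IsBranching (s.aux .path).reverse))) := by
  set s₁ : Store M := ((s.setRes false).set .path []).set .feed (s.aux .path).reverse with hs₁
  have h1 : Does (setF M fun f => { f with res := false }) s 1 (s.setRes false) :=
    does_setF _ _
  have h2 : Does (move M .path .feed) (s.setRes false) ((s.aux .path).length * 3 + 2) s₁ := by
    refine Does.congr (does_move _ (by decide) hs.reg) ?_ le_rfl
    simp [hs₁, hs.feed]
  have h3 : Does (loadInput M) s₁ (x.length * 7 + 4) (s₁.setMs (M.inp 0) (x.map M.bit)) := by
    have := does_loadInput s₁ hs.reg (by simp [hs₁, hs.t]) hs.ms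
    rwa [show s₁.aux .x = x by simp [hs₁, hx]] at this
  have h4 : Does (.load (fun v => (v.1, some M.main, v.2.2))) (s₁.setMs (M.inp 0) (x.map M.bit)) 1
      (s₁.withCfg (M.init ![x])) := by
    refine Does.congr (s₁ := { s₁.setMs (M.inp 0) (x.map M.bit) with ml := some M.main })
      (Prog.Exec.load _ _ _) (Store.ext_aux hs.mv rfl rfl ?_ fun e => rfl) le_rfl
    rw [Store.ms_withCfg, ChoiceTM.init_stk, ← hs.ms]
    rfl
  obtain ⟨c', u, w', hu, h5⟩ := does_sim h s₁ _ rfl hs.reg rfl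
  have hu' : (s.aux .path).reverse = u ++ w' := by simpa [hs₁] using hu
  have hwl : w'.length ≤ (s.aux .path).length := by
    have := congrArg List.length hu'
    simp at this
    omega
  set s₂ := (((s₁.withCfg c').set .feed w').set .path (u.reverse ++ s₁.aux .path)).setRes
    (decide (T.IsBranching (s₁.aux .feed))) with hs₂
  -- the stacks of the simulated machine are no longer than the time spent allows
  have hlen : ∀ k, (s₂.ms k).length ≤ x.length + (t * (stepCost M + 7) + 1) := by
    intro k
    have := Prog.Exec.length_le h5 s₂.cfg rfl (.inl k)
    refine le_trans this (Nat.add_le_add_right ?_ _)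
    simp only [Store.cfg, Sum.elim_inl, Store.ms_withCfg, ChoiceTM.init_stk]
    by_cases h : k = M.inp 0
    · subst h; simp
    · simp [h]
  have h6 : Does (move M .feed .path) s₂ ((s.aux .path).length * 3 + 2)
      ((s₂.set .feed []).set .path (s.aux .path)) := by
    refine Does.congr (does_move s₂ (by decide) hs.reg) ?_ ?_
    · have : w'.reverse ++ u.reverse = s.aux .path := by
        rw [← List.reverse_append, ← hu', List.reverse_reverse]
      simp [hs₂, hs₁, this]
    · simp [hs₂]; omega
  have h7 := does_mclearAll _ (Finset.univ : Finset M.K).toList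
    ((s₂.set .feed []).set .path (s.aux .path)) hs.reg hlen
  have h8 : ∀ s : Store M, Does (.load (fun v => (M.init₀, none, v.2.2))) s 1
      { s with mv := M.init₀, ml := none } := fun s => Prog.Exec.load _ _ _
  refine Does.congr (Does.seq h1 (Does.seq h2 (Does.seq h3 (Does.seq h4 (Does.seq h5 (Does.seq h6
    (Does.seq h7 (h8 _)))))))) (Store.ext_aux ?_ ?_ ?_ ?_ fun e => ?_) ?_
  · exact hs.mv.symm
  · exact hs.ml.symm
  · simp [hs₂, hs₁]
  · simp [hs.ms]
  · simp only [hs₂, hs₁, Store.aux_set, Store.aux_setRes, Store.aux_withCfg]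
    split_ifs <;> simp_all [hs.feed]
  · simp only [Finset.length_toList, Finset.card_univ, testTime]
    omega

/-! ### Depth-first traversal of a tree -/

namespace CompTree

variable {C : Type}

/-- The number of branchings. -/
def numBr : CompTree C → ℕ
  | leaf _ => 0
  | node l r => l.numBr + r.numBr + 1

lemma numLeaves_eq (T : CompTree C) : T.numLeaves = T.numBr + 1 := by
  induction T with
  | leaf c => rfl
  | node l r hl hr => simp only [numLeaves, numBr, hl, hr]; omega

lemma length_lt_height {T : CompTree C} {w : List Bool} (h : T.IsBranching w) :
    w.length < T.height := by
  induction T generalizing w with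
  | leaf c => exact h.elim
  | node l r hl hr =>
    match w with
    | [] => simp [height]
    | false :: w =>
      have := hl (w := w) h
      simp only [height, List.length_cons]; omega
    | true :: w =>
      have := hr (w := w) h
      simp only [height, List.length_cons]; omega

/-- The node that follows a subtree in depth-first order, if any. Addresses of nodes are written
backwards here, with the last choice first. -/
def up : List Bool → Option (List Bool)
  | [] => none
  | true :: p => up p
  | false :: p => some (true :: p)

/-- Whether the node is a branching of `T`; the value `none` stands for no node. -/
def isBr (T : CompTree C) : Option (List Bool) → Bool
  | none => false
  | some p => decide (T.IsBranching p.reverse)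

/-- One step of the depth-first traversal of `T`; it ends in `none`. -/
def walk (T : CompTree C) : Option (List Bool) → Option (List Bool)
  | none => none
  | some p => if T.IsBranching p.reverse then some (false :: p) else up p

/-- The addresses, written backwards, of the branchings of a subtree with root address `p`. -/
def addrs : CompTree C → List Bool → List (List Bool)
  | leaf _, _ => []
  | node l r, p => p :: (l.addrs (false :: p) ++ r.addrs (true :: p))

lemma length_addrs (S : CompTree C) (p : List Bool) : (S.addrs p).length = S.numBr := by
  induction S generalizing p with
  | leaf c => rfl
  | node l r hl hr => simp [addrs, numBr, hl, hr]

lemma mem_addrs {S : CompTree C} {p q : List Bool} :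
    q ∈ S.addrs p ↔ ∃ w, S.IsBranching w ∧ q = w.reverse ++ p := by
  induction S generalizing p with
  | leaf c => simp [addrs, IsBranching]
  | node l r hl hr =>
    simp only [addrs, List.mem_cons, List.mem_append, hl, hr]
    constructor
    · rintro (rfl | ⟨w, hw, rfl⟩ | ⟨w, hw, rfl⟩)
      · exact ⟨[], trivial, rfl⟩
      · exact ⟨false :: w, hw, by simp⟩
      · exact ⟨true :: w, hw, by simp⟩
    · rintro ⟨w, hw, rfl⟩
      match w with
      | [] => exact Or.inl rfl
      | false :: w => exact Or.inr (Or.inl ⟨w, hw, by simp⟩)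
      | true :: w => exact Or.inr (Or.inr ⟨w, hw, by simp⟩)

lemma nodup_addrs (S : CompTree C) (p : List Bool) : (S.addrs p).Nodup := by
  induction S generalizing p with
  | leaf c => simp [addrs]
  | node l r hl hr =>
    simp only [addrs, List.nodup_cons, List.mem_append, List.nodup_append, hl, hr, true_and]
    refine ⟨?_, ?_⟩
    · rintro (h | h) <;> obtain ⟨w, -, h⟩ := mem_addrs.1 h <;>
        · have := congrArg List.length h
          simp only [List.length_append, List.length_cons] at this
          omega
    · intro a ha b hb hab
      obtain ⟨w, -, rfl⟩ := mem_addrs.1 ha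
      obtain ⟨w', -, rfl⟩ := mem_addrs.1 hb
      have hlen : w.length = w'.length := by simpa using congrArg List.length hab
      simpa using (List.append_inj hab (by simp [hlen])).2

/-- The traversal of a subtree `S` with root address `p` takes `2 * S.numBr + 1` steps, after which
the traversal has left it, and it meets each branching of `S` exactly once. -/
lemma walk_subtree (T : CompTree C) (S : CompTree C) (p : List Bool)
    (h : ∀ w, T.IsBranching (p.reverse ++ w) ↔ S.IsBranching w) :
    (walk T)^[2 * S.numBr + 1] (some p) = up p ∧
    (∀ t < 2 * S.numBr + 1, ((walk T)^[t] (some p)).isSome) ∧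
    ∀ φ : Option (List Bool) → ℕ,
      ∑ t ∈ Finset.range (2 * S.numBr + 1),
        (if isBr T ((walk T)^[t] (some p)) then φ ((walk T)^[t] (some p)) else 0) =
      ((S.addrs p).map fun q => φ (some q)).sum := by
  induction S generalizing p with
  | leaf c =>
    have h0 : ¬ T.IsBranching p.reverse := by
      have := h []
      rw [List.append_nil] at this
      rw [this]; exact id
    refine ⟨by simp [numBr, walk, h0], ?_, fun φ => ?_⟩
    · intro t ht
      obtain rfl : t = 0 := by simp [numBr] at ht; exact ht
      rfl
    · simp [numBr, isBr, h0, addrs]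
  | node l r hl hr =>
    have h0 : T.IsBranching p.reverse := by
      have := h []
      rw [List.append_nil] at this
      rw [this]; trivial
    obtain ⟨l1, l2, l3⟩ := hl (false :: p) fun w => by
      rw [List.reverse_cons, List.append_assoc]; exact h (false :: w)
    obtain ⟨r1, r2, r3⟩ := hr (true :: p) fun w => by
      rw [List.reverse_cons, List.append_assoc]; exact h (true :: w)
    have hstep : walk T (some p) = some (false :: p) := by simp [walk, h0]
    have hl' : ∀ t, (walk T)^[t + 1] (some p) = (walk T)^[t] (some (false :: p)) := by
      intro t; rw [Function.iterate_succ_apply, hstep]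
    have hr' : ∀ t, (walk T)^[(2 * l.numBr + 1 + t) + 1] (some p) =
        (walk T)^[t] (some (true :: p)) := by
      intro t
      rw [hl', Nat.add_comm _ t, Function.iterate_add_apply, l1, up]
    have hsz : 2 * (node l r).numBr + 1 = (2 * l.numBr + 1 + (2 * r.numBr + 1)) + 1 := by
      simp only [numBr]; omega
    rw [hsz]
    refine ⟨?_, fun t ht => ?_, fun φ => ?_⟩
    · rw [hr', r1, up]
    · rcases t with _ | t
      · rfl
      · by_cases ht' : t < 2 * l.numBr + 1
        · rw [hl']; exact l2 t ht'
        · obtain ⟨u, rfl⟩ := Nat.exists_eq_add_of_le (not_lt.1 ht')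
          rw [hr']; exact r2 u (by omega)
    · rw [Finset.sum_range_succ', Finset.sum_range_add]
      simp only [hr']
      simp only [hl']
      rw [l3, r3]
      simp only [Function.iterate_zero, id, isBr, h0, decide_true, if_true, addrs, List.map_cons,
        List.map_append, List.sum_cons, List.sum_append]
      omega

lemma walk_iterate_none (T : CompTree C) (t : ℕ) : (walk T)^[t] none = none :=
  Function.iterate_fixed rfl t

lemma isSome_walk_iff (T : CompTree C) (t : ℕ) :
    ((walk T)^[t] (some [])).isSome ↔ t < 2 * T.numBr + 1 := by
  obtain ⟨h1, h2, -⟩ := walk_subtree T T [] fun w => Iff.rfl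
  refine ⟨fun h => ?_, h2 t⟩
  by_contra hlt
  obtain ⟨u, rfl⟩ := Nat.exists_eq_add_of_le (not_lt.1 hlt)
  rw [Nat.add_comm, Function.iterate_add_apply, h1, up, walk_iterate_none] at h
  simp at h

/-- In the time needed for the whole traversal, each branching is met exactly once. -/
lemma sum_walk (T : CompTree C) {N : ℕ} (hN : 2 * T.numBr + 1 ≤ N) (φ : Option (List Bool) → ℕ) :
    ∑ t ∈ Finset.range N,
      (if isBr T ((walk T)^[t] (some [])) then φ ((walk T)^[t] (some [])) else 0) =
    ((T.addrs []).map fun q => φ (some q)).sum := by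
  obtain ⟨h1, -, h3⟩ := walk_subtree T T [] fun w => Iff.rfl
  obtain ⟨u, rfl⟩ := Nat.exists_eq_add_of_le hN
  rw [Finset.sum_range_add, h3, Nat.add_eq_left]
  refine Finset.sum_eq_zero fun t _ => ?_
  rw [Nat.add_comm, Function.iterate_add_apply, h1, up, walk_iterate_none]
  rfl

/-- One step of the traversal, with a count of the branchings that have been left. -/
def walkCount (T : CompTree C) (a : Option (List Bool) × ℕ) : Option (List Bool) × ℕ :=
  (walk T a.1, if isBr T a.1 then a.2 + 1 else a.2)

lemma walkCount_iterate (T : CompTree C) (t : ℕ) (a : Option (List Bool)) (c : ℕ) :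
    (walkCount T)^[t] (a, c) = ((walk T)^[t] a,
      c + ∑ i ∈ Finset.range t, if isBr T ((walk T)^[i] a) then 1 else 0) := by
  induction t with
  | zero => simp
  | succ t ih =>
    rw [Function.iterate_succ_apply', ih, walkCount, Finset.sum_range_succ,
      Function.iterate_succ_apply']
    refine Prod.ext rfl ?_
    simp only
    split_ifs <;> omega

/-- A traversal that has ended has counted all branchings. -/
lemma walkCount_finished (T : CompTree C) {N : ℕ} (hN : 2 * T.numBr + 1 ≤ N) :
    (walkCount T)^[N] (some [], 0) = (none, T.numBr) := by
  rw [walkCount_iterate]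
  have h1 := sum_walk T hN fun _ => 1
  have h2 := isSome_walk_iff T N
  refine Prod.ext ?_ ?_
  · have : ¬ N < 2 * T.numBr + 1 := by omega
    rw [← h2] at this
    simpa using this
  · simp only [h1]
    simp [length_addrs]

lemma up_length {p q : List Bool} (h : up p = some q) : q.length ≤ p.length := by
  induction p with
  | nil => simp [up] at h
  | cons b p ih =>
    cases b
    · simp only [up, Option.some.injEq] at h; subst h; simp
    · have := ih h
      simp only [List.length_cons]; omega

/-- The traversal stays inside the tree. -/
lemma walk_length {T : CompTree C} {a : Option (List Bool)} {N : ℕ} (hN : T.height ≤ N)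
    (h : (a.getD []).length ≤ N) : ((walk T a).getD []).length ≤ N := by
  cases a with
  | none => simp [walk]
  | some p =>
    simp only [walk]
    split_ifs with hb
    · have := length_lt_height hb
      simp only [List.length_reverse] at this
      simp; omega
    · cases hu : up p with
      | none => simp
      | some q => exact (up_length hu).trans h

lemma walk_iterate_length {T : CompTree C} {N : ℕ} (hN : T.height ≤ N) (t : ℕ) :
    (((walk T)^[t] (some [])).getD []).length ≤ N := by
  induction t with
  | zero => simp
  | succ t ih => rw [Function.iterate_succ_apply']; exact walk_length hN ih

lemma walkCount_iterate_le (T : CompTree C) (t : ℕ) :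
    ((walkCount T)^[t] (some [], 0)).2 ≤ t := by
  induction t with
  | zero => simp
  | succ t ih =>
    rw [Function.iterate_succ_apply']
    simp only [walkCount]
    split_ifs <;> omega

end CompTree

/-! ### Subroutines -/

open CompTree

namespace Store

/-- Makes `a` the current node. -/
def setCur (s : Store M) (a : Option (List Bool)) : Store M :=
  (s.set .path (a.getD [])).setLive a.isSome

@[simp] lemma mv_setCur (s : Store M) (a) : (s.setCur a).mv = s.mv := rfl
@[simp] lemma ml_setCur (s : Store M) (a) : (s.setCur a).ml = s.ml := rfl
@[simp] lemma ms_setCur (s : Store M) (a) : (s.setCur a).ms = s.ms := rfl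
@[simp] lemma fl_setCur (s : Store M) (a) :
    (s.setCur a).fl = { s.fl with live := a.isSome } := rfl
@[simp] lemma aux_setCur (s : Store M) (a b) :
    (s.setCur a).aux b = if b = .path then a.getD [] else s.aux b := by simp [setCur]

lemma setCur_self {s : Store M} {a : Option (List Bool)} (hp : s.aux .path = a.getD [])
    (hl : s.fl.live = a.isSome) : s.setCur a = s := by
  refine ext_aux rfl rfl ?_ rfl fun e => ?_
  · simp [← hl]
  · rw [aux_setCur]
    split_ifs with h
    · rw [h, hp]
    · rfl

lemma Idle.of_eq {s s' : Store M} (h : s.Idle) (hv : s'.mv = s.mv) (hl : s'.ml = s.ml)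
    (hm : s'.ms = s.ms) (hr : s'.fl.reg = s.fl.reg) (ho : s'.fl.ovf = s.fl.ovf)
    (hf : s'.aux .feed = s.aux .feed) (ht : s'.aux .t = s.aux .t) : s'.Idle :=
  ⟨hv.trans h.mv, hl.trans h.ml, hm.trans h.ms, hr.trans h.reg, ho.trans h.ovf, hf.trans h.feed,
    ht.trans h.t⟩

end Store

/-- Moves from a node that is not a branching to the next one in depth-first order. -/
noncomputable def next (M : ChoiceTM 1) : MProg M :=
  bpop M .path ;; whileF (fun f => f.reg == some true) (bpop M .path) ;;
    ifF (fun f => f.reg == some false)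
      (bpush M .path (fun _ => true) ;; setF M fun f => { f with reg := none })
      (setF M fun f => { f with live := false })

lemma does_next (s : Store M) (hr : s.fl.reg = none) (hl : s.fl.live = true) :
    Does (next M) s ((s.aux .path).length * 2 + 5) (s.setCur (up (s.aux .path))) := by
  have tail : ∀ p : List Bool,
      Does (whileF (fun f => f.reg == some true) (bpop M .path) ;;
        ifF (fun f => f.reg == some false)
          (bpush M .path (fun _ => true) ;; setF M fun f => { f with reg := none })
          (setF M fun f => { f with live := false }))
        ((s.set .path p.tail).setReg p.head?) (p.length * 2 + 4) (s.setCur (up p)) := by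
    intro p
    have loop : ∀ p : List Bool, Does (whileF (fun f => f.reg == some true) (bpop M .path))
        ((s.set .path p.tail).setReg p.head?) (p.length * 2 + 1)
        ((s.set .path (p.dropWhile id).tail).setReg (p.dropWhile id).head?) := by
      intro p
      induction p with
      | nil => exact Does.mono (does_whileF_done (by rfl)) (by simp)
      | cons b p ih =>
        cases b
        · exact Does.mono (does_whileF_done (by rfl)) (by simp)
        · refine Does.congr (Does.whileF_step (by rfl) (Does.congr (does_bpop _ _)
            (s₂ := (s.set .path p.tail).setReg p.head?)
            (Store.ext_aux rfl rfl ?_ rfl fun e => ?_) le_rfl) ih) rfl ?_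
          · simp
          · simp only [Store.aux_set, Store.aux_setReg]
            split_ifs <;> simp_all
          · simp; omega
    have hup : up p = if (p.dropWhile id).head? = some false
        then some (true :: (p.dropWhile id).tail) else none := by
      induction p with
      | nil => rfl
      | cons b p ih => cases b <;> simp [up, ih]
    have hd := head?_dropWhile_id p
    by_cases hall : p.all id = true
    · have h1 := loop p
      rw [hup]
      rw [dropWhile_id_of_all hall] at h1 ⊢
      refine Does.congr (Does.seq h1 (Does.ifF_false (by simp) (does_setF _ _)))
        (Store.ext_aux rfl rfl ?_ rfl fun e => ?_) (by omega)
      · simp [hr]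
      · simp
    · rw [if_neg hall] at hd
      rw [hup, if_pos hd]
      have h1 := loop p
      rw [hd] at h1
      refine Does.congr (Does.seq h1 (Does.ifF_true (by simp)
        (Does.seq (does_bpush _ _ _) (does_setF _ _))))
        (Store.ext_aux rfl rfl ?_ rfl fun e => ?_) (by omega)
      · simp [← hr, ← hl]
      · simp only [Store.aux_set, Store.aux_setReg, Store.aux_withFl, Store.aux_setCur]
        split_ifs <;> simp_all
  exact Does.congr (Does.seq (does_bpop _ _) (tail _)) rfl (by omega)

/-- Tests whether there is a current node and it is a branching. -/
noncomputable def testCur (M : ChoiceTM 1) : MProg M :=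
  ifF (fun f => f.live) (test M) (setF M fun f => { f with res := false })

/-- One step of the depth-first traversal, which executes `e` at the branchings. -/
noncomputable def dfs (e : MProg M) : MProg M :=
  testCur M ;; ifF (fun f => f.res)
    (e ;; bpush M .path (fun _ => false) ;; setF M fun f => { f with res := false })
    (ifF (fun f => f.live) (next M) (setF M id))

section

variable {x : List Bool} {t : ℕ} {T : CompTree M.Cfg} (h : M.Runs (M.init ![x]) t T)

include h

lemma does_testCur (s : Store M) (hs : s.Idle) (hx : s.aux .x = x) (a : Option (List Bool))
    {N : ℕ} (hN : (a.getD []).length ≤ N) :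
    Does (testCur M) (s.setCur a) (testTime M x.length t N + 1)
      ((s.setCur a).setRes (isBr T a)) := by
  cases a with
  | none =>
    refine Does.congr (Does.ifF_false (by rfl) (does_setF _ _)) rfl ?_
    simp only [testTime]; omega
  | some p =>
    have hN' : p.length ≤ N := hN
    have h1 := does_test h (s.setCur (some p))
      (hs.of_eq rfl rfl rfl rfl rfl (by simp) (by simp)) (by simp [hx])
    refine Does.congr (Does.ifF_true (by rfl) h1) ?_ ?_
    · simp [isBr]
    · simp [testTime]; omega

lemma does_dfs {e : MProg M} {τ : ℕ} (s : Store M) (hs : s.Idle) (hx : s.aux .x = x)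
    (hres : s.fl.res = false) (a : Option (List Bool)) (l : List Bool)
    (he : isBr T a = true → Does e ((s.setCur a).setRes true) τ
      (((s.setCur a).setRes true).set .cnt l)) {N : ℕ} (hN : (a.getD []).length ≤ N) :
    Does (dfs e) (s.setCur a) (testTime M x.length t N + τ + 2 * N + 10)
      ((s.set .cnt (if isBr T a then l else s.aux .cnt)).setCur (walk T a)) := by
  have h1 := does_testCur h s hs hx a hN
  cases hb : isBr T a
  · rw [hb] at h1
    cases a with
    | none =>
      refine Does.congr (Does.seq h1 (Does.ifF_false (by rfl) (Does.ifF_false (by rfl)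
        (does_setF _ _)))) (Store.ext_aux rfl rfl ?_ rfl fun e => ?_) (by omega)
      · simp [walk, ← hres]
      · simp only [walk, Store.aux_withFl, Store.aux_setRes, Store.aux_setCur, Store.aux_set]
        split_ifs <;> simp_all
    | some p =>
      have hN' : p.length ≤ N := hN
      have hb' : ¬ T.IsBranching p.reverse := by simpa [isBr] using hb
      refine Does.congr (Does.seq h1 (Does.ifF_false (by rfl) (Does.ifF_true (by rfl)
        (does_next _ (by simp [hs.reg]) (by rfl)))))
        (Store.ext_aux rfl rfl ?_ rfl fun e => ?_) ?_
      · simp [walk, ← hres, hb']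
      · simp only [walk, hb', Store.aux_setRes, Store.aux_setCur, Store.aux_set]
        split_ifs <;> simp_all
      · simp; omega
  · rw [hb] at h1
    cases a with
    | none => simp [isBr] at hb
    | some p =>
      have hb' : T.IsBranching p.reverse := by simpa [isBr] using hb
      refine Does.congr (Does.seq h1 (Does.ifF_true (by rfl) (Does.seq (he hb)
        (Does.seq (does_bpush _ _ _) (does_setF _ _)))))
        (Store.ext_aux rfl rfl ?_ rfl fun e => ?_) (by omega)
      · simp [walk, ← hres, hb']
      · simp only [walk, hb', Store.aux_setRes, Store.aux_setCur, Store.aux_set, Store.aux_withFl]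
        split_ifs <;> simp_all

end

lemma length_bits_le {y h : ℕ} (hy : y < 2 ^ h) : y.bits.length ≤ h := by
  rw [Nat.size_eq_bits_len]; exact Nat.size_le.2 hy

/-- One step of the traversal, which counts the branchings. -/
noncomputable def dfsCount (M : ChoiceTM 1) : MProg M := dfs (inc M .cnt)

/-- One step of the traversal. -/
noncomputable def dfsPlain (M : ChoiceTM 1) : MProg M := dfs (setF M id)

lemma does_dfsCount {x : List Bool} {t : ℕ} {T : CompTree M.Cfg}
    (h : M.Runs (M.init ![x]) t T) (s : Store M) (hs : s.Idle) (hx : s.aux .x = x)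
    (hres : s.fl.res = false) (a : Option (List Bool) × ℕ) {N L : ℕ}
    (hN : (a.1.getD []).length ≤ N) (hL : a.2 < 2 ^ L) :
    Does (dfsCount M) ((s.set .cnt a.2.bits).setCur a.1)
      (testTime M x.length t N + (L * 6 + 8) + 2 * N + 10)
      ((s.set .cnt (walkCount T a).2.bits).setCur (walkCount T a).1) := by
  have hlen := length_bits_le hL
  refine Does.congr (does_dfs h (s.set .cnt a.2.bits) (hs.of_eq rfl rfl rfl rfl rfl (by simp)
    (by simp)) (by simp [hx]) hres a.1 (a.2 + 1).bits (τ := L * 6 + 8) (fun _ => ?_) hN) ?_ le_rfl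
  · refine Does.congr (does_inc _ (by decide) (by simp [hs.t]) (by simp [hs.reg])) ?_ ?_
    · simp [incGrow_bits]
    · simp; omega
  · refine Store.ext_aux rfl rfl rfl rfl fun e => ?_
    simp only [walkCount, Store.aux_setCur, Store.aux_set]
    split_ifs <;> simp_all

lemma does_dfsPlain {x : List Bool} {t : ℕ} {T : CompTree M.Cfg}
    (h : M.Runs (M.init ![x]) t T) (s : Store M) (hs : s.Idle) (hx : s.aux .x = x)
    (hres : s.fl.res = false) (a : Option (List Bool)) {N : ℕ} (hN : (a.getD []).length ≤ N) :
    Does (dfsPlain M) (s.setCur a) (testTime M x.length t N + 2 * N + 11)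
      (s.setCur (walk T a)) := by
  refine Does.congr (does_dfs h s hs hx hres a (s.aux .cnt) (τ := 1) (fun _ => ?_) hN) ?_ ?_
  · refine Does.congr (does_setF _ _) (Store.ext_aux rfl rfl rfl rfl fun e => ?_) le_rfl
    simp only [Store.aux_set, Store.aux_setRes, Store.aux_withFl, Store.aux_setCur]
    split_ifs <;> simp_all
  · refine Store.ext_aux rfl rfl rfl rfl fun e => ?_
    simp only [Store.aux_setCur, Store.aux_set]
    split_ifs <;> simp_all
  · omega

/-! ### Random nodes and random numbers -/

namespace CompTree

/-- Appends a choice to an address that is written backwards. Before the address has begun,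
zeros are skipped, and the first one begins the address. -/
def extend : Option (List Bool) → Bool → Option (List Bool)
  | none, b => if b then some [] else none
  | some p, b => some (b :: p)

/-- Extends an address by a random choice. -/
def extendT (a : Option (List Bool)) : CompTree (Option (List Bool)) :=
  .node (.leaf (extend a false)) (.leaf (extend a true))

/-- Adds a random least significant digit. -/
def digitT (l : List Bool) : CompTree (List Bool) := .node (.leaf (false :: l)) (.leaf (true :: l))

lemma length_of_mem_digitT {h : ℕ} : ∀ {l l' : List Bool}, (iter digitT h l).Mem l' →
    l'.length = l.length + h := by
  induction h with
  | zero => rintro l l' rfl; rfl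
  | succ h ih =>
    intro l l' hm
    obtain ⟨m, rfl | rfl, hm⟩ := mem_bind.1 hm <;>
      simpa [Nat.add_comm, Nat.add_left_comm] using ih hm

lemma length_of_mem_extendT {h : ℕ} : ∀ {a a' : Option (List Bool)}, (iter extendT h a).Mem a' →
    (a'.getD []).length ≤ (a.getD []).length + h := by
  induction h with
  | zero => rintro a a' rfl; rfl
  | succ h ih =>
    intro a a' hm
    obtain ⟨m, hm', hm⟩ := mem_bind.1 hm
    have := ih hm
    have h2 : (m.getD []).length ≤ (a.getD []).length + 1 := by
      rcases hm' with rfl | rfl <;> cases a <;> simp [extend]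
    omega

end CompTree

lemma foldT_const {ι : Type} (F : ι → CompTree ι) (l : List Bool) (y : ι) :
    foldT (fun _ => F) l y = iter F l.length y := by
  induction l generalizing y with
  | nil => rfl
  | cons b l ih => exact bind_congr _ fun z _ => ih z

/-- Generates a random address, starting from no node. -/
noncomputable def gen (M : ChoiceTM 1) : MProg M :=
  forPop .n (bpush M .t (fun _ => true) ;; tossF M ;; ifF (fun f => f.live)
    (bpush M .path fun f => f.reg.getD false)
    (setF M fun f => { f with live := f.reg.getD false }) ;;
    setF M fun f => { f with reg := none }) ;; move M .t .n

/-- Extending the current address by the letter in the register. -/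
lemma does_extend (s : Store M) (a : Option (List Bool)) (b : Bool) (hb : s.fl.reg = some b) :
    Does (ifF (fun f => f.live) (bpush M .path fun f => f.reg.getD false)
      (setF M fun f => { f with live := f.reg.getD false })) (s.setCur a) 2
      (s.setCur (extend a b)) := by
  cases a with
  | none =>
    refine Does.congr (Does.ifF_false (by rfl) (does_setF _ _))
      (Store.ext_aux rfl rfl ?_ rfl fun e => ?_) le_rfl
    · cases b <;> simp [hb, extend]
    · cases b <;> simp [extend]
  | some p =>
    refine Does.congr (Does.ifF_true (by rfl) (does_bpush _ _ _))
      (Store.ext_aux rfl rfl ?_ rfl fun e => ?_) le_rfl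
    · simp [extend]
    · simp only [extend, Store.aux_setCur, Store.aux_set]
      split_ifs <;> simp_all

lemma yields_gen (s : Store M) (hs : s.Idle) {N : ℕ} (hn : s.aux .n = unary N)
    (a : Option (List Bool)) :
    Yields (gen M) (s.setCur a) (N * 10 + 4) (iter extendT N a) s.setCur := by
  have h1 := yields_forPop (a := .n) (p := bpush M .t (fun _ => true) ;; tossF M ;;
    ifF (fun f => f.live) (bpush M .path fun f => f.reg.getD false)
    (setF M fun f => { f with live := f.reg.getD false }) ;;
    setF M fun f => { f with reg := none })
    (g := fun l y => (s.set .t (List.replicate (N - l.length) true)).setCur y)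
    (F := fun _ => fun y => extendT y) (τ := 5) (fun _ => none) (fun l _ => l.length ≤ N)
    (fun b l y h _ _ => by simp only [List.length_cons] at h; omega)
    (fun c l y h => by
      rw [List.length_cons] at h
      have hN : N - l.length = (N - (l.length + 1)) + 1 := by omega
      refine Yields.of_map (T := .node (.leaf false) (.leaf true)) (h := extend y) (Yields.mono
        (Does.seq_yields (does_bpush _ _ _) (Yields.seq_does (t' := 3) (yields_tossF _)
          fun b _ => ?_)) le_rfl)
      set s' : Store M :=
        ((s.set .t (List.replicate (N - l.length) true)).set .n l).setReg (some b) with hs'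
      refine Does.congr (Does.start (s := s'.setCur y) (Does.seq (does_extend s' y b rfl)
        (does_setF _ _)) (Store.ext_aux rfl rfl ?_ rfl fun e => ?_))
        (Store.ext_aux rfl rfl ?_ rfl fun e => ?_) le_rfl
      · simp [hs']
      · simp only [hs', Store.aux_set, Store.aux_setCur, Store.aux_setReg]
        split_ifs <;> simp_all [List.replicate_succ]
      · simp [hs']
      · simp only [hs', Store.aux_set, Store.aux_setCur, Store.aux_setReg, Store.aux_withFl]
        split_ifs <;> simp_all)
    (unary N) a (by simp [unary]) (s.setCur a) (Store.ext_aux rfl rfl rfl rfl fun e => by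
      simp only [Store.aux_set, Store.aux_setCur]
      split_ifs <;> simp_all [unary, hs.t])
  rw [foldT_const] at h1
  simp only [unary, List.length_replicate] at h1
  refine Yields.mono (Yields.seq_does h1 (t' := N * 3 + 2) fun y _ =>
    Does.congr (does_move _ (by decide) rfl) (Store.ext_aux rfl
      rfl ?_ rfl fun e => ?_) ?_) (by omega)
  · simp [hs.reg]
  · simp only [Store.aux_set, Store.aux_setCur, Store.aux_setReg]
    split_ifs <;> simp_all [unary, hs.t]
  · simp

/-- Replaces the number on the counter by a random number with the same number of digits. -/
noncomputable def randomize (M : ChoiceTM 1) (c : Aux) : MProg M :=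
  move M c .t ;; forPop .t (tossF M ;; bpush M c (fun f => f.reg.getD false) ;;
    setF M fun f => { f with reg := none })

lemma yields_randomize (s : Store M) {c : Aux} (hc : c ≠ .t) (ht : s.aux .t = [])
    (hr : s.fl.reg = none) :
    Yields (randomize M c) s ((s.aux c).length * 8 + 4) (iter digitT (s.aux c).length [])
      fun y => s.set c y := by
  have h1 := does_move s hc hr
  have h2 := yields_forPop (a := .t) (p := tossF M ;; bpush M c (fun f => f.reg.getD false) ;;
    setF M fun f => { f with reg := none })
    (g := fun _ y => s.set c y)
    (F := fun _ => fun y => digitT y) (τ := 3) (fun _ => none) (fun l _ => True)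
    (fun b l y h _ _ => trivial)
    (fun b l y h => by
      refine Yields.of_map (T := .node (.leaf false) (.leaf true)) (h := fun b => b :: y)
        (Yields.mono (Yields.seq_does (t' := 2) (yields_tossF _) fun b _ => ?_) le_rfl)
      refine Does.congr (Does.seq (does_bpush _ _ _) (does_setF _ _))
        (Store.ext_aux rfl rfl ?_ rfl fun e => ?_) le_rfl
      · simp
      · simp only [Store.aux_set, Store.aux_setReg, Store.aux_withFl]
        split_ifs <;> simp_all)
    (s.aux c).reverse [] trivial _ rfl
  rw [foldT_const, List.length_reverse] at h2
  refine Yields.congr (Does.seq_yields (Does.congr h1 ?_ le_rfl) h2) (fun y _ => ?_) (by omega)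
  · refine Store.ext_aux rfl rfl rfl rfl fun e => ?_
    simp only [Store.aux_set]
    split_ifs <;> simp_all
  · refine Store.ext_aux rfl rfl ?_ rfl fun e => ?_
    · simp [← hr]
    · simp only [Store.aux_set, Store.aux_setReg]
      split_ifs <;> simp_all

/-- Pushes half as many zeros as there are letters on the stack `n`: rounded up on `c1` and `c2`,
rounded down on `sh`. -/
noncomputable def half (M : ChoiceTM 1) : MProg M :=
  forPop .n (bpush M .t (fun _ => true) ;; ifF (fun f => f.res)
    (bpush M .sh (fun _ => false) ;; setF M fun f => { f with reg := none, res := false })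
    (bpush M .c1 (fun _ => false) ;; bpush M .c2 (fun _ => false) ;;
      setF M fun f => { f with reg := none, res := true })) ;;
  move M .t .n ;; setF M fun f => { f with res := false }

/-- The store after `i` letters have been read by `half`. -/
def halfStore (s : Store M) (i : ℕ) : Store M :=
  ((((s.set .c1 (List.replicate ((i + 1) / 2) false)).set .c2
    (List.replicate ((i + 1) / 2) false)).set .sh (List.replicate (i / 2) false)).set .t
    (List.replicate i true)).setRes (decide (i % 2 = 1))

@[simp] lemma mv_halfStore (s : Store M) (i : ℕ) : (halfStore s i).mv = s.mv := by simp [halfStore]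
@[simp] lemma ml_halfStore (s : Store M) (i : ℕ) : (halfStore s i).ml = s.ml := by simp [halfStore]
@[simp] lemma ms_halfStore (s : Store M) (i : ℕ) : (halfStore s i).ms = s.ms := by simp [halfStore]

lemma does_half_body (s : Store M) (i : ℕ) (l : List Bool) (b : Bool) :
    Does (bpush M .t (fun _ => true) ;; ifF (fun f => f.res)
      (bpush M .sh (fun _ => false) ;; setF M fun f => { f with reg := none, res := false })
      (bpush M .c1 (fun _ => false) ;; bpush M .c2 (fun _ => false) ;;
        setF M fun f => { f with reg := none, res := true }))
      (((halfStore s i).set .n l).setReg (some b)) 5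
      (((halfStore s (i + 1)).set .n l).setReg none) := by
  rcases Nat.mod_two_eq_zero_or_one i with hm | hm
  · have e1 : (i + 1 + 1) / 2 = (i + 1) / 2 + 1 := by omega
    have e2 : (i + 1) / 2 = i / 2 := by omega
    have e3 : (i + 1) % 2 = 1 := by omega
    refine Does.congr (Does.seq (does_bpush _ _ _) (Does.ifF_false ?_
      (Does.seq (does_bpush _ _ _) (Does.seq (does_bpush _ _ _) (does_setF _ _)))))
      (Store.ext_aux (by simp) (by simp) ?_ (by simp) fun e => ?_) le_rfl
    · simp [halfStore, hm]
    · simp [halfStore, e3]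
    · cases e <;> simp [halfStore, e1, e2, List.replicate_succ]
  · have e1 : (i + 1 + 1) / 2 = (i + 1) / 2 := by omega
    have e2 : (i + 1) / 2 = i / 2 + 1 := by omega
    have e3 : (i + 1) % 2 = 0 := by omega
    refine Does.congr (Does.seq (does_bpush _ _ _) (Does.ifF_true ?_
      (Does.seq (does_bpush _ _ _) (does_setF _ _))))
      (Store.ext_aux (by simp) (by simp) ?_ (by simp) fun e => ?_) (by omega)
    · simp [halfStore, hm]
    · simp [halfStore, e3]
    · cases e <;> simp [halfStore, e1, e2, List.replicate_succ]

lemma does_half (s : Store M) (hs : s.Idle) {N : ℕ} (hn : s.aux .n = unary N)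
    (hres : s.fl.res = false) (h1 : s.aux .c1 = []) (h2 : s.aux .c2 = []) (h3 : s.aux .sh = []) :
    Does (half M) s (N * 10 + 5)
      (((s.set .c1 (List.replicate ((N + 1) / 2) false)).set .c2
        (List.replicate ((N + 1) / 2) false)).set .sh (List.replicate (N / 2) false)) := by
  have hs0 : s = (halfStore s (N - (unary N).length)).set .n (unary N) := by
    refine Store.ext_aux (by simp) (by simp) ?_ (by simp) fun e => ?_
    · simp [halfStore, unary, ← hres]
    · cases e <;> simp [halfStore, unary, h1, h2, h3, hs.t, hn]
  have h4 := does_forPop (a := .n) (g := fun l (_ : Unit) => halfStore s (N - l.length))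
    (G := fun _ y => y) (τ := 5) (fun _ => none) (fun l _ => l.length ≤ N)
    (fun b l y h => by simp only [List.length_cons] at h; omega)
    (fun b l y h => by
      rw [List.length_cons] at h
      have hi : N - l.length = (N - (b :: l).length) + 1 := by rw [List.length_cons]; omega
      rw [hi]
      exact does_half_body s _ l b)
    (unary N) () (by simp [unary]) s hs0
  simp only [List.length_nil, Nat.sub_zero] at h4
  have h5 := does_move (((halfStore s N).set .n []).setReg none) (a := .t) (b := .n) (by decide) rfl
  refine Does.congr (Does.seq h4 (Does.seq h5 (does_setF _ _))) ?_ ?_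
  · refine Store.ext_aux (by simp) (by simp) ?_ (by simp) fun e => ?_
    · simp [halfStore, hs.reg, Flags.ext_iff, hres]
    · cases e <;> simp [halfStore, hs.t, hn, unary]
  · simp [halfStore, unary]; omega

/-- Pushes `j` zeros. -/
def bpushN (M : ChoiceTM 1) (b : Aux) : ℕ → MProg M
  | 0 => setF M id
  | j + 1 => bpush M b (fun _ => false) ;; bpushN M b j

lemma does_bpushN (b : Aux) (j : ℕ) : ∀ s : Store M,
    Does (bpushN M b j) s (j + 1) (s.set b (List.replicate j false ++ s.aux b)) := by
  induction j with
  | zero =>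
    intro s
    refine Does.congr (does_setF _ _) (Store.ext_aux rfl rfl rfl rfl fun e => ?_) le_rfl
    simp only [Store.aux_set, Store.aux_withFl]
    split_ifs <;> simp_all
  | succ j ih =>
    intro s
    refine Does.congr (Does.seq (does_bpush _ _ _) (ih _))
      (Store.ext_aux rfl rfl rfl rfl fun e => ?_) (by omega)
    simp only [Store.aux_set]
    split_ifs <;> simp_all [List.replicate_succ']

/-- Empties the stack `a` and pushes `j` zeros on `b` for each letter. -/
noncomputable def drain (M : ChoiceTM 1) (a b : Aux) (j : ℕ) : MProg M := forPop a (bpushN M b j)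

lemma foldl_replicate (j : ℕ) (l y : List Bool) :
    l.foldl (fun y _ => List.replicate j false ++ y) y =
      List.replicate (j * l.length) false ++ y := by
  induction l generalizing y with
  | nil => simp
  | cons b l ih =>
    rw [List.foldl_cons, ih, ← List.append_assoc, List.replicate_append_replicate,
      List.length_cons, Nat.mul_succ]

lemma does_drain (s : Store M) {a b : Aux} (hab : a ≠ b) (j : ℕ) (hr : s.fl.reg = none) :
    Does (drain M a b j) s ((s.aux a).length * (j + 3) + 2)
      ((s.set a []).set b (List.replicate (j * (s.aux a).length) false ++ s.aux b)) := by
  have := does_forPop (a := a) (p := bpushN M b j) (g := fun _ y => s.set b y)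
    (G := fun _ y => List.replicate j false ++ y) (τ := j + 1) (fun c => some c) (fun _ _ => True)
    (fun _ _ _ _ => trivial)
    (fun c l y _ => by
      refine Does.congr (does_bpushN _ _ _) (Store.ext_aux rfl rfl rfl rfl fun e => ?_) le_rfl
      simp only [Store.aux_set, Store.aux_setReg]
      split_ifs <;> simp_all)
    (s.aux a) (s.aux b) trivial s (by
      refine Store.ext_aux rfl rfl rfl rfl fun e => ?_
      simp only [Store.aux_set]
      split_ifs <;> simp_all)
  refine Does.congr this (Store.ext_aux rfl rfl ?_ rfl fun e => ?_) le_rfl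
  · simp [← hr]
  · rw [foldl_replicate]
    simp only [Store.aux_set, Store.aux_setReg]
    split_ifs <;> simp_all

/-- Empties the stack `a` and pushes `j` zeros on `b` for each binary digit of its length. -/
noncomputable def addLog (M : ChoiceTM 1) (a b : Aux) (j : ℕ) : MProg M :=
  forPop a (setF M (fun f => { f with reg := none }) ;; inc M .cnt) ;; drain M .cnt b j

lemma does_addLog (s : Store M) (hs : s.Idle) {a b : Aux} (ha : a ≠ .cnt) (hb : .cnt ≠ b)
    (hat : a ≠ .t) (hab : a ≠ b) (j : ℕ) (hcnt : s.aux .cnt = []) {L : ℕ}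
    (hL : (s.aux a).length ≤ L) :
    Does (addLog M a b j) s (L * (L * 6 + 11) + L * (j + 3) + 4)
      ((s.set a []).set b (List.replicate (j * (s.aux a).length.size) false ++ s.aux b)) := by
  have hlt : ∀ y ≤ L, y.bits.length ≤ L := fun y hy =>
    length_bits_le (hy.trans_lt Nat.lt_two_pow_self)
  have h1 := does_forPop (a := a) (p := setF M (fun f => { f with reg := none }) ;; inc M .cnt)
    (g := fun _ (y : ℕ) => s.set .cnt y.bits)
    (G := fun _ y => y + 1) (τ := L * 6 + 9) (fun _ => none) (fun l y => y + l.length ≤ L)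
    (fun c l y h => by simp only [List.length_cons] at h; omega)
    (fun c l y h => by
      have := hlt y (by omega)
      refine Does.congr (Does.seq (does_setF _ _) (does_inc _ (by decide) ?_ (by rfl)))
        (Store.ext_aux rfl rfl rfl rfl fun e => ?_) ?_
      · simp [hat.symm, hs.t]
      · simp only [Store.aux_set, Store.aux_setReg, Store.aux_withFl]
        split_ifs <;> simp_all [incGrow_bits]
      · simp [ha.symm]; omega)
    (s.aux a) 0 (by omega) s (by
      refine Store.ext_aux rfl rfl rfl rfl fun e => ?_
      simp only [Store.aux_set]
      split_ifs <;> simp_all)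
  have hf : (s.aux a).foldl (fun y _ => y + 1) 0 = (s.aux a).length := by
    simp
  rw [hf] at h1
  have hlen := hlt _ hL
  refine Does.congr (Does.seq h1 (does_drain _ hb j (by rfl)))
    (Store.ext_aux rfl rfl ?_ rfl fun e => ?_) ?_
  · simp [← hs.reg]
  · simp only [Store.aux_set, Store.aux_setReg]
    split_ifs <;> simp_all [Nat.size_eq_bits_len]
  · simp only [Store.aux_set, Store.aux_setReg, ha.symm, if_true, if_false]
    have e1 : (s.aux a).length * (L * 6 + 9 + 2) ≤ L * (L * 6 + 11) :=
      Nat.mul_le_mul hL (by omega)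
    have e2 := Nat.mul_le_mul_right (j + 3) hlen
    omega

/-! ### Trials -/

namespace Store

/-- Records the sample `r`; the value `none` stands for no sample. -/
def setFound (s : Store M) (r : Option (List Bool)) : Store M :=
  (s.set .path (r.getD [])).setSucc r.isSome

@[simp] lemma mv_setFound (s : Store M) (a) : (s.setFound a).mv = s.mv := rfl
@[simp] lemma ml_setFound (s : Store M) (a) : (s.setFound a).ml = s.ml := rfl
@[simp] lemma ms_setFound (s : Store M) (a) : (s.setFound a).ms = s.ms := rfl
@[simp] lemma fl_setFound (s : Store M) (a) :
    (s.setFound a).fl = { s.fl with succ := a.isSome } := rfl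
@[simp] lemma aux_setFound (s : Store M) (a b) :
    (s.setFound a).aux b = if b = .path then a.getD [] else s.aux b := by simp [setFound]

end Store

namespace CompTree

/-- Accepts the node if it is a branching. -/
def accept {C : Type} (T : CompTree C) (a : Option (List Bool)) : Option (List Bool) :=
  if isBr T a then a else none

/-- Repeats a trial unless a previous one has succeeded. -/
def retry (G : CompTree (Option (List Bool))) :
    Option (List Bool) → CompTree (Option (List Bool))
  | none => G
  | some p => leaf (some p)

/-- A trial with a random node of the complete binary tree of height `N`. -/
def nodeTrial {C : Type} (T : CompTree C) (N : ℕ) : CompTree (Option (List Bool)) :=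
  (iter extendT N none).map (accept T)

/-- A trial with the node reached by the traversal after a random number of less than `2 ^ h`
steps. -/
def timeTrial {C : Type} (T : CompTree C) (h : ℕ) : CompTree (Option (List Bool)) :=
  (iter digitT h []).map fun y => accept T ((walk T)^[2 ^ h - 1 - bval y] (some []))

/-- A trial that counts its successes. -/
def countTrial {C : Type} (T : CompTree C) (N X : ℕ) : CompTree ℕ :=
  (iter extendT N none).map fun a => if isBr T a then X + 1 else X

end CompTree

/-- Records the current node as a sample if it is a branching, and gives it up otherwise. -/
noncomputable def finish (M : ChoiceTM 1) : MProg M :=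
  testCur M ;; ifF (fun f => f.res)
    (setF M fun f => { f with res := false, succ := true, live := false })
    (clear M .path ;; setF M fun f => { f with live := false })

/-- A trial with a random node, unless a sample has been found. -/
noncomputable def trialNode (M : ChoiceTM 1) : MProg M :=
  ifF (fun f => f.succ) (setF M id) (gen M ;; finish M)

/-- A trial with a random time of the traversal, unless a sample has been found. -/
noncomputable def trialTime (M : ChoiceTM 1) : MProg M :=
  ifF (fun f => f.succ) (setF M id) (randomize M .c3 ;; setF M (fun f => { f with live := true }) ;;
    fuel .c3 (dfsPlain M) ;; finish M)

/-- A trial with a random node that counts its successes. -/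
noncomputable def trialCount (M : ChoiceTM 1) : MProg M :=
  gen M ;; testCur M ;; ifF (fun f => f.res)
    (setF M (fun f => { f with res := false }) ;; inc M .cnt) (setF M id) ;;
    clear M .path ;; setF M fun f => { f with live := false }

section

variable {x : List Bool} {t : ℕ} {T : CompTree M.Cfg} (h : M.Runs (M.init ![x]) t T)

include h

lemma does_finish (s : Store M) (hs : s.Idle) (hx : s.aux .x = x) (hres : s.fl.res = false)
    (hlive : s.fl.live = false) (hsucc : s.fl.succ = false) (a : Option (List Bool))
    {N : ℕ} (hN : (a.getD []).length ≤ N) :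
    Does (finish M) (s.setCur a) (testTime M x.length t N + N * 3 + 8)
      (s.setFound (accept T a)) := by
  have h1 := does_testCur h s hs hx a hN
  cases hb : isBr T a
  · rw [hb] at h1
    refine Does.congr (Does.seq h1 (Does.ifF_false (by rfl) (Does.seq (does_clear _ _ hs.reg)
      (does_setF _ _)))) (Store.ext_aux rfl rfl ?_ rfl fun e => ?_) ?_
    · simp [accept, hb, hres, hlive, hsucc]
    · simp only [accept, hb, Store.aux_set, Store.aux_setCur, Store.aux_setRes, Store.aux_withFl,
        Store.aux_setFound]
      split_ifs <;> simp_all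
    · simp; omega
  · rw [hb] at h1
    refine Does.congr (Does.seq h1 (Does.ifF_true (by rfl)
      (does_setF _ _))) (Store.ext_aux rfl rfl ?_ rfl fun e => ?_) (by omega)
    · cases a with
      | none => simp [isBr] at hb
      | some p => simp [accept, hb, hres, hlive]
    · simp [accept, hb]

lemma yields_trialNode (s : Store M) (hs : s.Idle) (hx : s.aux .x = x) (hres : s.fl.res = false)
    (hlive : s.fl.live = false) {N : ℕ} (hn : s.aux .n = unary N) (r : Option (List Bool)) :
    Yields (trialNode M) (s.setFound r) (testTime M x.length t N + N * 13 + 13)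
      (retry (nodeTrial T N) r) s.setFound := by
  cases r with
  | some p =>
    exact Does.yields (Does.mono (Does.ifF_true (by rfl) (does_setF _ _)) (by omega)) rfl rfl
  | none =>
    set s' := s.setFound none with hs'
    have hI : s'.Idle := hs.of_eq rfl rfl rfl rfl rfl (by simp [hs']) (by simp [hs'])
    have h1 := yields_gen s' hI (N := N) (by simp [hs', hn]) none
    rw [Store.setCur_self (by simp [hs']) (by simp [hs', hlive])] at h1
    refine Yields.of_map (Yields.ifF_false (by rfl) (Yields.mono (Yields.seq_does
      (t' := testTime M x.length t N + N * 3 + 8) h1 fun a ha => ?_) (by omega)))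
    have hN : (a.getD []).length ≤ N := by simpa using length_of_mem_extendT ha
    refine Does.congr (does_finish h s' hI (by simp [hs', hx]) hres hlive rfl a hN)
      (Store.ext_aux rfl rfl rfl rfl fun e => ?_) le_rfl
    simp only [hs', Store.aux_setFound]
    split_ifs <;> rfl

lemma does_fuel_dfsPlain (s : Store M) (hs : s.Idle) (hx : s.aux .x = x) (hres : s.fl.res = false)
    {N : ℕ} (hT : T.height ≤ N) {c : Aux} (hc : c ≠ .t) (hcp : c ≠ .path) (hcx : c ≠ .x)
    (hcf : c ≠ .feed) :
    Does (fuel c (dfsPlain M)) (s.setCur (some []))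
      (2 ^ (s.aux c).length * (testTime M x.length t N + 2 * N + 11 +
        (6 * (s.aux c).length + 10)) + 1)
      ((s.set c (List.replicate (s.aux c).length false)).setCur
        ((walk T)^[2 ^ (s.aux c).length - 1 - bval (s.aux c)] (some []))) := by
  have hcomm : ∀ (l : List Bool) (a), (s.setCur a).set c l = (s.set c l).setCur a := by
    intro l a
    refine Store.ext_aux rfl rfl rfl rfl fun e => ?_
    simp only [Store.aux_set, Store.aux_setCur]
    split_ifs <;> simp_all
  have := yields_fuel hc (p := dfsPlain M) (g := s.setCur) (F := fun a => .leaf (walk T a))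
    (τ := testTime M x.length t N + 2 * N + 11) (fun _ a => (a.getD []).length ≤ N)
    (fun i a ha b hb => by obtain rfl := hb; exact walk_length hT ha) (s.aux c).length
    (fun a => by simp [hs.t]) (fun a => hs.reg) (fun a => hs.ovf)
    (fun i a l ha _ _ => by
      rw [hcomm]
      refine Does.yields (does_dfsPlain h (s.set c l) (hs.of_eq rfl rfl rfl rfl rfl
        (by simp [hcf.symm]) (by simp [hc.symm])) (by simp [hcx.symm, hx]) hres a ha) ?_ rfl
      rw [hcomm])
    (s.aux c) rfl (some []) (by simp) (s.setCur (some []))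
    (by
      rw [hcomm]
      congr 1
      refine Store.ext_aux rfl rfl rfl rfl fun e => ?_
      simp only [Store.aux_set]
      split_ifs <;> simp_all)
  rw [iter_leaf] at this
  exact Does.congr this (hcomm _ _) le_rfl

lemma yields_trialTime (s : Store M) (hs : s.Idle) (hx : s.aux .x = x) (hres : s.fl.res = false)
    (hlive : s.fl.live = false) {N : ℕ} (hT : T.height ≤ N) {w : ℕ}
    (hw : s.aux .c3 = List.replicate w false) (r : Option (List Bool)) :
    Yields (trialTime M) (s.setFound r)
      (w * 8 + 2 ^ w * (testTime M x.length t N + 2 * N + 11 + (6 * w + 10)) +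
        testTime M x.length t N + N * 3 + 20)
      (retry (timeTrial T w) r) s.setFound := by
  cases r with
  | some p =>
    exact Does.yields (Does.mono (Does.ifF_true (by rfl) (does_setF _ _)) (by omega)) rfl rfl
  | none =>
    set s' := s.setFound none with hs'
    have h1 := yields_randomize s' (c := .c3) (by decide) (by simp [hs', hs.t]) hs.reg
    rw [show s'.aux .c3 = List.replicate w false by simp [hs', hw], List.length_replicate] at h1
    refine Yields.of_map (Yields.ifF_false (by rfl) (Yields.mono (Yields.seq_does
      (t' := 1 + ((2 ^ w * (testTime M x.length t N + 2 * N + 11 + (6 * w + 10)) + 1) +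
        (testTime M x.length t N + N * 3 + 8))) h1 fun y hy => ?_) (by omega)))
    have hyl : y.length = w := by simpa using length_of_mem_digitT hy
    have hI : (s'.set .c3 y).Idle := hs.of_eq rfl rfl rfl rfl rfl (by simp [hs']) (by simp [hs'])
    have h2 := does_fuel_dfsPlain h (s'.set .c3 y) hI (by simp [hs', hx]) hres hT (c := .c3)
      (by decide) (by decide) (by decide) (by decide)
    rw [show (s'.set .c3 y).aux .c3 = y by simp, hyl] at h2
    have h3 := does_finish h ((s'.set .c3 y).set .c3 (List.replicate w false))
      (hs.of_eq rfl rfl rfl rfl rfl (by simp [hs']) (by simp [hs'])) (by simp [hs', hx]) hres hlive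
      rfl ((walk T)^[2 ^ w - 1 - bval y] (some [])) (walk_iterate_length hT _)
    refine Does.congr (Does.seq (does_setF _ _) (Does.seq (Does.start h2 ?_) h3))
      (Store.ext_aux rfl rfl rfl rfl fun e => ?_) le_rfl
    · refine Store.ext_aux rfl rfl rfl rfl fun e => ?_
      simp only [hs', Store.aux_set, Store.aux_withFl, Store.aux_setCur, Store.aux_setFound]
      split_ifs <;> simp_all
    · simp only [hs', Store.aux_set, Store.aux_setFound]
      split_ifs <;> simp_all

lemma yields_trialCount (s : Store M) (hs : s.Idle) (hx : s.aux .x = x) (hres : s.fl.res = false)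
    (hlive : s.fl.live = false) (hpath : s.aux .path = []) {N : ℕ} (hn : s.aux .n = unary N)
    (X : ℕ) {L : ℕ} (hX : X < 2 ^ L) :
    Yields (trialCount M) (s.set .cnt X.bits) (testTime M x.length t N + N * 13 + L * 6 + 21)
      (countTrial T N X) fun X => s.set .cnt X.bits := by
  set s' := s.set .cnt X.bits with hs'
  have hI : s'.Idle := hs.of_eq rfl rfl rfl rfl rfl (by simp [hs']) (by simp [hs'])
  have hlen := length_bits_le hX
  have h1 := yields_gen s' hI (N := N) (by simp [hs', hn]) none
  rw [Store.setCur_self (by simp [hs', hpath]) (by simp [hs', hlive])] at h1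
  refine Yields.of_map (Yields.mono (Yields.seq_does
      (t' := testTime M x.length t N + N * 3 + L * 6 + 17) h1 fun a ha => ?_) (by omega))
  have hN : (a.getD []).length ≤ N := by simpa using length_of_mem_extendT ha
  have h2 := does_testCur h s' hI (by simp [hs', hx]) a hN
  cases hb : isBr T a
  · rw [hb] at h2
    refine Does.congr (Does.seq h2 (Does.seq (Does.ifF_false (by rfl) (does_setF _ _))
      (Does.seq (does_clear _ _ hs.reg) (does_setF _ _))))
      (Store.ext_aux rfl rfl ?_ rfl fun e => ?_) ?_
    · simp [hs', Flags.ext_iff, hres, hlive]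
    · simp only [hs', Store.aux_set, Store.aux_withFl, Store.aux_setCur, Store.aux_setRes]
      split_ifs <;> simp_all
    · simp; omega
  · rw [hb] at h2
    refine Does.congr (Does.seq h2 (Does.seq (Does.ifF_true (by rfl) (Does.seq (does_setF _ _)
      (does_inc _ (by decide) (by simp [hs', hs.t]) hs.reg)))
      (Does.seq (does_clear _ _ hs.reg) (does_setF _ _))))
      (Store.ext_aux rfl rfl ?_ rfl fun e => ?_) ?_
    · simp [hs', Flags.ext_iff, hres, hlive]
    · simp only [hs', Store.aux_set, Store.aux_withFl, Store.aux_setCur, Store.aux_setRes]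
      split_ifs <;> simp_all [incGrow_bits]
    · simp [hs']; omega

end

/-! ### Machines for programs -/

/-- The initial contents of the store. -/
def initStore (M : ChoiceTM 1) (w : Aux → List Bool) : Store M where
  mv := M.init₀
  ml := none
  fl := ⟨none, false, false, false, false⟩
  ms := fun _ => []
  aux := w

lemma idle_initStore {w : Aux → List Bool} (hf : w .feed = []) (ht : w .t = []) :
    (initStore M w).Idle := ⟨rfl, rfl, rfl, rfl, rfl, hf, ht⟩

/-- The machine that executes a program, with the given input and output stacks. -/
noncomputable def progMachine (p : MProg M) {a : ℕ} (inp : Fin a ↪ Aux) (o : Aux) :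
    ChoiceTM a :=
  letI : Finite p.Lab := p.finite_lab
  { K := M.K ⊕ Aux
    inp := inp.trans Function.Embedding.inr
    out := .inr o
    Γ := M.Γ
    bit := M.bit
    Λ := p.Lab ⊕ Unit
    finΛ := Fintype.ofFinite _
    main := .inl p.entry
    σ := Memo M
    init₀ := (M.init₀, none, ⟨none, false, false, false, false⟩)
    code := fun l => match l with
      | .inl b => p.code Sum.inl (.inr ()) b
      | .inr _ => .inl .halt }

/-- A run of the machine is an execution of the program, followed by one halting step. -/
lemma progMachine_runs {p : MProg M} {a : ℕ} (inp : Fin a ↪ Aux) (o : Aux)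
    (w : Fin a → List Bool) (v : Aux → List Bool) (hv : v = Function.extend inp w fun _ => [])
    {ι : Type} {t : ℕ} {T : CompTree ι} {g : ι → Store M}
    (h : Yields p (initStore M v) t T g) :
    (progMachine p inp o).RunsIn ((progMachine p inp o).init w) (t + 1)
      (T.map fun i => ⟨none, (g i).cfg.1, (g i).cfg.2⟩) := by
  have h1 := ChoiceTM.runsIn_of_exec (progMachine p inp o) h Sum.inl (.inr ()) (fun b => rfl) 1
    (fun c => .leaf ⟨none, c.1, c.2⟩) (fun c _ =>
      ChoiceTM.RunsIn.mono (ChoiceTM.RunsIn.step (t := 0) (q := .halt) rfl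
        ⟨0, le_rfl, .halt _ _⟩) le_rfl)
  have h2 : (progMachine p inp o).RunsIn ⟨some (.inl p.entry), (initStore M v).cfg.1,
      (initStore M v).cfg.2⟩ (t + 1) (T.map fun i => ⟨none, (g i).cfg.1, (g i).cfg.2⟩) := by
    have := h1
    erw [bind_map] at this
    exact this
  convert h2 using 1
  simp only [ChoiceTM.init]
  congr 1
  funext e
  rcases e with e | b
  · refine (Function.extend_apply' _ _ _ ?_).trans rfl
    rintro ⟨i, hi⟩
    cases hi
  · subst hv
    by_cases hk : ∃ i, inp i = b
    · obtain ⟨i, rfl⟩ := hk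
      rw [show (Sum.inr (inp i) : M.K ⊕ Aux) = (progMachine p inp o).inp i from rfl,
        (progMachine p inp o).inp.injective.extend_apply]
      change _ = List.map M.bit (Function.extend inp w (fun _ => []) (inp i))
      rw [inp.injective.extend_apply]
      rfl
    · refine (Function.extend_apply' _ _ _ ?_).trans ?_
      · rintro ⟨i, hi⟩
        exact hk ⟨i, Sum.inr.inj hi⟩
      · change [] = List.map M.bit (Function.extend inp w (fun _ => []) b)
        rw [Function.extend_apply' _ _ _ hk]
        rfl

lemma progMachine_outputs {p : MProg M} {a : ℕ} (inp : Fin a ↪ Aux) (o : Aux) (s : Store M)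
    (w : List Bool) :
    (progMachine p inp o).Outputs w ⟨none, s.cfg.1, s.cfg.2⟩ ↔ s.aux o = w := by
  change List.map M.bit (s.aux o) = List.map M.bit w ↔ _
  exact (List.map_injective_iff.2 M.bit.injective).eq_iff

/-! ### The approximation scheme -/

/-- Makes `2 ^ w` steps of the traversal, where `w` is the width of the counter `c`: a counter that
starts at zero overflows after `2 ^ w - 1` steps. -/
noncomputable def traverse (M : ChoiceTM 1) (c : Aux) : MProg M :=
  fuel c (dfsCount M) ;; dfsCount M

/-- Makes `2 ^ w` trials with random nodes, where `w` is the width of the counter `c1`. -/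
noncomputable def estimate (M : ChoiceTM 1) : MProg M :=
  fuel .c1 (trialCount M) ;; trialCount M

section

variable {x : List Bool} {t : ℕ} {T : CompTree M.Cfg} (h : M.Runs (M.init ![x]) t T)

include h

lemma does_traverse (s : Store M) (hs : s.Idle) (hx : s.aux .x = x) (hres : s.fl.res = false)
    {N : ℕ} (hT : T.height ≤ N) {c : Aux} (hc : c ≠ .t) (hcp : c ≠ .path) (hcx : c ≠ .x)
    (hcf : c ≠ .feed) (hcc : c ≠ .cnt) {w : ℕ} (hw : s.aux c = List.replicate w false) :
    Does (traverse M c) ((s.set .cnt []).setCur (some []))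
      ((2 ^ w + 1) * (testTime M x.length t N + 12 * w + 2 * N + 30))
      ((s.set .cnt ((walkCount T)^[2 ^ w] (some [], 0)).2.bits).setCur
        ((walkCount T)^[2 ^ w] (some [], 0)).1) := by
  set g : Option (List Bool) × ℕ → Store M := fun a => (s.set .cnt a.2.bits).setCur a.1 with hg
  have hcomm : ∀ (l : List Bool) (a : Option (List Bool) × ℕ),
      (g a).set c l = ((s.set c l).set .cnt a.2.bits).setCur a.1 := by
    intro l a
    refine Store.ext_aux rfl rfl rfl rfl fun e => ?_
    simp only [hg, Store.aux_set, Store.aux_setCur]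
    split_ifs <;> simp_all
  have hself : ∀ a, (g a).set c (List.replicate w false) = g a := by
    intro a
    refine Store.ext_aux rfl rfl rfl rfl fun e => ?_
    simp only [hg, Store.aux_set, Store.aux_setCur]
    split_ifs <;> simp_all
  have h1 := yields_fuel hc (p := dfsCount M) (g := g) (F := fun a => .leaf (walkCount T a))
    (τ := testTime M x.length t N + (w * 6 + 8) + 2 * N + 10)
    (fun i a => (a.1.getD []).length ≤ N ∧ a.2 ≤ i)
    (fun i a ha b hb => by
      obtain rfl := hb
      refine ⟨walk_length hT ha.1, ?_⟩
      have := ha.2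
      simp only [walkCount]
      split_ifs <;> omega) w
    (fun a => by simp [hg, hs.t]) (fun a => hs.reg) (fun a => hs.ovf)
    (fun i a l ha hi _ => by
      rw [hcomm]
      refine Does.yields (does_dfsCount h (s.set c l) (hs.of_eq rfl rfl rfl rfl rfl
        (by simp [hcf.symm]) (by simp [hc.symm])) (by simp [hcx.symm, hx]) hres a ha.1
        (ha.2.trans_lt hi)) ?_ rfl
      rw [hcomm])
    (List.replicate w false) (by simp) (some [], 0) (by simp) (g (some [], 0)) (hself _).symm
  rw [iter_leaf, bval_replicate_false] at h1
  have h1' : Does (fuel c (dfsCount M)) (g (some [], 0)) _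
    (g ((walkCount T)^[2 ^ w - 1 - 0] (some [], 0))) := Does.congr h1 (hself _) le_rfl
  have hpow := Nat.one_le_two_pow (n := w)
  have i1 : (((walkCount T)^[2 ^ w - 1 - 0] (some [], 0)).1.getD []).length ≤ N := by
    rw [walkCount_iterate]
    exact walk_iterate_length hT _
  have i2 := walkCount_iterate_le T (2 ^ w - 1 - 0)
  have h2 := does_dfsCount h s hs hx hres ((walkCount T)^[2 ^ w - 1 - 0] (some [], 0)) i1
    (L := w) (by omega)
  have hsucc : walkCount T ((walkCount T)^[2 ^ w - 1 - 0] (some [], 0)) =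
      (walkCount T)^[2 ^ w] (some [], 0) := by
    rw [← Function.iterate_succ_apply' (walkCount T)]
    congr 1
    omega
  rw [hsucc] at h2
  refine Does.congr (Does.seq (Does.start h1' ?_) h2) rfl ?_
  · simp [hg]
  · have : (2 ^ w + 1) * (testTime M x.length t N + 12 * w + 2 * N + 30) =
      2 ^ w * (testTime M x.length t N + (w * 6 + 8) + 2 * N + 10 + (6 * w + 10)) + 2 ^ w * 2 +
      (testTime M x.length t N + 12 * w + 2 * N + 30) := by ring
    omega

lemma yields_estimate (s : Store M) (hs : s.Idle) (hx : s.aux .x = x) (hres : s.fl.res = false)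
    (hlive : s.fl.live = false) (hpath : s.aux .path = []) {N : ℕ} (hn : s.aux .n = unary N)
    {w : ℕ} (hw : s.aux .c1 = List.replicate w false) :
    Yields (estimate M) (s.set .cnt [])
      ((2 ^ w + 1) * (testTime M x.length t N + 12 * w + 13 * N + 40))
      (iter (countTrial T N) (2 ^ w) 0) fun X => s.set .cnt X.bits := by
  have hcomm : ∀ (l : List Bool) (X : ℕ),
      (s.set .cnt X.bits).set .c1 l = (s.set .c1 l).set .cnt X.bits := by
    intro l X
    refine Store.ext_aux rfl rfl rfl rfl fun e => ?_
    simp only [Store.aux_set]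
    split_ifs <;> simp_all
  have hself : ∀ X : ℕ, (s.set .cnt X.bits).set .c1 (List.replicate w false) =
      s.set .cnt X.bits := by
    intro X
    refine Store.ext_aux rfl rfl rfl rfl fun e => ?_
    simp only [Store.aux_set]
    split_ifs <;> simp_all
  have hmem : ∀ X Y : ℕ, (countTrial T N X).Mem Y → Y ≤ X + 1 := by
    intro X Y hY
    obtain ⟨a, -, rfl⟩ := mem_map.1 hY
    split_ifs <;> omega
  have hmem' : ∀ i X Y : ℕ, (iter (countTrial T N) i X).Mem Y → Y ≤ X + i := by
    intro i
    induction i with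
    | zero => rintro X Y rfl; exact le_rfl
    | succ i ih =>
      intro X Y hY
      obtain ⟨Z, hZ, hY⟩ := mem_bind.1 hY
      have h1 := hmem _ _ hZ
      have h2 := ih _ _ hY
      omega
  have h1 := yields_fuel (c := .c1) (by decide) (p := trialCount M)
    (g := fun X : ℕ => s.set .cnt X.bits) (F := countTrial T N)
    (τ := testTime M x.length t N + N * 13 + w * 6 + 21)
    (fun i X => X ≤ i) (fun i X hX Y hY => (hmem _ _ hY).trans (by omega)) w
    (fun X => by simp [hs.t]) (fun X => hs.reg) (fun X => hs.ovf)
    (fun i X l hX hi _ => by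
      simp only [hcomm]
      exact yields_trialCount h (s.set .c1 l) (hs.of_eq rfl rfl rfl rfl rfl
        (by simp) (by simp)) (by simp [hx]) hres hlive (by simp [hpath]) (by simp [hn]) X
        (hX.trans_lt hi))
    (List.replicate w false) (by simp) 0 (by simp [bval_replicate_false]) _ (hself 0).symm
  simp only [hself, bval_replicate_false] at h1
  have hpow := Nat.one_le_two_pow (n := w)
  have h2 := Yields.seq h1 (q := trialCount M) (F := countTrial T N) fun X hX =>
    yields_trialCount h s hs hx hres hlive hpath hn X (L := w) (by have := hmem' _ _ _ hX; omega)
  have h3 : (iter (countTrial T N) (2 ^ w - 1 - 0) 0).bind (countTrial T N) =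
      iter (countTrial T N) (2 ^ w) 0 := by
    have : 2 ^ w = (2 ^ w - 1 - 0) + 1 := by omega
    rw [this, iter_add, ← this]
    exact bind_congr _ fun X _ => (bind_pure _).symm
  rw [h3] at h2
  refine Yields.mono h2 ?_
  have : (2 ^ w + 1) * (testTime M x.length t N + 12 * w + 13 * N + 40) =
      2 ^ w * (testTime M x.length t N + N * 13 + w * 6 + 21 + (6 * w + 10)) + 2 ^ w * 9 +
      (testTime M x.length t N + 12 * w + 13 * N + 40) := by ring
  omega

end

/-- The width of the counter that limits the traversal in the approximation scheme. It is chosen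
such that a tree too large to be traversed in `2 ^ countWidth N K D` steps has at least
`32 * (K + 1) ^ 2 * (D + 1) * 2 ^ ⌈N / 2⌉` branchings. -/
def countWidth (N K D : ℕ) : ℕ := (N + 1) / 2 + 2 * (K + 1).size + D.size + 6

/-- Prepares the counters. -/
noncomputable def countSetup (M : ChoiceTM 1) : MProg M :=
  half M ;; bpush M .k (fun _ => true) ;; addLog M .k .c2 2 ;; addLog M .d .c2 1 ;; bpushN M .c2 6

/-- The approximation scheme: it tries to count the branchings by traversing the tree, and if the
tree is too large, it estimates their number by random trials. -/
noncomputable def countProg (M : ChoiceTM 1) : MProg M :=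
  countSetup M ;; setF M (fun f => { f with live := true }) ;; traverse M .c2 ;;
  ifF (fun f => f.live)
    (setF M (fun f => { f with live := false }) ;; clear M .path ;; clear M .cnt ;; estimate M ;;
      drain M .sh .cnt 1)
    (setF M id)

/-- The initial contents of the stacks in the approximation scheme. -/
def countInput (x : List Bool) (N K D : ℕ) : Aux → List Bool
  | .x => x
  | .n => unary N
  | .k => unary K
  | .d => unary D
  | _ => []

/-- The store after the counters have been prepared. -/
def countStore (M : ChoiceTM 1) (x : List Bool) (N K D : ℕ) : Store M :=
  initStore M fun a => match a with
    | .x => x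
    | .n => unary N
    | .c1 => List.replicate ((N + 1) / 2) false
    | .c2 => List.replicate (countWidth N K D) false
    | .sh => List.replicate (N / 2) false
    | _ => []

lemma does_countSetup (x : List Bool) (N K D : ℕ) {L : ℕ} (hK : K + 1 ≤ L) (hD : D ≤ L) :
    Does (countSetup M) (initStore M (countInput x N K D)) (N * 10 + L * L * 12 + L * 31 + 21)
      (countStore M x N K D) := by
  have h0 : (initStore M (countInput x N K D)).Idle := idle_initStore rfl rfl
  have h1 := does_half _ h0 (N := N) rfl rfl rfl rfl rfl
  set s₁ := (((initStore M (countInput x N K D)).set .c1 (List.replicate ((N + 1) / 2) false)).set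
    .c2 (List.replicate ((N + 1) / 2) false)).set .sh (List.replicate (N / 2) false) with hs₁
  have h2 := does_bpush s₁ .k fun _ => true
  have hk : (s₁.set .k (true :: s₁.aux .k)).aux .k = unary (K + 1) := rfl
  have h3 := does_addLog (s₁.set .k (true :: s₁.aux .k)) ⟨rfl, rfl, rfl, rfl, rfl, rfl, rfl⟩
    (a := .k) (b := .c2) (by decide) (by decide) (by decide) (by decide) 2 rfl (L := L)
    (by rw [hk]; simpa [unary] using hK)
  rw [hk] at h3
  have h4 := does_addLog (((s₁.set .k (true :: s₁.aux .k)).set .k []).set .c2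
    (List.replicate (2 * (unary (K + 1)).length.size) false ++
      (s₁.set .k (true :: s₁.aux .k)).aux .c2)) ⟨rfl, rfl, rfl, rfl, rfl, rfl, rfl⟩
    (a := .d) (b := .c2) (by decide) (by decide) (by decide) (by decide) 1 rfl (L := L)
    (by simpa [hs₁, initStore, countInput, unary] using hD)
  refine Does.congr (Does.seq h1 (Does.seq h2 (Does.seq h3 (Does.seq h4 (does_bpushN _ _ _)))))
    (Store.ext_aux rfl rfl rfl rfl fun e => ?_) ?_
  · cases e <;> simp [hs₁, countStore, initStore, countInput, unary, countWidth]
    rw [show (N + 1) / 2 + 2 * (K + 1).size + D.size + 6 =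
      D.size + (2 * (K + 1).size + (N + 1) / 2) + 6 by omega]
    rfl
  · exact le_of_eq (by ring)

/-- The outcome of the approximation scheme. The zeros prepended to the number of successes multiply
it by `2 ^ ⌊N / 2⌋`. -/
lemma yields_countProg {x : List Bool} {t : ℕ} {T : CompTree M.Cfg}
    (h : M.Runs (M.init ![x]) t T) {N : ℕ} (hT : T.height ≤ N) (K D : ℕ) :
    ∃ g : List Bool → Store M, (∀ l, (g l).aux .cnt = l) ∧
      Yields (countProg M) (initStore M (countInput x N K D))
        ((N * 10 + (K + D + 1) * (K + D + 1) * 12 + (K + D + 1) * 31 + 21) + 1 +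
          (2 ^ countWidth N K D + 1) *
            (testTime M x.length t N + 12 * countWidth N K D + 2 * N + 30) +
          ((2 ^ ((N + 1) / 2) + 1) * (testTime M x.length t N + 12 * ((N + 1) / 2) + 13 * N + 40) +
            7 * N + 3 * countWidth N K D + 20))
        (if 2 * T.numBr + 1 ≤ 2 ^ countWidth N K D then .leaf T.numBr.bits
          else (iter (countTrial T N) (2 ^ ((N + 1) / 2)) 0).map fun X =>
            List.replicate (N / 2) false ++ X.bits) g := by
  set W := countWidth N K D with hW
  set s := countStore M x N K D with hs
  have hI : s.Idle := ⟨rfl, rfl, rfl, rfl, rfl, rfl, rfl⟩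
  have h1 := does_countSetup (M := M) x N K D (L := K + D + 1) (by omega) (by omega)
  have h2 := does_setF s fun f => { f with live := true }
  have h3 := does_traverse h s hI rfl rfl hT (c := .c2) (by decide) (by decide) (by decide)
    (by decide) (by decide) (w := W) rfl
  have h2' := Does.congr h2 (s₂ := (s.set .cnt []).setCur (some [])) (Store.ext_aux rfl rfl rfl rfl
    fun e => by cases e <;> simp [hs, countStore, initStore]) le_rfl
  set r := (walkCount T)^[2 ^ W] (some [], 0) with hr
  have hr1 : r.1 = (walk T)^[2 ^ W] (some []) := by rw [hr, walkCount_iterate]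
  have hrl : (r.1.getD []).length ≤ N := by
    rw [hr1]
    exact walk_iterate_length hT _
  have hrc : r.2 ≤ 2 ^ W := walkCount_iterate_le T _
  have hrb : r.2.bits.length ≤ W + 1 :=
    length_bits_le (hrc.trans_lt (Nat.pow_lt_pow_right (by norm_num) (by omega)))
  split_ifs with hfin
  · refine ⟨fun l => s.set .cnt l, fun l => by simp, ?_⟩
    rw [walkCount_finished T hfin] at hr
    rw [hr] at h3
    refine Does.yields (Does.congr (Does.seq h1 (Does.seq h2' (Does.seq h3
      (Does.ifF_false (by rfl) (does_setF _ _))))) (s₂ := s.set .cnt T.numBr.bits) ?_ ?_) rfl rfl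
    · exact Store.ext_aux rfl rfl rfl rfl fun e => by
        cases e <;> simp [hs, countStore, initStore]
    · omega
  · have hlive : r.1.isSome = true := by
      rw [hr1, isSome_walk_iff]; omega
    refine ⟨fun l => (s.set .sh []).set .cnt l, fun l => by simp, ?_⟩
    have h4 := does_setF ((s.set .cnt r.2.bits).setCur r.1) fun f => { f with live := false }
    have h4' := Does.congr h4 (s₂ := (s.set .cnt r.2.bits).set .path (r.1.getD []))
      (Store.ext_aux rfl rfl rfl rfl fun e => by simp) le_rfl
    have h5 := does_clear ((s.set .cnt r.2.bits).set .path (r.1.getD [])) .path rfl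
    have h5' := Does.congr h5 (s₂ := s.set .cnt r.2.bits) (t' := N * 3 + 2)
      (Store.ext_aux rfl rfl rfl rfl fun e => by
        cases e <;> simp [hs, countStore, initStore]) (by simp; omega)
    have h6 := does_clear (s.set .cnt r.2.bits) .cnt rfl
    have h6' := Does.congr h6 (s₂ := s.set .cnt []) (t' := W * 3 + 5)
      (Store.ext_aux rfl rfl rfl rfl fun e => by
        cases e <;> simp [hs, countStore, initStore]) (by simp; omega)
    have h7 := yields_estimate h s hI rfl rfl rfl rfl (N := N) rfl (w := (N + 1) / 2) rfl
    have h8 : ∀ X : ℕ, Does (drain M .sh .cnt 1) (s.set .cnt X.bits) (N * 4 + 2)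
        ((s.set .sh []).set .cnt (List.replicate (N / 2) false ++ X.bits)) := by
      intro X
      refine Does.congr (does_drain _ (by decide) 1 rfl) (Store.ext_aux rfl rfl rfl rfl fun e => ?_)
        ?_
      · cases e <;> simp [hs, countStore, initStore]
      · simp [hs, countStore, initStore]; omega
    refine Yields.of_map (g := fun l => (s.set .sh []).set .cnt l) (Yields.mono
      (Does.seq_yields h1 (Does.seq_yields h2' (Does.seq_yields h3 (Yields.ifF_true hlive
        (Does.seq_yields h4' (Does.seq_yields h5' (Does.seq_yields h6'
          (Yields.seq_does h7 fun X _ => h8 X)))))))) ?_)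
    omega

/-! ### The sampler -/

/-- A loop of `2 ^ w - 1` trials that may find a sample. -/
lemma yields_search {p : MProg M} {R : Option (List Bool) → CompTree (Option (List Bool))} {τ : ℕ}
    (s : Store M) (hs : s.Idle) {w : ℕ} (hw : s.aux .c2 = List.replicate w false)
    (hp : ∀ l r, Yields p ((s.set .c2 l).setFound r) τ (R r) (s.set .c2 l).setFound) :
    Yields (fuel .c2 p) (s.setFound none) (2 ^ w * (τ + (6 * w + 10)) + 1)
      (iter R (2 ^ w - 1) none) s.setFound := by
  have hcomm : ∀ (l : List Bool) (r), (s.setFound r).set .c2 l = (s.set .c2 l).setFound r := by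
    intro l r
    refine Store.ext_aux rfl rfl rfl rfl fun e => ?_
    simp only [Store.aux_set, Store.aux_setFound]
    split_ifs <;> simp_all
  have hself : ∀ r, (s.setFound r).set .c2 (List.replicate w false) = s.setFound r := by
    intro r
    refine Store.ext_aux rfl rfl rfl rfl fun e => ?_
    simp only [Store.aux_set, Store.aux_setFound]
    split_ifs <;> simp_all
  have h1 := yields_fuel (c := .c2) (by decide) (p := p) (g := s.setFound) (F := R) (τ := τ)
    (fun _ _ => True) (fun _ _ _ _ _ => trivial) w (fun a => by simp [hs.t]) (fun _ => hs.reg)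
    (fun _ => hs.ovf) (fun i a l _ _ _ => by simp only [hcomm]; exact hp l a)
    (List.replicate w false) (by simp) none trivial _ (hself none).symm
  simp only [hself, bval_replicate_false, Nat.sub_zero] at h1
  exact h1

/-- The sampler: it tries to count the branchings by traversing the tree. If that succeeds, it
samples random times of the traversal, and random nodes of the complete binary tree otherwise,
until it finds a branching or runs out of trials. -/
noncomputable def sampleProg (M : ChoiceTM 1) : MProg M :=
  half M ;; setF M (fun f => { f with live := true }) ;; traverse M .c1 ;;
  ifF (fun f => f.live)
    (setF M (fun f => { f with live := false }) ;; clear M .path ;; clear M .cnt ;;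
      addLog M .d .c2 1 ;; bpushN M .c2 3 ;; fuel .c2 (trialNode M))
    (drain M .cnt .c3 1 ;; bpushN M .c3 1 ;; clear M .c2 ;; addLog M .d .c2 1 ;; bpushN M .c2 3 ;;
      fuel .c2 (trialTime M)) ;;
  ifF (fun f => f.succ) (move M .path .out ;; bpush M .out (fun _ => true)) (setF M id)

/-- The initial contents of the stacks in the sampler. -/
def sampleInput (x : List Bool) (N D : ℕ) : Aux → List Bool
  | .x => x
  | .n => unary N
  | .d => unary D
  | _ => []

/-- The store of the sampler during the trials: `d`, `c2` and `c3` are the contents of the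
stacks with these names. -/
def sampleStore (M : ChoiceTM 1) (x : List Bool) (N : ℕ) (d c2 c3 : List Bool) : Store M :=
  initStore M fun a => match a with
    | .x => x
    | .n => unary N
    | .d => d
    | .c1 => List.replicate ((N + 1) / 2) false
    | .c2 => c2
    | .c3 => c3
    | .sh => List.replicate (N / 2) false
    | _ => []

lemma idle_sampleStore (x : List Bool) (N : ℕ) (d c2 c3 : List Bool) :
    (sampleStore M x N d c2 c3).Idle := ⟨rfl, rfl, rfl, rfl, rfl, rfl, rfl⟩

/-- The number of trials of the sampler is `2 ^ w - 1`, where `w` is the width of the counter. -/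
def sampleWidth (f N D : ℕ) : ℕ :=
  D.size + 3 + if 2 * f + 1 ≤ 2 ^ ((N + 1) / 2) then 0 else (N + 1) / 2

/-- The trials of the sampler. -/
def sampleTrial {C : Type} (T : CompTree C) (N : ℕ) : CompTree (Option (List Bool)) :=
  if 2 * T.numBr + 1 ≤ 2 ^ ((N + 1) / 2) then timeTrial T (T.numBr.size + 1) else nodeTrial T N

/-- The end of the sampler. Moving the address to the output stack reverses it, so that the first
choice comes first. -/
lemma does_output (s : Store M) (hr : s.fl.reg = none) (ho : s.aux .out = [])
    (r : Option (List Bool)) :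
    ∃ s' : Store M, s'.aux .out = sampleCode (r.map List.reverse) ∧
      Does (ifF (fun f => f.succ) (move M .path .out ;; bpush M .out (fun _ => true)) (setF M id))
        (s.setFound r) ((r.getD []).length * 3 + 4) s' := by
  cases r with
  | none => exact ⟨_, by simp [sampleCode, ho], Does.mono (Does.ifF_false (by rfl) (does_setF _ _))
      (by omega)⟩
  | some p =>
    refine ⟨_, ?_, Does.mono (Does.ifF_true (by rfl) (Does.seq
      (does_move _ (by decide) (by simp [hr])) (does_bpush _ _ _))) ?_⟩
    · simp [sampleCode, ho]
    · simp

namespace CompTree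

lemma mem_retry_iter {G : CompTree (Option (List Bool))} {P : List Bool → Prop}
    (hG : ∀ p, G.Mem (some p) → P p) : ∀ {n : ℕ} {r : Option (List Bool)},
    (iter (retry G) n none).Mem r → ∀ p, r = some p → P p := by
  have : ∀ (n : ℕ) (r₀ r : Option (List Bool)), (∀ p, r₀ = some p → P p) →
      (iter (retry G) n r₀).Mem r → ∀ p, r = some p → P p := by
    intro n
    induction n with
    | zero => rintro r₀ r h0 rfl; exact h0
    | succ n ih =>
      intro r₀ r h0 hr
      obtain ⟨r₁, h1, hr⟩ := mem_bind.1 hr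
      refine ih r₁ r ?_ hr
      rintro p rfl
      cases r₀ with
      | none => exact hG p h1
      | some p₀ => exact h0 p h1.symm
  exact fun {n r} => this n none r (by simp)

lemma isBranching_of_accept {C : Type} {T : CompTree C} {a : Option (List Bool)} {p : List Bool}
    (h : some p = accept T a) : T.IsBranching p.reverse := by
  unfold accept at h
  split_ifs at h with hb
  subst h
  simpa [isBr] using hb

lemma isBranching_of_mem_sampleTrial {C : Type} {T : CompTree C} {N : ℕ} {p : List Bool}
    (h : (sampleTrial T N).Mem (some p)) : T.IsBranching p.reverse := by
  unfold sampleTrial at h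
  split_ifs at h
  · obtain ⟨a, -, ha⟩ := mem_map.1 h
    exact isBranching_of_accept ha
  · obtain ⟨a, -, ha⟩ := mem_map.1 h
    exact isBranching_of_accept ha

end CompTree

/-- The outcome of the sampler, as a repetition of independent trials. -/
lemma yields_sampleProg {x : List Bool} {t : ℕ} {T : CompTree M.Cfg}
    (h : M.Runs (M.init ![x]) t T) {N : ℕ} (hT : T.height ≤ N) (D : ℕ) :
    ∃ g : Option (List Bool) → Store M, (∀ r, (g r).aux .out = sampleCode (r.map List.reverse)) ∧
      Yields (sampleProg M) (initStore M (sampleInput x N D))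
        (2 ^ (D.size + 3) * 2 ^ ((N + 1) / 2) * (3 * testTime M x.length t N + 20 * N +
            20 * ((N + 1) / 2) + 6 * D.size + 200) +
          (2 ^ ((N + 1) / 2) + 1) * (testTime M x.length t N + 12 * ((N + 1) / 2) + 2 * N + 30) +
          (D * (D * 6 + 11) + D * 4 + 20 * N + 10 * ((N + 1) / 2) + 60))
        (iter (retry (sampleTrial T N)) (2 ^ sampleWidth T.numBr N D - 1) none) g := by
  set m := (N + 1) / 2 with hm
  set τ := testTime M x.length t N with hτ
  set s₀ := sampleStore M x N (unary D) (List.replicate m false) [] with hs₀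
  have hI₀ : s₀.Idle := idle_sampleStore _ _ _ _ _
  have h1 := does_half (initStore M (sampleInput x N D)) (idle_initStore rfl rfl) (N := N)
    rfl rfl rfl rfl rfl
  have h1' := Does.congr h1 (s₂ := s₀) (Store.ext_aux rfl rfl rfl rfl fun e => by
    cases e <;> simp [hs₀, sampleStore, initStore, sampleInput, hm]) le_rfl
  have h2 := does_setF s₀ fun f => { f with live := true }
  have h2' := Does.congr h2 (s₂ := (s₀.set .cnt []).setCur (some [])) (Store.ext_aux rfl rfl rfl rfl
    fun e => by cases e <;> simp [hs₀, sampleStore, initStore]) le_rfl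
  have h3 := does_traverse h s₀ hI₀ rfl rfl hT (c := .c1) (by decide) (by decide) (by decide)
    (by decide) (by decide) (w := m) rfl
  set r := (walkCount T)^[2 ^ m] (some [], 0) with hr
  have hr1 : r.1 = (walk T)^[2 ^ m] (some []) := by rw [hr, walkCount_iterate]
  have hrl : (r.1.getD []).length ≤ N := by
    rw [hr1]
    exact walk_iterate_length hT _
  have hrc : r.2 ≤ 2 ^ m := walkCount_iterate_le T _
  have hrb : r.2.bits.length ≤ m + 1 :=
    length_bits_le (hrc.trans_lt (Nat.pow_lt_pow_right (by norm_num) (by omega)))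
  have hmem : ∀ n r, (iter (retry (sampleTrial T N)) n none).Mem r → (r.getD []).length ≤ N := by
    intro n r hr
    have := mem_retry_iter (P := fun p => p.length ≤ N) (G := sampleTrial T N) (fun p hp => by
      simpa using (length_lt_height (isBranching_of_mem_sampleTrial hp)).le.trans hT) hr
    cases r with
    | none => simp
    | some p => exact this p rfl
  have hpow := Nat.one_le_two_pow (n := m)
  by_cases hfin : 2 * T.numBr + 1 ≤ 2 ^ m
  · have hG : sampleTrial T N = timeTrial T (T.numBr.size + 1) := if_pos hfin
    have hw : sampleWidth T.numBr N D = D.size + 3 := by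
      rw [sampleWidth, if_pos hfin, Nat.add_zero]
    set H := T.numBr.size + 1 with hH
    have hHm : H ≤ m + 1 := Nat.succ_le_succ (Nat.size_le.2 (by omega))
    have hHpow : 2 ^ H ≤ 2 * 2 ^ m := by
      rw [← pow_succ']; exact Nat.pow_le_pow_right (by norm_num) hHm
    set s := sampleStore M x N [] (List.replicate (D.size + 3) false) (List.replicate H false)
      with hs
    have hI : s.Idle := idle_sampleStore _ _ _ _ _
    choose g hg hgd using does_output s hI.reg rfl
    refine ⟨g, hg, ?_⟩
    rw [walkCount_finished T hfin] at hr
    rw [hr] at h3 hrb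
    set s₁ := s₀.set .cnt T.numBr.bits with hs₁
    have h3' := Does.congr h3 (s₂ := s₁) (Store.ext_aux rfl rfl rfl rfl fun e => by
      cases e <;> simp [hs₁, hs₀, sampleStore, initStore]) le_rfl
    have h4 := Does.congr (does_drain s₁ (a := .cnt) (b := .c3) (by decide) 1 rfl)
      (s₂ := sampleStore M x N (unary D) (List.replicate m false)
        (List.replicate T.numBr.size false)) (t' := (m + 1) * 4 + 2)
      (Store.ext_aux rfl rfl rfl rfl fun e => by
        cases e <;> simp [hs₁, hs₀, sampleStore, initStore, Nat.size_eq_bits_len])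
      (by
        have : T.numBr.bits.length ≤ m + 1 := hrb
        simp only [hs₁, Store.aux_set, if_true]; omega)
    have h5 := Does.congr (does_bpushN .c3 1 (sampleStore M x N (unary D) (List.replicate m false)
        (List.replicate T.numBr.size false)))
      (s₂ := sampleStore M x N (unary D) (List.replicate m false) (List.replicate H false))
      (Store.ext_aux rfl rfl rfl rfl fun e => by
        cases e <;> simp [hH, sampleStore, initStore, List.replicate_succ]) le_rfl
    have h6 := Does.congr (does_clear (sampleStore M x N (unary D) (List.replicate m false)
        (List.replicate H false)) .c2 rfl)
      (s₂ := sampleStore M x N (unary D) [] (List.replicate H false)) (t' := m * 3 + 2)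
      (Store.ext_aux rfl rfl rfl rfl fun e => by
        cases e <;> simp [sampleStore, initStore])
      (by simp [sampleStore, initStore])
    have h7 := Does.congr (does_addLog (sampleStore M x N (unary D) [] (List.replicate H false))
      (idle_sampleStore _ _ _ _ _) (a := .d) (b := .c2) (by decide) (by decide) (by decide)
      (by decide) 1 rfl (L := D) (by simp [sampleStore, initStore, unary]))
      (s₂ := sampleStore M x N [] (List.replicate D.size false) (List.replicate H false))
      (Store.ext_aux rfl rfl rfl rfl fun e => by
        cases e <;> simp [sampleStore, initStore, unary]) le_rfl
    have h8 := Does.congr (does_bpushN .c2 3 (sampleStore M x N [] (List.replicate D.size false)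
        (List.replicate H false))) (s₂ := s.setFound none)
      (Store.ext_aux rfl rfl rfl rfl fun e => by
        cases e <;> simp [hs, sampleStore, initStore, List.replicate_succ]) le_rfl
    have h9 := yields_search (p := trialTime M) (R := retry (timeTrial T H)) s hI
      (w := D.size + 3) rfl (fun l r => yields_trialTime h (s.set .c2 l)
        (hI.of_eq rfl rfl rfl rfl rfl rfl rfl) rfl rfl rfl hT rfl r)
    rw [← hG, ← hw] at h9
    refine Yields.mono (Does.seq_yields h1' (Does.seq_yields h2' (Does.seq_yields h3'
      (Yields.seq_does (Yields.ifF_false (by rfl) (Does.seq_yields h4 (Does.seq_yields h5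
        (Does.seq_yields h6 (Does.seq_yields h7 (Does.seq_yields h8 h9)))))) (t' := N * 3 + 4)
        fun r hr => Does.mono (hgd r) (by have := hmem _ _ hr; omega))))) ?_
    rw [hw]
    have e1 : 2 ^ H * (τ + 2 * N + 11 + (6 * H + 10)) ≤
        2 * 2 ^ m * (τ + 2 * N + 11 + (6 * (m + 1) + 10)) :=
      Nat.mul_le_mul hHpow (by omega)
    have e2 : H * 8 + 2 ^ H * (τ + 2 * N + 11 + (6 * H + 10)) + τ + N * 3 + 20 +
        (6 * (D.size + 3) + 10) ≤ 2 ^ m * (3 * τ + 20 * N + 20 * m + 6 * D.size + 200) := by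
      have e3 : (m + 1) * 8 + τ + N * 3 + 20 + (6 * (D.size + 3) + 10) ≤
        2 ^ m * ((m + 1) * 8 + τ + N * 3 + 20 + (6 * (D.size + 3) + 10)) :=
          Nat.le_mul_of_pos_left _ hpow
      have e4 : 2 ^ m * (3 * τ + 20 * N + 20 * m + 6 * D.size + 200) =
        2 ^ m * ((m + 1) * 8 + τ + N * 3 + 20 + (6 * (D.size + 3) + 10)) +
        2 * 2 ^ m * (τ + 2 * N + 11 + (6 * (m + 1) + 10)) + 2 ^ m * (13 * N + 90) := by ring
      omega
    have e5 := Nat.mul_le_mul_left (2 ^ (D.size + 3)) e2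
    rw [← mul_assoc] at e5
    rw [← hτ]
    omega
  · have hG : sampleTrial T N = nodeTrial T N := if_neg hfin
    have hw : sampleWidth T.numBr N D = D.size + 3 + m := by
      rw [sampleWidth, if_neg hfin]
    set s := sampleStore M x N [] (List.replicate (D.size + 3 + m) false) [] with hs
    have hI : s.Idle := idle_sampleStore _ _ _ _ _
    choose g hg hgd using does_output s hI.reg rfl
    refine ⟨g, hg, ?_⟩
    have hlive : r.1.isSome = true := by
      rw [hr1, isSome_walk_iff]; omega
    have h4 := Does.congr (does_setF ((s₀.set .cnt r.2.bits).setCur r.1)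
        fun f => { f with live := false })
      (s₂ := (s₀.set .cnt r.2.bits).set .path (r.1.getD []))
      (Store.ext_aux rfl rfl rfl rfl fun e => by simp) le_rfl
    have h5 := Does.congr (does_clear ((s₀.set .cnt r.2.bits).set .path (r.1.getD [])) .path rfl)
      (s₂ := s₀.set .cnt r.2.bits) (t' := N * 3 + 2) (Store.ext_aux rfl rfl rfl rfl fun e => by
        cases e <;> simp [hs₀, sampleStore, initStore]) (by simp; omega)
    have h6 := Does.congr (does_clear (s₀.set .cnt r.2.bits) .cnt rfl) (s₂ := s₀)
      (t' := m * 3 + 5) (Store.ext_aux rfl rfl rfl rfl fun e => by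
        cases e <;> simp [hs₀, sampleStore, initStore]) (by simp; omega)
    have h7 := Does.congr (does_addLog s₀ hI₀ (a := .d) (b := .c2) (by decide) (by decide)
      (by decide) (by decide) 1 rfl (L := D) (by simp [hs₀, sampleStore, initStore, unary]))
      (s₂ := sampleStore M x N [] (List.replicate (D.size + m) false) [])
      (Store.ext_aux rfl rfl rfl rfl fun e => by
        cases e <;> simp [hs₀, sampleStore, initStore, unary]) le_rfl
    have h8 := Does.congr (does_bpushN .c2 3 (sampleStore M x N []
        (List.replicate (D.size + m) false) [])) (s₂ := s.setFound none)
      (Store.ext_aux rfl rfl rfl rfl fun e => by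
        cases e <;> simp [hs, sampleStore, initStore]
        rw [show D.size + 3 + m = D.size + m + 3 by omega]
        rfl) le_rfl
    have h9 := yields_search (p := trialNode M) (R := retry (nodeTrial T N)) s hI
      (w := D.size + 3 + m) rfl (fun l r => yields_trialNode h (s.set .c2 l)
        (hI.of_eq rfl rfl rfl rfl rfl rfl rfl) rfl rfl rfl rfl r)
    rw [← hG, ← hw] at h9
    refine Yields.mono (Does.seq_yields h1' (Does.seq_yields h2' (Does.seq_yields h3
      (Yields.seq_does (Yields.ifF_true hlive (Does.seq_yields h4 (Does.seq_yields h5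
        (Does.seq_yields h6 (Does.seq_yields h7 (Does.seq_yields h8 h9)))))) (t' := N * 3 + 4)
        fun r hr => Does.mono (hgd r) (by have := hmem _ _ hr; omega))))) ?_
    rw [hw, pow_add 2 (D.size + 3) m, ← hτ]
    have e1 : 2 ^ (D.size + 3) * 2 ^ m * (τ + N * 13 + 13 + (6 * (D.size + 3 + m) + 10)) ≤
        2 ^ (D.size + 3) * 2 ^ m * (3 * τ + 20 * N + 20 * m + 6 * D.size + 200) :=
      Nat.mul_le_mul_left _ (by omega)
    omega

/-! ### Success probabilities -/

lemma two_pow_size_le (a : ℕ) : 2 ^ (a + 1).size ≤ 2 * (a + 1) := by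
  have h : ¬ (a + 1).size ≤ (a + 1).size - 1 := by
    have := Nat.size_pos.2 (Nat.add_one_pos a)
    omega
  rw [Nat.size_le, not_lt] at h
  have h2 : 2 ^ (a + 1).size = 2 * 2 ^ ((a + 1).size - 1) := by
    rw [← pow_succ', Nat.sub_add_cancel (Nat.size_pos.2 (Nat.add_one_pos a))]
  omega

lemma two_pow_size_le' (a : ℕ) : 2 ^ a.size ≤ 2 * (a + 1) :=
  (Nat.pow_le_pow_right (by norm_num) (Nat.size_le_size a.le_succ)).trans (two_pow_size_le a)

namespace CompTree

variable {C D : Type}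

lemma expect_ite (P : C → Prop) [DecidablePred P] (T : CompTree C) :
    (T.expect fun c => if P c then 1 else 0) = T.prob P := by
  rw [prob_eq_expect]
  exact expect_congr fun c _ => by by_cases h : P c <;> simp [h]

lemma iter_succ' (F : C → CompTree C) (n : ℕ) (a : C) :
    iter F (n + 1) a = (iter F n a).bind F := by
  rw [iter_add]
  exact bind_congr _ fun c _ => bind_pure _

lemma prob_nonneg (P : C → Prop) (T : CompTree C) : 0 ≤ T.prob P := by
  induction T with
  | leaf c => simp only [prob]; split_ifs <;> norm_num
  | node l r hl hr => simp only [prob]; linarith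

lemma prob_le_one (P : C → Prop) (T : CompTree C) : T.prob P ≤ 1 := by
  have := prob_nonneg (fun c => ¬ P c) T
  rw [prob_not] at this
  linarith

lemma prob_eq_one {P : C → Prop} {T : CompTree C} (H : ∀ c, T.Mem c → P c) : T.prob P = 1 := by
  rw [prob_congr (Q := fun _ => True) fun c hc => by simpa using H c hc]
  simp [prob_eq_expect]

lemma prob_eq_zero {P : C → Prop} {T : CompTree C} (H : ∀ c, T.Mem c → ¬ P c) : T.prob P = 0 := by
  rw [prob_congr (Q := fun _ => False) fun c hc => by simpa using H c hc]
  simp [prob_eq_expect]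

lemma prob_or_le (P Q : C → Prop) (T : CompTree C) :
    (T.prob fun c => P c ∨ Q c) ≤ T.prob P + T.prob Q := by
  classical
  simp only [prob_eq_expect, ← expect_add]
  refine expect_mono fun c _ => ?_
  by_cases hP : P c <;> by_cases hQ : Q c <;> simp [hP, hQ]

lemma prob_bind (P : D → Prop) (T : CompTree C) (F : C → CompTree D) :
    (T.bind F).prob P = T.expect fun c => (F c).prob P := by
  classical
  simp only [prob_eq_expect, expect_bind]

/-- Markov's inequality. -/
lemma prob_le_expect {P : C → Prop} {g : C → ℝ} {T : CompTree C} (h0 : ∀ c, 0 ≤ g c)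
    (h1 : ∀ c, P c → 1 ≤ g c) : T.prob P ≤ T.expect g := by
  classical
  rw [prob_eq_expect]
  refine expect_mono fun c _ => ?_
  split_ifs with h
  · exact h1 c h
  · exact h0 c

lemma prob_extendT_none (N : ℕ) : (iter extendT N none).prob (· = none) = 1 / 2 ^ N := by
  classical
  induction N with
  | zero => simp [iter, prob]
  | succ N ih =>
    rw [iter_succ', prob_bind, show (fun c => (extendT c).prob (· = none)) =
      fun c => (1 / 2 : ℝ) * if c = none then 1 else 0 by
        funext c; cases c <;> simp [extendT, extend, prob], expect_mul_left, expect_ite, ih]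
    rw [pow_succ]; ring

/-- All addresses of length less than `N` are equally likely as random nodes. -/
lemma prob_extendT_some : ∀ {N : ℕ} {u : List Bool}, u.length < N →
    (iter extendT N none).prob (· = some u) = 1 / 2 ^ N := by
  classical
  intro N
  induction N with
  | zero => intro u hu; omega
  | succ N ih =>
    intro u hu
    rw [iter_succ', prob_bind]
    cases u with
    | nil =>
      rw [show (fun c => (extendT c).prob (· = some [])) =
        fun c => (1 / 2 : ℝ) * if c = none then 1 else 0 by
          funext c; cases c <;> simp [extendT, extend, prob], expect_mul_left, expect_ite,
        prob_extendT_none, pow_succ]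
      ring
    | cons b u =>
      rw [show (fun c => (extendT c).prob (· = some (b :: u))) =
        fun c => (1 / 2 : ℝ) * if c = some u then 1 else 0 by
          funext c
          cases c with
          | none => simp [extendT, extend, prob]
          | some p => cases b <;> by_cases hp : p = u <;> simp [extendT, extend, prob, hp],
        expect_mul_left, expect_ite, ih (by simpa using hu), pow_succ]
      ring

lemma sum_range_two_mul (g : ℕ → ℝ) (n : ℕ) :
    ∑ i ∈ Finset.range (2 * n), g i = ∑ i ∈ Finset.range n, (g (2 * i) + g (2 * i + 1)) := by
  induction n with
  | zero => simp
  | succ n ih =>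
    rw [Nat.mul_succ, Finset.sum_range_succ, Finset.sum_range_succ, ih, Finset.sum_range_succ,
      add_assoc]

/-- A random number is uniformly distributed. -/
lemma expect_digitT (g : ℕ → ℝ) (h : ℕ) : (iter digitT h []).expect (fun y => g (bval y)) =
    (∑ i ∈ Finset.range (2 ^ h), g i) / 2 ^ h := by
  induction h generalizing g with
  | zero => simp [iter, bval]
  | succ h ih =>
    rw [iter_succ', expect_bind, show (fun c => (digitT c).expect fun y => g (bval y)) =
      fun c => (fun i => (g (2 * i) + g (2 * i + 1)) / 2) (bval c) by
        funext c; simp [digitT, bval, add_comm],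
      ih (fun i => (g (2 * i) + g (2 * i + 1)) / 2), ← Finset.sum_div, pow_succ', pow_succ',
      sum_range_two_mul]
    field_simp

/-- If the values other than `none` are uniformly distributed over a list, then their common
probability is determined by the probability of `none`. -/
lemma prob_none_eq {G : CompTree (Option (List Bool))} {L : List (List Bool)} (hL : L.Nodup)
    (hG : ∀ u, G.Mem (some u) → u ∈ L) {q : ℝ} (hq : ∀ u ∈ L, G.prob (· = some u) = q) :
    G.prob (· = none) = 1 - L.length * q := by
  classical
  -- every value of `G` is `none` or occurs once in `L`
  have h1 : G.expect (fun a => (if a = none then (1 : ℝ) else 0) +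
      ∑ u ∈ L.toFinset, if a = some u then (1 : ℝ) else 0) = 1 := by
    rw [← expect_const (1 : ℝ) G]
    refine expect_congr fun a ha => ?_
    cases a with
    | none => simp
    | some u => simp [hG u ha]
  rw [expect_add, expect_sum] at h1
  simp only [expect_ite] at h1
  rw [Finset.sum_congr rfl fun u hu => hq u (List.mem_toFinset.1 hu), Finset.sum_const,
    List.toFinset_card_of_nodup hL, nsmul_eq_mul] at h1
  linarith

section

variable (T : CompTree C)

lemma mem_addrs_nil {u : List Bool} : u ∈ T.addrs [] ↔ T.IsBranching u.reverse := by
  rw [mem_addrs]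
  constructor
  · rintro ⟨w, hw, rfl⟩
    simpa using hw
  · exact fun h => ⟨_, h, by simp⟩

lemma accept_eq_some {a : Option (List Bool)} {u : List Bool} (hu : u ∈ T.addrs []) :
    accept T a = some u ↔ a = some u := by
  rw [mem_addrs_nil] at hu
  unfold accept
  split_ifs with h
  · rfl
  · simp only [false_iff]
    rintro rfl
    simp [isBr, hu] at h

lemma length_lt_of_mem_addrs {N : ℕ} (hT : T.height ≤ N) {u : List Bool} (hu : u ∈ T.addrs []) :
    u.length < N := by
  have := length_lt_height ((mem_addrs_nil T).1 hu)
  rw [List.length_reverse] at this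
  omega

lemma prob_nodeTrial {N : ℕ} (hT : T.height ≤ N) {u : List Bool} (hu : u ∈ T.addrs []) :
    (nodeTrial T N).prob (· = some u) = 1 / 2 ^ N := by
  rw [nodeTrial, prob_map]
  simp only [accept_eq_some T hu]
  exact prob_extendT_some (length_lt_of_mem_addrs T hT hu)

/-- The traversal has ended before time `2 ^ h` and has met each branching once, so that a random
time below `2 ^ h` leads to each branching with the same probability. -/
lemma prob_timeTrial {h : ℕ} (hT : 2 * T.numBr + 1 ≤ 2 ^ h) {u : List Bool}
    (hu : u ∈ T.addrs []) : (timeTrial T h).prob (· = some u) = 1 / 2 ^ h := by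
  rw [timeTrial, prob_map, ← expect_ite]
  have h1 := expect_digitT (fun i =>
    if accept T ((walk T)^[2 ^ h - 1 - i] (some [])) = some u then 1 else 0) h
  rw [h1, Finset.sum_range_reflect
    (fun i => if accept T ((walk T)^[i] (some [])) = some u then (1 : ℝ) else 0)]
  congr 1
  have h2 := sum_walk T hT fun a => if a = some u then 1 else 0
  rw [← List.sum_toFinset _ (nodup_addrs T [])] at h2
  simp only [Option.some.injEq, Finset.sum_ite_eq', List.mem_toFinset, hu, if_true] at h2
  refine Eq.trans ?_ ((congrArg Nat.cast h2).trans Nat.cast_one)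
  rw [Nat.cast_sum]
  refine Finset.sum_congr rfl fun t _ => ?_
  clear h1 h2
  unfold accept
  split_ifs <;> simp_all

/-- The probability that a trial of the sampler yields a given branching. -/
noncomputable def trialProb (N : ℕ) : ℝ :=
  if 2 * T.numBr + 1 ≤ 2 ^ ((N + 1) / 2) then 1 / 2 ^ (T.numBr.size + 1) else 1 / 2 ^ N

lemma two_mul_add_one_le (f : ℕ) : 2 * f + 1 ≤ 2 ^ (f.size + 1) := by
  have := Nat.lt_size_self f
  rw [pow_succ]; omega

lemma prob_sampleTrial {N : ℕ} (hT : T.height ≤ N) {u : List Bool} (hu : u ∈ T.addrs []) :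
    (sampleTrial T N).prob (· = some u) = trialProb T N := by
  unfold sampleTrial trialProb
  split_ifs with h
  · exact prob_timeTrial T (two_mul_add_one_le _) hu
  · exact prob_nodeTrial T hT hu

end

section

variable {G : CompTree (Option (List Bool))} {q : ℝ}

lemma prob_retry_none (n : ℕ) :
    (iter (retry G) n none).prob (· = none) = (G.prob (· = none)) ^ n := by
  classical
  induction n with
  | zero => simp [iter, prob]
  | succ n ih =>
    rw [iter_succ', prob_bind, show (fun c => (retry G c).prob (· = none)) =
      fun c => G.prob (· = none) * if c = none then 1 else 0 by
        funext c; cases c <;> simp [retry, prob], expect_mul_left, expect_ite, ih, pow_succ']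

lemma prob_retry_some {u : List Bool} (n : ℕ) (hq : G.prob (· = some u) = q) :
    (iter (retry G) n none).prob (· = some u) =
      q * ∑ i ∈ Finset.range n, (G.prob (· = none)) ^ i := by
  classical
  induction n with
  | zero => simp [iter, prob]
  | succ n ih =>
    rw [iter_succ', prob_bind, show (fun c => (retry G c).prob (· = some u)) =
      fun c => q * (if c = none then 1 else 0) + if c = some u then 1 else 0 by
        funext c; cases c <;> simp [retry, prob, hq], expect_add, expect_mul_left,
      expect_ite, expect_ite, ih, prob_retry_none, Finset.sum_range_succ]
    ring

/-- Repeating a trial preserves the uniformity of the samples. -/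
lemma prob_retry_eq {L : List (List Bool)} (hL : L.Nodup) (h0 : 0 < L.length)
    (hG : ∀ u, G.Mem (some u) → u ∈ L) (hq : ∀ u ∈ L, G.prob (· = some u) = q) (n : ℕ)
    {u : List Bool} (hu : u ∈ L) : (iter (retry G) n none).prob (· = some u) =
      (1 - (iter (retry G) n none).prob (· = none)) / L.length := by
  have h1 := prob_none_eq (G := iter (retry G) n none) hL
    (fun u hu => mem_retry_iter (P := (· ∈ L)) hG hu u rfl) fun u hu => prob_retry_some n (hq u hu)
  rw [h1, prob_retry_some n (hq u hu)]
  have : (L.length : ℝ) ≠ 0 := by positivity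
  field_simp
  ring

end

lemma exp_neg_nat_le (D : ℕ) : Real.exp (-(D : ℝ)) ≤ 1 / 2 ^ D := by
  rw [Real.exp_neg, one_div]
  refine inv_anti₀ (by positivity) ?_
  rw [← mul_one (D : ℝ), Real.exp_nat_mul]
  refine pow_le_pow_left₀ (by norm_num) ?_ D
  have := Real.add_one_le_exp (1 : ℝ)
  linarith

lemma two_pow_div_le (N : ℕ) : (2 : ℝ) ^ N ≤ 2 ^ ((N + 1) / 2) * 2 ^ ((N + 1) / 2) := by
  rw [← pow_add]
  exact pow_le_pow_right₀ (by norm_num) (by omega)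

/-- The trials all fail with probability at most `(1 - p) ^ n ≤ exp (- p * n)`, where `n` is their
number and `p` the success probability; the width of the counter makes `p * n` at least `D`. -/
lemma prob_fail_le (T : CompTree C) {N : ℕ} (hT : T.height ≤ N) (h0 : 0 < T.numBr) (D : ℕ) :
    (iter (retry (sampleTrial T N)) (2 ^ sampleWidth T.numBr N D - 1) none).prob (· = none) ≤
      1 / 2 ^ D := by
  have h1 := prob_none_eq (nodup_addrs T []) (G := sampleTrial T N)
    (fun u hu => (mem_addrs_nil T).2 (isBranching_of_mem_sampleTrial hu))
    fun u hu => prob_sampleTrial T hT hu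
  rw [length_addrs] at h1
  have h2 := prob_nonneg (· = none) (sampleTrial T N)
  rw [prob_retry_none]
  refine le_trans (pow_le_pow_left₀ h2 (h1.trans_le (Real.one_sub_le_exp_neg _)) _) ?_
  rw [← Real.exp_nat_mul]
  refine le_trans (Real.exp_le_exp.2 ?_) (exp_neg_nat_le D)
  have hD : ((D : ℝ) + 1) ≤ 2 ^ D.size := by exact_mod_cast Nat.lt_size_self D
  have hcast : ((2 ^ sampleWidth T.numBr N D - 1 : ℕ) : ℝ) = 2 ^ sampleWidth T.numBr N D - 1 := by
    rw [Nat.cast_sub Nat.one_le_two_pow]; norm_num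
  have hf : (1 : ℝ) ≤ T.numBr := by exact_mod_cast h0
  rw [hcast, sampleWidth, trialProb]
  rw [mul_neg, neg_le_neg_iff]
  split_ifs with h
  · have hsize : (2 : ℝ) ^ (T.numBr.size + 1) ≤ 4 * T.numBr := by
      have h3 := two_pow_size_le (T.numBr - 1)
      rw [Nat.sub_add_cancel h0] at h3
      have : 2 ^ (T.numBr.size + 1) ≤ 4 * T.numBr := by rw [pow_succ]; omega
      exact_mod_cast this
    have h5 : (1 / 4 : ℝ) ≤ T.numBr * (1 / 2 ^ (T.numBr.size + 1)) := by
      rw [mul_one_div, div_le_div_iff₀ (by norm_num) (by positivity)]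
      linarith
    have h6 : 8 * (D : ℝ) + 7 ≤ 2 ^ (D.size + 3 + 0) - 1 := by
      rw [add_zero, pow_add]; linarith
    calc (D : ℝ) ≤ (8 * (D : ℝ) + 7) * (1 / 4) := by
          have : (0 : ℝ) ≤ D := by positivity
          linarith
      _ ≤ _ := mul_le_mul h6 h5 (by norm_num) (by
          have : (0 : ℝ) ≤ D := by positivity
          linarith)
  · set m := (N + 1) / 2 with hm
    have hf2 : (2 : ℝ) ^ m ≤ 2 * T.numBr := by
      have : 2 ^ m ≤ 2 * T.numBr := by omega
      exact_mod_cast this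
    have hp : (1 : ℝ) ≤ 2 ^ m := one_le_pow₀ (by norm_num)
    have h6 : (8 * (D : ℝ) + 7) * 2 ^ m ≤ 2 ^ (D.size + 3 + m) - 1 := by
      rw [pow_add, pow_add]
      have := mul_le_mul_of_nonneg_right hD (by positivity : (0 : ℝ) ≤ 8 * 2 ^ m)
      nlinarith
    have h7 := two_pow_div_le N
    rw [mul_one_div, ← mul_div_assoc, le_div_iff₀ (by positivity)]
    have hD0 : (0 : ℝ) ≤ D := by positivity
    calc (D : ℝ) * 2 ^ N ≤ D * (2 ^ m * 2 ^ m) := mul_le_mul_of_nonneg_left h7 hD0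
      _ ≤ D * (2 ^ m * (2 * T.numBr)) := by gcongr
      _ = (2 * D * 2 ^ m) * T.numBr := by ring
      _ ≤ ((8 * (D : ℝ) + 7) * 2 ^ m) * T.numBr := by gcongr; linarith
      _ ≤ _ := mul_le_mul_of_nonneg_right h6 (by positivity)

/-! ### Concentration of the estimate -/

section

variable (T : CompTree C)

lemma prob_isBr {N : ℕ} (hT : T.height ≤ N) :
    (iter extendT N none).prob (fun a => isBr T a = true) = T.numBr / 2 ^ N := by
  have h1 := prob_none_eq (nodup_addrs T []) (G := nodeTrial T N)
    (fun u hu => by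
      obtain ⟨a, -, ha⟩ := mem_map.1 hu
      exact (mem_addrs_nil T).2 (isBranching_of_accept ha))
    fun u hu => prob_nodeTrial T hT hu
  have h2 : (nodeTrial T N).prob (· = none) =
      (iter extendT N none).prob (fun a => ¬ isBr T a = true) := by
    rw [nodeTrial, prob_map]
    refine prob_congr fun a _ => ?_
    unfold accept
    cases a with
    | none => simp [isBr]
    | some p => split_ifs <;> simp_all
  rw [prob_not, h1, length_addrs] at h2
  rw [mul_one_div] at h2
  linarith

/-- The moment generating function of the number of successes. -/
lemma expect_exp_countTrial {N : ℕ} (hT : T.height ≤ N) (c : ℝ) (n : ℕ) :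
    (iter (countTrial T N) n 0).expect (fun X : ℕ => Real.exp (c * X)) =
      (1 + T.numBr / 2 ^ N * (Real.exp c - 1)) ^ n := by
  induction n with
  | zero => simp [iter]
  | succ n ih =>
    rw [iter_succ', expect_bind, show (fun X : ℕ => (countTrial T N X).expect fun X : ℕ =>
        Real.exp (c * X)) =
      fun X : ℕ => (1 + T.numBr / 2 ^ N * (Real.exp c - 1)) * Real.exp (c * X) by
        funext X
        rw [countTrial, expect_map, show (fun a : Option (List Bool) =>
          Real.exp (c * ((if isBr T a then X + 1 else X : ℕ) : ℝ))) = fun a => Real.exp (c * X) +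
            Real.exp (c * X) * (Real.exp c - 1) * if isBr T a = true then 1 else 0 by
          funext a
          split_ifs
          · rw [Nat.cast_add, Nat.cast_one, mul_add, Real.exp_add, mul_one]; ring
          · ring, expect_add, expect_const, expect_mul_left, expect_ite, prob_isBr T hT]
        ring, expect_mul_left, ih, pow_succ']

/-- Both tails of the number of successes, for positive and negative `c`. -/
lemma prob_tail_le {N : ℕ} (hT : T.height ≤ N) (n : ℕ) {μ ε c : ℝ} (hμ : μ = n * (T.numBr / 2 ^ N))
    (hc : |c| ≤ 1) :
    (iter (countTrial T N) n 0).prob (fun X : ℕ => |c| * ε * μ ≤ c * (X - μ)) ≤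
      Real.exp (μ * (c ^ 2 - |c| * ε)) := by
  set p : ℝ := T.numBr / 2 ^ N with hp
  have hp0 : 0 ≤ p := by positivity
  -- the second order expansion of the exponential makes both tails alike
  have hexp : Real.exp c ≤ 1 + c + c ^ 2 := by
    have := (abs_le.1 (Real.abs_exp_sub_one_sub_id_le hc)).2
    linarith
  have h1 : 0 ≤ 1 + p * (Real.exp c - 1) := by
    have hp1 : p ≤ 1 := by
      rw [hp, ← prob_isBr T hT]
      exact prob_le_one _ _
    have := Real.exp_pos c
    nlinarith
  refine le_trans (prob_le_expect
    (g := fun X : ℕ => Real.exp (-c * μ - |c| * ε * μ) * Real.exp (c * X))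
    (fun X => by positivity) fun X hX => ?_) ?_
  · rw [← Real.exp_add]
    exact Real.one_le_exp (by linarith)
  · rw [expect_mul_left, expect_exp_countTrial T hT]
    calc Real.exp (-c * μ - |c| * ε * μ) * (1 + p * (Real.exp c - 1)) ^ n
        ≤ Real.exp (-c * μ - |c| * ε * μ) * Real.exp (p * (Real.exp c - 1)) ^ n := by
          gcongr
          rw [add_comm]
          exact Real.add_one_le_exp _
      _ = Real.exp (-c * μ - |c| * ε * μ + μ * (Real.exp c - 1)) := by
          rw [← Real.exp_nat_mul, ← Real.exp_add, hμ]; ring_nf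
      _ ≤ _ := by
          rw [Real.exp_le_exp]
          have : 0 ≤ μ := by rw [hμ]; positivity
          nlinarith

/-- Chernoff's bound. -/
lemma prob_deviation_le {N : ℕ} (hT : T.height ≤ N) (n : ℕ) {μ ε : ℝ}
    (hμ : μ = n * (T.numBr / 2 ^ N)) (h0 : 0 < ε) (h1 : ε ≤ 1) :
    (iter (countTrial T N) n 0).prob (fun X : ℕ => ε * μ < |(X : ℝ) - μ|) ≤
      2 * Real.exp (-(μ * ε ^ 2 / 4)) := by
  -- `c = ± ε / 2` minimizes the exponent `c ^ 2 - |c| * ε`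
  have ha : |ε / 2| = ε / 2 := abs_of_pos (by linarith)
  have hb : |-(ε / 2)| = ε / 2 := by rw [abs_neg, ha]
  have h2 := prob_tail_le T hT n (ε := ε) hμ (c := ε / 2) (by rw [ha]; linarith)
  have h3 := prob_tail_le T hT n (ε := ε) hμ (c := -(ε / 2)) (by rw [hb]; linarith)
  rw [ha] at h2
  rw [hb, neg_sq] at h3
  have h4 : μ * ((ε / 2) ^ 2 - ε / 2 * ε) = -(μ * ε ^ 2 / 4) := by ring
  rw [h4] at h2 h3
  refine le_trans (prob_mono fun X _ hX => ?_) ((prob_or_le _ _ _).trans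
    ((add_le_add h2 h3).trans_eq (two_mul _).symm))
  rcases lt_abs.1 hX with h | h
  · left; nlinarith
  · right; nlinarith

lemma bits_two_pow_mul {X : ℕ} (hX : 0 < X) (j : ℕ) :
    (2 ^ j * X).bits = List.replicate j false ++ X.bits := by
  induction j with
  | zero => simp
  | succ j ih =>
    have h : 2 ^ (j + 1) * X = Nat.bit false (2 ^ j * X) := by
      rw [Nat.bit_false_apply, pow_succ]; ring
    rw [h, Nat.bits_append_bit _ _ fun h0 => absurd h0 (by positivity), ih]
    rfl

/-- If the tree is too large to be traversed, then the estimate is likely to be accurate. -/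
lemma prob_estimate_ge {N : ℕ} (hT : T.height ≤ N) {K D : ℕ}
    (hK : 0 < K) (h : ¬ 2 * T.numBr + 1 ≤ 2 ^ countWidth N K D) :
    1 - 1 / 2 ^ D ≤ (iter (countTrial T N) (2 ^ ((N + 1) / 2)) 0).prob fun X =>
      ∃ y : ℕ, y.bits = List.replicate (N / 2) false ++ X.bits ∧
        |(y : ℝ) - T.numBr| ≤ 1 / (K + 1) * T.numBr := by
  set m := (N + 1) / 2 with hm
  set f : ℝ := (T.numBr : ℝ) with hf
  set ε : ℝ := 1 / (K + 1) with hε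
  set μ : ℝ := ((2 ^ m : ℕ) : ℝ) * (f / 2 ^ N) with hμ
  have hK' : (1 : ℝ) ≤ K := by exact_mod_cast hK
  have hε0 : 0 < ε := by positivity
  -- the accuracy `1 / (K + 1)` instead of `1 / K` ensures that `X` is positive; the number zero has
  -- no binary digits, so that prepending zeros to it would not give a valid representation
  have hε2 : ε ≤ 1 / 2 := one_div_le_one_div_of_le (by norm_num) (by linarith)
  have hmN : m + N / 2 = N := by omega
  have hfμ : f = 2 ^ (N / 2) * μ := by
    have : (2 : ℝ) ^ N = 2 ^ m * 2 ^ (N / 2) := by rw [← pow_add, hmN]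
    rw [hμ, this]
    push_cast
    field_simp
  have hlarge : 32 * ((K : ℝ) + 1) ^ 2 * (D + 1) * 2 ^ m ≤ f := by
    have h1 : (2 : ℝ) ^ countWidth N K D ≤ 2 * f := by
      have : 2 ^ countWidth N K D ≤ 2 * T.numBr := by omega
      rw [hf]
      exact_mod_cast this
    have h2 : ((K : ℝ) + 1) ≤ 2 ^ (K + 1).size := by
      exact_mod_cast (Nat.lt_size_self (K + 1)).le
    have h3 : ((D : ℝ) + 1) ≤ 2 ^ D.size := by exact_mod_cast Nat.lt_size_self D
    have h4 : (2 : ℝ) ^ countWidth N K D =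
        64 * (2 ^ (K + 1).size) ^ 2 * 2 ^ D.size * 2 ^ m := by
      rw [countWidth, pow_add, pow_add, pow_add, ← pow_mul, mul_comm 2 (K + 1).size]
      ring
    have h5 : 64 * ((K : ℝ) + 1) ^ 2 * (D + 1) * 2 ^ m ≤
        64 * (2 ^ (K + 1).size) ^ 2 * 2 ^ D.size * 2 ^ m := by gcongr
    linarith
  have hμlarge : 32 * ((K : ℝ) + 1) ^ 2 * (D + 1) ≤ μ := by
    have h1 := two_pow_div_le N
    rw [hμ, ← mul_div_assoc, le_div_iff₀ (by positivity)]
    push_cast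
    calc 32 * ((K : ℝ) + 1) ^ 2 * (D + 1) * 2 ^ N
        ≤ 32 * ((K : ℝ) + 1) ^ 2 * (D + 1) * (2 ^ m * 2 ^ m) := by gcongr
      _ = 2 ^ m * (32 * ((K : ℝ) + 1) ^ 2 * (D + 1) * 2 ^ m) := by ring
      _ ≤ 2 ^ m * f := by gcongr
  have hexp : ((D : ℝ) + 1) ≤ μ * ε ^ 2 / 4 := by
    have h1 : 32 * ((K : ℝ) + 1) ^ 2 * (D + 1) * ε ^ 2 ≤ μ * ε ^ 2 := by gcongr
    have h2 : 32 * ((K : ℝ) + 1) ^ 2 * (D + 1) * ε ^ 2 = 32 * (D + 1) := by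
      rw [hε]; field_simp
    have : (0 : ℝ) ≤ D := by positivity
    linarith
  have hμ0 : 0 < μ := lt_of_lt_of_le (by positivity) hμlarge
  have hdev := prob_deviation_le T hT (2 ^ m) hμ hε0 (by linarith)
  have hbound : 2 * Real.exp (-(μ * ε ^ 2 / 4)) ≤ 1 / 2 ^ D := by
    have h1 : Real.exp (-(μ * ε ^ 2 / 4)) ≤ 1 / 2 ^ (D + 1) := by
      refine le_trans (Real.exp_le_exp.2 ?_) (exp_neg_nat_le (D + 1))
      push_cast
      linarith
    calc 2 * Real.exp (-(μ * ε ^ 2 / 4)) ≤ 2 * (1 / 2 ^ (D + 1)) := by gcongr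
      _ = 1 / 2 ^ D := by rw [pow_succ]; field_simp
  calc 1 - 1 / 2 ^ D
      ≤ (iter (countTrial T N) (2 ^ m) 0).prob fun X : ℕ => ¬ ε * μ < |(X : ℝ) - μ| := by
        rw [prob_not]; linarith
    _ ≤ _ := prob_mono fun X _ hX => by
        rw [not_lt] at hX
        have hX0 : (0 : ℝ) < X := by
          have h1 := (abs_le.1 hX).1
          have h2 : ε * μ ≤ 1 / 2 * μ := by gcongr
          linarith
        refine ⟨2 ^ (N / 2) * X, bits_two_pow_mul (by exact_mod_cast hX0) _, ?_⟩
        rw [hfμ]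
        push_cast
        rw [← mul_sub, abs_mul, abs_of_pos (by positivity)]
        calc (2 : ℝ) ^ (N / 2) * |(X : ℝ) - μ| ≤ 2 ^ (N / 2) * (ε * μ) := by gcongr
          _ = ε * (2 ^ (N / 2) * μ) := by ring

end

end CompTree

/-! ### Running times -/

lemma size_le_self (a : ℕ) : a.size ≤ a := Nat.size_le.2 Nat.lt_two_pow_self

/-- A generous bound; the factor `Z ^ 4` consists of `Z ^ 3` for the length `2 ^ countWidth N K D`
of the traversal and `Z` for the time of a step. -/
lemma countProg_time_le (N K D τ : ℕ) {Z : ℕ} (hZ : K + D + (τ + N) + 1 ≤ Z) :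
    (N * 10 + (K + D + 1) * (K + D + 1) * 12 + (K + D + 1) * 31 + 21) + 1 +
      (2 ^ countWidth N K D + 1) * (τ + 12 * countWidth N K D + 2 * N + 30) +
      ((2 ^ ((N + 1) / 2) + 1) * (τ + 12 * ((N + 1) / 2) + 13 * N + 40) +
        7 * N + 3 * countWidth N K D + 20) + 1 ≤ 79000 * Z ^ 4 * 2 ^ ((N + 1) / 2) := by
  set m := (N + 1) / 2 with hm
  set W := countWidth N K D with hW
  have hp : 1 ≤ 2 ^ m := Nat.one_le_two_pow
  have hWZ : W ≤ 10 * Z := by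
    have h1 := size_le_self (K + 1)
    have h2 := size_le_self D
    rw [hW, countWidth]
    omega
  have h2W : 2 ^ W ≤ 2 ^ m * (512 * Z ^ 3) := by
    have h3 : (2 ^ (K + 1).size) ^ 2 ≤ (2 * Z) ^ 2 :=
      Nat.pow_le_pow_left ((two_pow_size_le K).trans (by omega)) 2
    have h4 : 2 ^ D.size ≤ 2 * Z := (two_pow_size_le' D).trans (by omega)
    calc 2 ^ W = 2 ^ m * ((2 ^ (K + 1).size) ^ 2 * 2 ^ D.size * 64) := by
          rw [hW, countWidth, pow_add, pow_add, pow_add, ← pow_mul, mul_comm 2 (K + 1).size]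
          ring
      _ ≤ 2 ^ m * ((2 * Z) ^ 2 * (2 * Z) * 64) := by gcongr
      _ = _ := by ring
  have hZ1 : 1 ≤ Z := by omega
  have hZ4 : Z ≤ Z ^ 4 := Nat.le_self_pow (by norm_num) Z
  have hZ24 : Z * Z ≤ Z ^ 4 := by
    rw [← pow_two]; exact Nat.pow_le_pow_right hZ1 (by norm_num)
  have e1 : (K + D + 1) * (K + D + 1) ≤ Z * Z := Nat.mul_le_mul (by omega) (by omega)
  have e2 : (2 ^ W + 1) * (τ + 12 * W + 2 * N + 30) ≤ 2 ^ m * (513 * Z ^ 3) * (152 * Z) :=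
    Nat.mul_le_mul (by
      have : 1 ≤ 2 ^ m * Z ^ 3 := Nat.one_le_iff_ne_zero.2 (by positivity)
      calc 2 ^ W + 1 ≤ 2 ^ m * (512 * Z ^ 3) + 2 ^ m * Z ^ 3 := by omega
        _ = _ := by ring) (by omega)
  have e3 : (2 ^ m + 1) * (τ + 12 * m + 13 * N + 40) ≤ 2 * 2 ^ m * (40 * Z) :=
    Nat.mul_le_mul (by omega) (by omega)
  have e4 : N * 10 + Z * Z * 12 + Z * 31 + 21 + 1 + 7 * N + 3 * W + 20 + 1 ≤ 150 * Z ^ 4 := by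
    omega
  have e5 : 150 * Z ^ 4 ≤ 2 ^ m * (150 * Z ^ 4) := Nat.le_mul_of_pos_left _ hp
  have e6 : 2 * 2 ^ m * (40 * Z) ≤ 2 * 2 ^ m * (40 * Z ^ 4) := by gcongr
  have e7 : 79000 * Z ^ 4 * 2 ^ m = 2 ^ m * (513 * Z ^ 3) * (152 * Z) + 2 * 2 ^ m * (40 * Z ^ 4) +
      2 ^ m * (150 * Z ^ 4) + 794 * (2 ^ m * Z ^ 4) := by ring
  omega

lemma sampleProg_time_le (N D τ : ℕ) {Z : ℕ} (hZ : D + (τ + N) + 1 ≤ Z) :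
    2 ^ (D.size + 3) * 2 ^ ((N + 1) / 2) * (3 * τ + 20 * N +
        20 * ((N + 1) / 2) + 6 * D.size + 200) +
      (2 ^ ((N + 1) / 2) + 1) * (τ + 12 * ((N + 1) / 2) + 2 * N + 30) +
      (D * (D * 6 + 11) + D * 4 + 20 * N + 10 * ((N + 1) / 2) + 60) + 1 ≤
    79000 * Z ^ 4 * 2 ^ ((N + 1) / 2) := by
  set m := (N + 1) / 2 with hm
  have hp : 1 ≤ 2 ^ m := Nat.one_le_two_pow
  have hD := size_le_self D
  have hZ1 : 1 ≤ Z := by omega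
  have hZ4 : Z ≤ Z ^ 4 := Nat.le_self_pow (by norm_num) Z
  have hZ24 : Z * Z ≤ Z ^ 4 := by
    rw [← pow_two]; exact Nat.pow_le_pow_right hZ1 (by norm_num)
  have h2D : 2 ^ (D.size + 3) ≤ 16 * Z := by
    have := two_pow_size_le' D
    rw [pow_add]; omega
  have e1 : 2 ^ (D.size + 3) * 2 ^ m * (3 * τ + 20 * N + 20 * m + 6 * D.size + 200) ≤
      16 * Z * 2 ^ m * (200 * Z) :=
    Nat.mul_le_mul (Nat.mul_le_mul_right _ h2D) (by omega)
  have e2 : (2 ^ m + 1) * (τ + 12 * m + 2 * N + 30) ≤ 2 * 2 ^ m * (30 * Z) :=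
    Nat.mul_le_mul (by omega) (by omega)
  have e3 : D * (D * 6 + 11) ≤ Z * (Z * 11) := Nat.mul_le_mul (by omega) (by omega)
  have e4 : Z * (Z * 11) = 11 * (Z * Z) := by ring
  have e5 : D * 4 + 20 * N + 10 * m + 60 + 1 + Z * (Z * 11) ≤ 100 * Z ^ 4 := by omega
  have e6 : 100 * Z ^ 4 ≤ 2 ^ m * (100 * Z ^ 4) := Nat.le_mul_of_pos_left _ hp
  have e7 : 2 * 2 ^ m * (30 * Z) ≤ 2 * 2 ^ m * (30 * Z ^ 4) := by gcongr
  have e8 : 16 * Z * 2 ^ m * (200 * Z) = 3200 * 2 ^ m * (Z * Z) := by ring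
  have e9 : 3200 * 2 ^ m * (Z * Z) ≤ 3200 * 2 ^ m * Z ^ 4 := by gcongr
  have e10 : 79000 * Z ^ 4 * 2 ^ m = 3200 * 2 ^ m * Z ^ 4 + 2 * 2 ^ m * (30 * Z ^ 4) +
      2 ^ m * (100 * Z ^ 4) + 75640 * (2 ^ m * Z ^ 4) := by ring
  omega

lemma two_pow_half_le (N : ℕ) : (2 : ℝ) ^ ((N + 1) / 2) ≤ 2 * (2 : ℝ) ^ ((N : ℝ) / 2) := by
  have h1 : (((N + 1) / 2 : ℕ) : ℝ) ≤ (N : ℝ) / 2 + 1 := by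
    have : 2 * ((N + 1) / 2) ≤ N + 1 := Nat.mul_div_le _ _
    have : (2 : ℝ) * (((N + 1) / 2 : ℕ) : ℝ) ≤ N + 1 := by exact_mod_cast this
    linarith
  rw [← Real.rpow_natCast]
  calc (2 : ℝ) ^ (((N + 1) / 2 : ℕ) : ℝ) ≤ 2 ^ ((N : ℝ) / 2 + 1) :=
        Real.rpow_le_rpow_of_exponent_le (by norm_num) h1
    _ = 2 * (2 : ℝ) ^ ((N : ℝ) / 2) := by
        rw [Real.rpow_add (by norm_num), Real.rpow_one, mul_comm]

lemma ceil_logb_le {δ : ℝ} (h0 : 0 < δ) (h1 : δ < 1) :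
    (⌈Real.logb 2 δ⁻¹⌉₊ : ℝ) ≤ 2 * Real.log δ⁻¹ + 1 := by
  have h2 : 0 ≤ Real.log δ⁻¹ := Real.log_nonneg ((one_le_inv₀ h0).2 h1.le)
  have h3 := Real.log_two_gt_d9
  have h4 : Real.logb 2 δ⁻¹ ≤ 2 * Real.log δ⁻¹ := by
    rw [Real.logb, div_le_iff₀ (by linarith)]
    nlinarith
  refine (Nat.ceil_lt_add_one ?_).le.trans (by linarith)
  exact Real.logb_nonneg (by norm_num) ((one_le_inv₀ h0).2 h1.le)

lemma one_div_two_pow_ceil_logb_le {δ : ℝ} (h0 : 0 < δ) :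
    1 / (2 : ℝ) ^ ⌈Real.logb 2 δ⁻¹⌉₊ ≤ δ := by
  rw [one_div]
  refine inv_le_of_inv_le₀ h0 ?_
  rw [← Real.rpow_natCast]
  calc δ⁻¹ = (2 : ℝ) ^ Real.logb 2 δ⁻¹ :=
        (Real.rpow_logb (by norm_num) (by norm_num) (inv_pos.2 h0)).symm
    _ ≤ _ := Real.rpow_le_rpow_of_exponent_le (by norm_num) (Nat.le_ceil _)

/-- The polynomial `Q`, as a polynomial in the `i`-th variable. -/
noncomputable def inVar {σ : Type} (Q : Polynomial ℕ) (i : σ) : MvPolynomial σ ℝ :=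
  Q.eval₂ (Nat.castRingHom _) (MvPolynomial.X i)

lemma eval_inVar {σ : Type} (Q : Polynomial ℕ) {i : σ} {v : σ → ℝ} {n : ℕ} (h : v i = n) :
    (inVar Q i).eval v = (Q.eval n : ℕ) := by
  rw [inVar, Polynomial.hom_eval₂, MvPolynomial.eval_X, h, Polynomial.eval₂_at_natCast]
  simp

/-- The simulation of the machine takes polynomial time. -/
lemma exists_testTime_le {f n' : List Bool → ℕ} (hM : M.CountsPaths f)
    (hn : M.ChoicesBoundedBy n') :
    ∃ Q : Polynomial ℕ, ∀ x : List Bool, ∃ (t : ℕ) (T : CompTree M.Cfg),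
      M.Runs (M.init ![x]) t T ∧ T.height ≤ n' x ∧ T.numBr = f x ∧
      testTime M x.length t (n' x) + n' x ≤ Q.eval x.length := by
  obtain ⟨p, hp⟩ := hM
  obtain ⟨hh, q, hq⟩ := hn
  refine ⟨7 * q + 7 * .X + (p * (stepCost M + 7 : ℕ) + 1) +
    (Fintype.card M.K : ℕ) * ((.X + (p * (stepCost M + 7 : ℕ) + 1)) * 2 + 2) + 12, fun x => ?_⟩
  obtain ⟨t, T, h, ht, hf⟩ := hp x
  refine ⟨t, T, h, hh x t T h, by rw [numLeaves_eq] at hf; omega, ?_⟩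
  have h1 := hq x
  simp only [Polynomial.eval_add, Polynomial.eval_mul, Polynomial.eval_X, Polynomial.eval_natCast,
    Polynomial.eval_one, Polynomial.eval_ofNat, testTime, Nat.cast_id]
  have h2 : t * (stepCost M + 7) ≤ p.eval x.length * (stepCost M + 7) := Nat.mul_le_mul_right _ ht
  have h3 : Fintype.card M.K * ((x.length + (t * (stepCost M + 7) + 1)) * 2 + 2) ≤
      Fintype.card M.K * ((x.length + (p.eval x.length * (stepCost M + 7) + 1)) * 2 + 2) := by
    gcongr
  omega

/-! ### Correctness of the machines -/

/-- The input stacks of the approximation scheme. -/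
def countInp : Fin 4 ↪ Aux := ⟨![.x, .n, .k, .d], by decide⟩

/-- The input stacks of the sampler. -/
def sampleInp : Fin 3 ↪ Aux := ⟨![.x, .n, .d], by decide⟩

lemma countInput_eq (x : List Bool) (N K D : ℕ) : countInput x N K D =
    Function.extend countInp ![x, unary N, unary K, unary D] fun _ => [] := by
  have h := countInp.injective.extend_apply ![x, unary N, unary K, unary D] fun _ => []
  funext e
  cases e
  case x => exact (h 0).symm
  case n => exact (h 1).symm
  case k => exact (h 2).symm
  case d => exact (h 3).symm
  all_goals exact (Function.extend_apply' _ _ _ (by decide)).symm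

lemma sampleInput_eq (x : List Bool) (N D : ℕ) : sampleInput x N D =
    Function.extend sampleInp ![x, unary N, unary D] fun _ => [] := by
  have h := sampleInp.injective.extend_apply ![x, unary N, unary D] fun _ => []
  funext e
  cases e
  case x => exact (h 0).symm
  case n => exact (h 1).symm
  case d => exact (h 2).symm
  all_goals exact (Function.extend_apply' _ _ _ (by decide)).symm

/-- A bound for the running time of the approximation scheme, up to the factor `2 ^ (n' / 2)`; the
variables stand for the accuracy, the length of the input, and `log δ⁻¹`. -/
noncomputable def countPoly (Q : Polynomial ℕ) : MvPolynomial (Fin 3) ℝ :=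
  158000 * (.X 0 + 2 * .X 2 + inVar Q 1 + 3) ^ 4

/-- A bound for the running time of the sampler, up to the factor `2 ^ (n' / 2)`; the variables
stand for the length of the input and `log δ⁻¹`. -/
noncomputable def samplePoly (Q : Polynomial ℕ) : MvPolynomial (Fin 2) ℝ :=
  158000 * (2 * .X 1 + inVar Q 0 + 2) ^ 4

/-- The approximation scheme runs in time `2 ^ (n' / 2)`, up to a polynomial factor. -/
lemma hasRAS {f n' : List Bool → ℕ} {Q : Polynomial ℕ}
    (hQ : ∀ x : List Bool, ∃ (t : ℕ) (T : CompTree M.Cfg),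
      M.Runs (M.init ![x]) t T ∧ T.height ≤ n' x ∧ T.numBr = f x ∧
      testTime M x.length t (n' x) + n' x ≤ Q.eval x.length)
    {B : ℕ → ℝ} (hB : ∀ m : ℕ, (2 : ℝ) ^ ((m : ℝ) / 2) ≤ B m) :
    HasRAS f n' (countPoly Q) B := by
  refine ⟨progMachine (countProg M) countInp .cnt, fun x k δ hk hδ0 hδ1 => ?_⟩
  obtain ⟨t, T, h, hT, hf, ht⟩ := hQ x
  set K := ⌈k⌉₊ with hK
  set D := ⌈Real.logb 2 δ⁻¹⌉₊ with hD
  set N := n' x with hN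
  have hK0 : 0 < K := Nat.ceil_pos.2 hk
  obtain ⟨g, hg, hy⟩ := yields_countProg h hT K D
  obtain ⟨t', ht', hr⟩ := progMachine_runs countInp .cnt _ _ (countInput_eq x N K D) hy
  refine ⟨t', _, hr, ?_, ?_⟩
  · have h1 := ht'.trans (countProg_time_le N K D (testTime M x.length t N) le_rfl)
    set Z := K + D + (testTime M x.length t N + N) + 1 with hZ
    have h2 : (t' : ℝ) ≤ 79000 * (Z : ℝ) ^ 4 * 2 ^ ((N + 1) / 2) := by exact_mod_cast h1
    have h3 : (Z : ℝ) ≤ k + 2 * Real.log δ⁻¹ + (Q.eval x.length : ℕ) + 3 := by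
      have e1 : (Z : ℝ) ≤ K + D + (Q.eval x.length : ℕ) + 1 := by
        have : Z ≤ K + D + Q.eval x.length + 1 := by omega
        exact_mod_cast this
      have e2 : (K : ℝ) ≤ k + 1 := (Nat.ceil_lt_add_one hk.le).le
      have e3 := ceil_logb_le hδ0 hδ1
      linarith
    have h4 : MvPolynomial.eval ![k, (x.length : ℝ), Real.log δ⁻¹] (countPoly Q) =
        158000 * (k + 2 * Real.log δ⁻¹ + (Q.eval x.length : ℕ) + 3) ^ 4 := by
      simp only [countPoly, map_mul, map_pow, map_add, map_ofNat, MvPolynomial.eval_X,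
        eval_inVar Q (i := (1 : Fin 3)) (v := ![k, (x.length : ℝ), Real.log δ⁻¹])
          (n := x.length) rfl]
      rfl
    rw [h4]
    calc (t' : ℝ) ≤ 79000 * (Z : ℝ) ^ 4 * 2 ^ ((N + 1) / 2) := h2
      _ ≤ 79000 * (k + 2 * Real.log δ⁻¹ + (Q.eval x.length : ℕ) + 3) ^ 4 * (2 * B N) := by
          gcongr
          exact (two_pow_half_le N).trans (by have := hB N; linarith)
      _ = _ := by ring
  · rw [prob_map]
    simp only [progMachine_outputs, hg]
    have hδ := one_div_two_pow_ceil_logb_le hδ0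
    rw [← hD] at hδ
    have hf0 : (0 : ℝ) ≤ f x := by positivity
    split_ifs with hfin
    · rw [prob_eq_one]
      · linarith
      · rintro _ rfl
        refine ⟨T.numBr, rfl, ?_, ?_⟩
        · rw [hf]
          have : 0 ≤ 1 / k * (f x : ℝ) := by positivity
          linarith
        · rw [hf]
          have : 0 ≤ 1 / k * (f x : ℝ) := by positivity
          linarith
    · rw [prob_map]
      refine le_trans (le_trans (by linarith) (prob_estimate_ge T hT hK0 hfin)) ?_
      refine prob_mono fun X _ hX => ?_
      obtain ⟨y, hy, hyf⟩ := hX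
      refine ⟨y, hy.symm, ?_⟩
      rw [hf] at hyf
      have h1 : 1 / ((K : ℝ) + 1) ≤ 1 / k :=
        one_div_le_one_div_of_le hk ((Nat.le_ceil k).trans (by linarith))
      have h2 := abs_le.1 (hyf.trans (mul_le_mul_of_nonneg_right h1 hf0))
      constructor <;> linarith [h2.1, h2.2]

lemma sampleCode_injective : Function.Injective sampleCode := by
  intro a b h
  cases a <;> cases b <;> simp_all [sampleCode]

/-- The sampler runs in time `2 ^ (n' / 2)`, up to a polynomial factor. -/
lemma hasUniformSampler {f n' : List Bool → ℕ} {Q : Polynomial ℕ}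
    (hQ : ∀ x : List Bool, ∃ (t : ℕ) (T : CompTree M.Cfg),
      M.Runs (M.init ![x]) t T ∧ T.height ≤ n' x ∧ T.numBr = f x ∧
      testTime M x.length t (n' x) + n' x ≤ Q.eval x.length)
    {B : ℕ → ℝ} (hB : ∀ m : ℕ, (2 : ℝ) ^ ((m : ℝ) / 2) ≤ B m) :
    HasUniformSampler M f n' (samplePoly Q) B := by
  refine ⟨progMachine (sampleProg M) sampleInp .out, fun x δ hδ0 hδ1 => ?_⟩
  obtain ⟨t, T, h, hT, hf, ht⟩ := hQ x
  set D := ⌈Real.logb 2 δ⁻¹⌉₊ with hD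
  set N := n' x with hN
  obtain ⟨g, hg, hy⟩ := yields_sampleProg h hT D
  obtain ⟨t', ht', hr⟩ := progMachine_runs sampleInp .out _ _ (sampleInput_eq x N D) hy
  have hfail : ∀ r : Option (List Bool),
      sampleCode (r.map List.reverse) = sampleCode none ↔ r = none := by
    intro r
    rw [sampleCode_injective.eq_iff]
    simp
  have hsome : ∀ (r : Option (List Bool)) (w : List Bool),
      sampleCode (r.map List.reverse) = sampleCode (some w) ↔ r = some w.reverse := by
    intro r w
    rw [sampleCode_injective.eq_iff]
    cases r with
    | none => simp
    | some u => simp [List.reverse_eq_iff]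
  refine ⟨t', _, hr, ?_, ?_, ?_, ?_⟩
  · have h1 := ht'.trans (sampleProg_time_le N D (testTime M x.length t N) le_rfl)
    set Z := D + (testTime M x.length t N + N) + 1 with hZ
    have h2 : (t' : ℝ) ≤ 79000 * (Z : ℝ) ^ 4 * 2 ^ ((N + 1) / 2) := by exact_mod_cast h1
    have h3 : (Z : ℝ) ≤ 2 * Real.log δ⁻¹ + (Q.eval x.length : ℕ) + 2 := by
      have e1 : (Z : ℝ) ≤ D + (Q.eval x.length : ℕ) + 1 := by
        have : Z ≤ D + Q.eval x.length + 1 := by omega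
        exact_mod_cast this
      have e3 := ceil_logb_le hδ0 hδ1
      linarith
    have h4 : MvPolynomial.eval ![(x.length : ℝ), Real.log δ⁻¹] (samplePoly Q) =
        158000 * (2 * Real.log δ⁻¹ + (Q.eval x.length : ℕ) + 2) ^ 4 := by
      simp only [samplePoly, map_mul, map_pow, map_add, map_ofNat, MvPolynomial.eval_X,
        eval_inVar Q (i := (0 : Fin 2)) (v := ![(x.length : ℝ), Real.log δ⁻¹])
          (n := x.length) rfl]
      rfl
    rw [h4]
    calc (t' : ℝ) ≤ 79000 * (Z : ℝ) ^ 4 * 2 ^ ((N + 1) / 2) := h2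
      _ ≤ 79000 * (2 * Real.log δ⁻¹ + (Q.eval x.length : ℕ) + 2) ^ 4 * (2 * B N) := by
          gcongr
          exact (two_pow_half_le N).trans (by have := hB N; linarith)
      _ = _ := by ring
  · refine prob_eq_one fun c hc => ?_
    obtain ⟨r, -, rfl⟩ := mem_map.1 hc
    exact ⟨_, (progMachine_outputs _ _ _ _).2 (hg r)⟩
  · intro h0
    rw [prob_map]
    simp only [progMachine_outputs, hg, hfail]
    exact (prob_fail_le T hT (by omega) D).trans (one_div_two_pow_ceil_logb_le hδ0)
  · intro s S hS w
    obtain ⟨-, rfl⟩ := hS.unique h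
    rw [prob_map, prob_map]
    simp only [progMachine_outputs, hg, hfail, hsome]
    have hG : ∀ u, (sampleTrial S N).Mem (some u) → u ∈ S.addrs [] := fun u hu =>
      (mem_addrs_nil S).2 (isBranching_of_mem_sampleTrial hu)
    have hw : w.reverse ∈ S.addrs [] ↔ S.IsBranching w := by
      rw [mem_addrs_nil, List.reverse_reverse]
    constructor
    · intro hb
      have hmem := hw.2 hb
      rw [prob_retry_eq (nodup_addrs S []) (List.length_pos_of_mem hmem) hG
        (fun u hu => prob_sampleTrial S hT hu) _ hmem, length_addrs, hf]
    · intro hb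
      refine prob_eq_zero fun r hr he => hb (hw.1 ?_)
      exact mem_retry_iter (P := (· ∈ S.addrs [])) hG hr _ he

theorem mainTheorem4 :
    ∀ f ∈ TotP, ∀ M : ChoiceTM 1, M.CountsPaths f →
    ∀ n' : List Bool → ℕ, M.ChoicesBoundedBy n' →
    ∃ (p : MvPolynomial (Fin 3) ℝ) (q : MvPolynomial (Fin 2) ℝ),
      (∀ s : ℕ → ℕ, (∀ m, 0 < s m) →
        HasRAS f n' p
          (fun m => (2 : ℝ) ^ m / (s m : ℝ) + (2 : ℝ) ^ ((m : ℝ) / 2) * (s m : ℝ) ^ (1 / 2 : ℝ)) ∧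
        HasUniformSampler M f n' q
          (fun m => (2 : ℝ) ^ m / (s m : ℝ) +
            (2 : ℝ) ^ ((m : ℝ) / 2) * (s m : ℝ) ^ (1 / 2 : ℝ))) ∧
      (∀ β : ℝ, 0 < β → β < 1 →
        HasRAS f n' p
          (fun m => (2 : ℝ) ^ ((1 - β) * (m : ℝ)) + (2 : ℝ) ^ ((1 + β) * (m : ℝ) / 2)) ∧
        HasUniformSampler M f n' q
          (fun m => (2 : ℝ) ^ ((1 - β) * (m : ℝ)) + (2 : ℝ) ^ ((1 + β) * (m : ℝ) / 2))) ∧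
      HasRAS f n' p (fun m => (2 : ℝ) ^ (2 * (m : ℝ) / 3)) ∧
      HasUniformSampler M f n' q (fun m => (2 : ℝ) ^ (2 * (m : ℝ) / 3)) := by
  intro f _ M hM n' hn
  obtain ⟨Q, hQ⟩ := exists_testTime_le hM hn
  refine ⟨countPoly Q, samplePoly Q, fun s hs => ?_, fun β h0 h1 => ?_, ?_⟩
  · have hB : ∀ m : ℕ, (2 : ℝ) ^ ((m : ℝ) / 2) ≤
        (2 : ℝ) ^ m / (s m : ℝ) + (2 : ℝ) ^ ((m : ℝ) / 2) * (s m : ℝ) ^ (1 / 2 : ℝ) := by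
      intro m
      have h1 : (1 : ℝ) ≤ (s m : ℝ) ^ (1 / 2 : ℝ) :=
        Real.one_le_rpow (by exact_mod_cast hs m) (by norm_num)
      have h2 : (0 : ℝ) ≤ (2 : ℝ) ^ m / (s m : ℝ) := by positivity
      have h3 := le_mul_of_one_le_right
        (Real.rpow_nonneg (by norm_num : (0 : ℝ) ≤ 2) ((m : ℝ) / 2)) h1
      linarith
    exact ⟨hasRAS hQ hB, hasUniformSampler hQ hB⟩
  · have hB : ∀ m : ℕ, (2 : ℝ) ^ ((m : ℝ) / 2) ≤
        (2 : ℝ) ^ ((1 - β) * (m : ℝ)) + (2 : ℝ) ^ ((1 + β) * (m : ℝ) / 2) := by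
      intro m
      have h2 : (0 : ℝ) ≤ (2 : ℝ) ^ ((1 - β) * (m : ℝ)) := by positivity
      have h3 : (2 : ℝ) ^ ((m : ℝ) / 2) ≤ (2 : ℝ) ^ ((1 + β) * (m : ℝ) / 2) := by
        refine Real.rpow_le_rpow_of_exponent_le (by norm_num) ?_
        have : (0 : ℝ) ≤ β * m := by positivity
        linarith
      linarith
    exact ⟨hasRAS hQ hB, hasUniformSampler hQ hB⟩
  · have hB : ∀ m : ℕ, (2 : ℝ) ^ ((m : ℝ) / 2) ≤ (2 : ℝ) ^ (2 * (m : ℝ) / 3) := by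
      intro m
      refine Real.rpow_le_rpow_of_exponent_le (by norm_num) ?_
      have : (0 : ℝ) ≤ m := by positivity
      linarith
    exact ⟨hasRAS hQ hB, hasUniformSampler hQ hB⟩
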